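/- Let $(M,\omega)$ be a $4$-dimensional symplectic manifold and let $F=(H,J):M\to\mathbb R^2$ be smooth, where $J$ is the momentum of a smooth Hamiltonian action of $\mathbb S^1=\mathbb R/2\pi\mathbb Z$ on $M$ (with generator $X_J$) that leaves $H$ and $J$ invariant, so that $\{H,J\}=0$. Let $\mathcal R$ be the set of values $v\in F(M)$ such that $dF$ has rank $2$ at all points of $F^{-1}(v)$; assume that for $v\in\mathcal R$ the fibre $F^{-1}(v)$ is compact and connected and that $\mathbb S^1$ acts freely on it. Let $\vartheta$ be a rotation $1$-form: a smooth closed $1$-form on an open $\mathbb S^1$-invariant set $M'\subset M$ with $\vartheta(X_J)=1$; let $\Pi=M\setminus M'$ be its polar set. For $p\in F^{-1}(v)$, $v\in\mathcal R$, let $T(p)$ be the least $t>0$ at which the $X_H$-orbit of $p$ meets $\mathbb S^1p$, let $p'$ be the point reached at time $T(p)$, let the rotation number $\Theta(p)\in[0,2\pi)$ be the least $\tau\ge 0$ for which the flow of $X_J$ takes $p$ to $p'$ in time $\tau$, and let $\Phi(p)=\int_{\gamma_H(p)}\vartheta$, where $\gamma_H(p)$ is the $X_H$-orbit segment from $p$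 to $p'$. Then these minima exist, $T$ and $\Theta$ are constant on the fibres over $\mathcal R$, and $\Phi$ is constant on those fibres over $\mathcal R$ that do not meet $\Pi$; we write $\Theta(v)$ and $\Phi(v)$. If $g:\mathbb R/2\pi\mathbb Z\to\mathbb R$ has finitely many discontinuities $s_1,\dots,s_k$ (points where $g$ is not defined count as such, with an arbitrary value assigned there) and the jumps $d_j=\lim_{\varepsilon\to0^+}\bigl(g(s_j+\varepsilon)-g(s_j-\varepsilon)\bigr)$ exist, its variation is $-\sum_j d_j$; for a closed path $\Gamma:\mathbb R/2\pi\mathbb Z\to\mathcal R$ write $\operatorname{var}_\Gamma g$ for the variation of $g\circ\Gamma$. (a) Suppose that $\Pi$ is a smooth embedded surface near each of its points that is not fixed by the $\mathbb S^1$-action. Let $\Gamma:\mathbb R/2\pi\mathbb Z\to\mathcal R$ be a $C^1$ closed path that intersects $F(\Pi)$ transversally, that is, $\mathbb R\,\Gamma'(s)+dF(T_p\Pi)=\mathbb R^2$ whenever $p\in\Pi$ and $F(p)=\Gamma(s)$. Then $\Gamma(s)\in F(\Pi)$ for only finitely many $s$, $\Phi\circ\Gamma$ is continuous at all other $s$,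 and $\operatorname{var}_\Gamma\Phi$ exists. If moreover $\Theta\circ\Gamma$ has only finitely many discontinuities, then $\operatorname{var}_\Gamma\Theta$ exists and $$\operatorname{var}_\Gamma\Phi=\operatorname{var}_\Gamma\Theta .$$ (b) Let $v\in\mathcal R$ with $F^{-1}(v)\cap\Pi=\emptyset$. Then $\Phi(v)\equiv\Theta(v)\pmod{2\pi}$ if and only if there is a cycle $\delta$ in $F^{-1}(v)$ such that the class of $\delta$ and the class of an $X_J$-orbit form a basis of $H_1(F^{-1}(v);\mathbb Z)$ and $\int_\delta\vartheta=0$. -/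

import Mathlib

open Set Filter Topology
open scoped Manifold ContDiff

namespace RotationForm

noncomputable section

/-- The model space of four-dimensional manifolds. -/
abbrev E4 : Type := EuclideanSpace ℝ (Fin 4)

section Forms

variable {M : Type*} [TopologicalSpace M] [ChartedSpace E4 M]

/-- The differential of the inverse of the chart around `x`, at the point `y` of its target. -/
def chartInvDeriv (x : M) (y : E4) :
    E4 →L[ℝ] TangentSpace (𝓡 4) ((extChartAt (𝓡 4) x).symm y) :=
  mfderiv 𝓘(ℝ, E4) (𝓡 4) (extChartAt (𝓡 4) x).symm y

/-- A 1-form written in the chart around `x`. -/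
def oneFormInChart (θ : ∀ p : M, TangentSpace (𝓡 4) p →L[ℝ] ℝ) (x : M) (y : E4) :
    E4 →L[ℝ] ℝ :=
  (θ ((extChartAt (𝓡 4) x).symm y)).comp (chartInvDeriv x y)

/-- A field of bilinear forms written in the chart around `x`. -/
def twoFormInChart
    (Ω : ∀ p : M, TangentSpace (𝓡 4) p →L[ℝ] TangentSpace (𝓡 4) p →L[ℝ] ℝ) (x : M) (y : E4) :
    E4 →L[ℝ] E4 →L[ℝ] ℝ :=
  let B : E4 →L[ℝ] E4 →L[ℝ] ℝ := Ω ((extChartAt (𝓡 4) x).symm y)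
  let A : E4 →L[ℝ] E4 := chartInvDeriv x y
  B.bilinearComp A A

variable (M) in
/-- A symplectic form on a 4-manifold: a smooth, closed, nondegenerate 2-form. Smoothness and
closedness are expressed in the charts. -/
structure SymplecticForm where
  form : ∀ p : M, TangentSpace (𝓡 4) p →L[ℝ] TangentSpace (𝓡 4) p →L[ℝ] ℝ
  alternating : ∀ (p : M) (u : TangentSpace (𝓡 4) p), form p u u = 0
  nondegenerate : ∀ (p : M) (u : TangentSpace (𝓡 4) p),
    (∀ v : TangentSpace (𝓡 4) p, form p u v = 0) → u = 0
  smooth : ∀ x : M, ContDiffOn ℝ ∞ (twoFormInChart form x) (extChartAt (𝓡 4) x).target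
  closed : ∀ x : M, ∀ y ∈ (extChartAt (𝓡 4) x).target, ∀ a b c : E4,
    fderiv ℝ (twoFormInChart form x) y a b c - fderiv ℝ (twoFormInChart form x) y b a c
      + fderiv ℝ (twoFormInChart form x) y c a b = 0

/-- The Hamiltonian vector field `X_f`: the vector field with `Ω(X_f, ·) = df`. -/
def hamVec (Ω : SymplecticForm M) (f : M → ℝ) (p : M) : TangentSpace (𝓡 4) p :=
  Classical.epsilon fun X : TangentSpace (𝓡 4) p =>
    ∀ v : TangentSpace (𝓡 4) p, Ω.form p X v = mfderiv (𝓡 4) 𝓘(ℝ, ℝ) f p v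

/-- The energy-momentum map. -/
def energyMomentum (H J : M → ℝ) (p : M) : ℝ × ℝ := (H p, J p)

/-- The fibre of the energy-momentum map over `v`. -/
def fibre (H J : M → ℝ) (v : ℝ × ℝ) : Set M := {p | energyMomentum H J p = v}

/-- The values of the energy-momentum map whose fibre consists of regular points. -/
def regularValues (H J : M → ℝ) : Set (ℝ × ℝ) :=
  {v | (fibre H J v).Nonempty ∧ ∀ p ∈ fibre H J v,
    Function.Surjective (mfderiv (𝓡 4) 𝓘(ℝ, ℝ × ℝ) (energyMomentum H J) p)}

/-- An integrable system with two degrees of freedom with integrals `H` and `J`, where `J` is the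
momentum of a Hamiltonian action of the circle `ℝ / 2πℤ` that leaves `H` and `J` invariant. -/
structure IsCircleIntegrable [MulAction Circle M] (Ω : SymplecticForm M) (H J : M → ℝ) :
    Prop where
  smooth_H : ContMDiff (𝓡 4) 𝓘(ℝ, ℝ) ∞ H
  smooth_J : ContMDiff (𝓡 4) 𝓘(ℝ, ℝ) ∞ J
  commute : ∀ p : M, Ω.form p (hamVec Ω H p) (hamVec Ω J p) = 0
  smooth_action : ContMDiff ((𝓡 1).prod (𝓡 4)) (𝓡 4) ∞ fun z : Circle × M => z.1 • z.2
  symplectic : ∀ (z : Circle) (p : M) (u v : TangentSpace (𝓡 4) p),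
    Ω.form (z • p) (mfderiv (𝓡 4) (𝓡 4) (fun q : M => z • q) p u)
      (mfderiv (𝓡 4) (𝓡 4) (fun q : M => z • q) p v) = Ω.form p u v
  generator : ∀ p : M,
    IsMIntegralCurve (I := 𝓡 4) (fun t : ℝ => Circle.exp t • p) (hamVec Ω J)
  invariant_H : ∀ (z : Circle) (p : M), H (z • p) = H p
  invariant_J : ∀ (z : Circle) (p : M), J (z • p) = J p

/-- A rotation 1-form: a smooth closed 1-form `θ` on an open circle-invariant set `M'` with
`θ(X_J) = 1` there. Its values outside `M'` are irrelevant; the poles are the points outside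
`M'`. -/
structure IsRotationForm [MulAction Circle M] (Ω : SymplecticForm M) (J : M → ℝ) (M' : Set M)
    (θ : ∀ p : M, TangentSpace (𝓡 4) p →L[ℝ] ℝ) : Prop where
  isOpen : IsOpen M'
  invariant : ∀ (z : Circle), ∀ p ∈ M', z • p ∈ M'
  smooth : ∀ x : M, ContDiffOn ℝ ∞ (oneFormInChart θ x)
    ((extChartAt (𝓡 4) x).target ∩ (extChartAt (𝓡 4) x).symm ⁻¹' M')
  closed : ∀ x : M, ∀ y ∈ (extChartAt (𝓡 4) x).target, (extChartAt (𝓡 4) x).symm y ∈ M' →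
    ∀ a b : E4, fderiv ℝ (oneFormInChart θ x) y a b = fderiv ℝ (oneFormInChart θ x) y b a
  normalized : ∀ p ∈ M', θ p (hamVec Ω J p) = 1

end Forms

section RotationNumber

variable {M : Type*} [TopologicalSpace M] [ChartedSpace E4 M]

open Classical in
/-- The integral curve of `X_H` that starts at `p`, if it is defined for all times. -/
def flowH (Ω : SymplecticForm M) (H : M → ℝ) (p : M) : ℝ → M :=
  if h : ∃ γ : ℝ → M, γ 0 = p ∧ IsMIntegralCurve (I := 𝓡 4) γ (hamVec Ω H) then h.choose
  else fun _ => p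

/-- The positive times at which the `X_H`-orbit of `p` meets the circle orbit of `p`. -/
def returnTimes [MulAction Circle M] (Ω : SymplecticForm M) (H : M → ℝ) (p : M) : Set ℝ :=
  {t | 0 < t ∧ ∃ z : Circle, flowH Ω H p t = z • p}

/-- The first return time `T(p)`. -/
def firstReturn [MulAction Circle M] (Ω : SymplecticForm M) (H : M → ℝ) (p : M) : ℝ :=
  sInf (returnTimes Ω H p)

/-- The times `τ ≥ 0` for which the flow of `X_J` leads from `p` to the first return point. -/
def rotationTimes [MulAction Circle M] (Ω : SymplecticForm M) (H : M → ℝ) (p : M) : Set ℝ :=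
  {τ | 0 ≤ τ ∧ Circle.exp τ • p = flowH Ω H p (firstReturn Ω H p)}

/-- The rotation number `Θ(p)`. -/
def rotationNumber [MulAction Circle M] (Ω : SymplecticForm M) (H : M → ℝ) (p : M) : ℝ :=
  sInf (rotationTimes Ω H p)

/-- The integral `Φ(p)` of `θ` along the `X_H`-orbit segment from `p` to its first return
point. -/
def orbitIntegral [MulAction Circle M] (Ω : SymplecticForm M) (H : M → ℝ)
    (θ : ∀ p : M, TangentSpace (𝓡 4) p →L[ℝ] ℝ) (p : M) : ℝ :=
  ∫ t in (0 : ℝ)..firstReturn Ω H p, θ (flowH Ω H p t) (hamVec Ω H (flowH Ω H p t))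

open Classical in
/-- A function on phase space, regarded as a function of the values of the energy-momentum map by
evaluation at a point of the fibre (meaningful where the function is constant on fibres). -/
def onValues (H J : M → ℝ) (f : M → ℝ) (v : ℝ × ℝ) : ℝ :=
  if h : (fibre H J v).Nonempty then f h.some else 0

end RotationNumber

section Transversality

variable {M : Type*} [TopologicalSpace M] [ChartedSpace E4 M]

/-- Near `p`, the set `S` is an embedded smooth surface (of dimension two in the 4-manifold). -/
def IsSmoothSurfaceAt (S : Set M) (p : M) : Prop :=
  ∃ (U : Set M) (g : M → ℝ × ℝ), IsOpen U ∧ p ∈ U ∧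
    ContMDiffOn (𝓡 4) 𝓘(ℝ, ℝ × ℝ) ∞ g U ∧
    Function.Surjective (mfderiv (𝓡 4) 𝓘(ℝ, ℝ × ℝ) g p) ∧
    S ∩ U = {q | q ∈ U ∧ g q = 0}

/-- The velocities at `p` of curves in `S` through `p`; if `S` is a smooth surface near `p` this
is the tangent space of `S` at `p`. -/
def tangentDirections (S : Set M) (p : M) : Set (TangentSpace (𝓡 4) p) :=
  {v | ∃ c : ℝ → M, c 0 = p ∧ (∀ᶠ t in 𝓝 (0 : ℝ), c t ∈ S) ∧
    HasMFDerivAt 𝓘(ℝ, ℝ) (𝓡 4) c 0 ((1 : ℝ →L[ℝ] ℝ).smulRight (M₂ := E4) v)}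

/-- The path `Γ` is transversal to the image of the surface `S` under the energy-momentum map
`F`: at every crossing the velocity of `Γ` and `dF(T_p S)` span the plane. -/
def IsTransversalToImage (H J : M → ℝ) (S : Set M) (Γ : ℝ → ℝ × ℝ) : Prop :=
  ∀ (s : ℝ), ∀ p ∈ S, energyMomentum H J p = Γ s →
    Submodule.span ℝ ({deriv Γ s} ∪
      {w : ℝ × ℝ | ∃ v ∈ tangentDirections S p,
        mfderiv (𝓡 4) 𝓘(ℝ, ℝ × ℝ) (energyMomentum H J) p v = w}) = ⊤

end Transversality

section Variation

/-- The discontinuities, in one period, of a `2π`-periodic function. -/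
def discontinuities (g : ℝ → ℝ) : Set ℝ :=
  {s | s ∈ Ico 0 (2 * Real.pi) ∧ ¬ ContinuousAt g s}

/-- The `2π`-periodic function `g` has finitely many discontinuities per period, a jump at each of
them, and `c` is its variation, that is, minus the sum of the jumps. -/
def HasVariation (g : ℝ → ℝ) (c : ℝ) : Prop :=
  ∃ (hfin : (discontinuities g).Finite) (d : ℝ → ℝ),
    (∀ s ∈ discontinuities g,
      Tendsto (fun ε : ℝ => g (s + ε) - g (s - ε)) (𝓝[>] 0) (𝓝 (d s))) ∧
    c = -∑ s ∈ hfin.toFinset, d s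

end Variation

section Homology

variable {M : Type*} [TopologicalSpace M] [ChartedSpace E4 M]

/-- The extension of a map on the unit interval to the line by its end values. -/
def extendPath (γ : unitInterval → M) (t : ℝ) : M := γ (projIcc 0 1 zero_le_one t)

/-- The extension of a map on the unit square to the plane. -/
def extendSquare (σ : unitInterval × unitInterval → M) (z : ℝ × ℝ) : M :=
  σ (projIcc 0 1 zero_le_one z.1, projIcc 0 1 zero_le_one z.2)

/-- Smooth singular 1-cubes in a subset of `M`. -/
structure SmoothPath (S : Set M) where
  toFun : unitInterval → M
  smooth : ContMDiffOn 𝓘(ℝ, ℝ) (𝓡 4) ∞ (extendPath toFun) (Icc 0 1)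
  mem : ∀ t, toFun t ∈ S

/-- Smooth singular 2-cubes in a subset of `M`. -/
structure SmoothSquare (S : Set M) where
  toFun : unitInterval × unitInterval → M
  smooth : ContMDiffOn 𝓘(ℝ, ℝ × ℝ) (𝓡 4) ∞ (extendSquare toFun) (Icc 0 1 ×ˢ Icc 0 1)
  mem : ∀ z, toFun z ∈ S

variable {S : Set M}

/-- The face `σ(·, b)`. -/
def SmoothSquare.faceFst (σ : SmoothSquare S) (b : unitInterval) : SmoothPath S where
  toFun t := σ.toFun (t, b)
  smooth := by
    have h := σ.smooth.comp (s := Icc (0 : ℝ) 1) (f := fun t : ℝ => (t, (b : ℝ)))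
      (I := 𝓘(ℝ, ℝ))
      ((contDiff_id.prodMk contDiff_const).contMDiff.contMDiffOn)
      (fun t ht => ⟨ht, b.2⟩)
    refine h.congr fun t _ => ?_
    simp [extendPath, extendSquare]
  mem t := σ.mem _

/-- The face `σ(a, ·)`. -/
def SmoothSquare.faceSnd (σ : SmoothSquare S) (a : unitInterval) : SmoothPath S where
  toFun t := σ.toFun (a, t)
  smooth := by
    have h := σ.smooth.comp (s := Icc (0 : ℝ) 1) (f := fun t : ℝ => ((a : ℝ), t))
      (I := 𝓘(ℝ, ℝ))
      ((contDiff_const.prodMk contDiff_id).contMDiff.contMDiffOn)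
      (fun t ht => ⟨a.2, ht⟩)
    refine h.congr fun t _ => ?_
    simp [extendPath, extendSquare]
  mem t := σ.mem _

variable (S) in
/-- Smooth singular 1-chains with integer coefficients. -/
abbrev OneChain : Type _ := SmoothPath S →₀ ℤ

variable (S) in
/-- The boundary of 1-chains. -/
def boundaryOne : OneChain S →ₗ[ℤ] (S →₀ ℤ) :=
  Finsupp.linearCombination ℤ fun γ : SmoothPath S =>
    Finsupp.single (⟨γ.toFun 1, γ.mem 1⟩ : S) (1 : ℤ)
      - Finsupp.single (⟨γ.toFun 0, γ.mem 0⟩ : S) (1 : ℤ)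

variable (S) in
/-- The 1-cycles. -/
abbrev OneCycle : Submodule ℤ (OneChain S) := LinearMap.ker (boundaryOne S)

/-- The boundary of a 2-cube. -/
def SmoothSquare.boundary (σ : SmoothSquare S) : OneChain S :=
  Finsupp.single (σ.faceFst 0) 1 + Finsupp.single (σ.faceSnd 1) 1
    - Finsupp.single (σ.faceFst 1) 1 - Finsupp.single (σ.faceSnd 0) 1

variable (S) in
/-- The 1-chains that vanish in homology: they are generated by the boundaries of the 2-cubes and
by the degenerate (constant) 1-cubes, as usual for cubical singular chains. -/
def nullChains : Submodule ℤ (OneChain S) :=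
  Submodule.span ℤ (range (SmoothSquare.boundary (S := S)) ∪
    {c | ∃ γ : SmoothPath S, (∀ t, γ.toFun t = γ.toFun 0) ∧ c = Finsupp.single γ 1})

variable (S) in
/-- The first smooth cubical singular homology group of `S` with integer coefficients. -/
abbrev HOne : Type _ := OneCycle S ⧸ (nullChains S).submoduleOf (OneCycle S)

/-- The homology class of a 1-cycle. -/
def homologyClass (c : OneCycle S) : HOne S :=
  Submodule.Quotient.mk c

/-- The integral of a 1-form along a smooth path. -/
def pathIntegral (θ : ∀ p : M, TangentSpace (𝓡 4) p →L[ℝ] ℝ) (γ : SmoothPath S) : ℝ :=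
  ∫ t in (0 : ℝ)..1, θ (extendPath γ.toFun t)
    (mfderivWithin 𝓘(ℝ, ℝ) (𝓡 4) (extendPath γ.toFun) (Icc 0 1) t (1 : ℝ))

/-- The integral of a 1-form along a 1-chain. -/
def chainIntegral (θ : ∀ p : M, TangentSpace (𝓡 4) p →L[ℝ] ℝ) (c : OneChain S) : ℝ :=
  c.sum fun γ n => (n : ℝ) * pathIntegral θ γ

/-- Two homology classes form a basis of the first homology group. -/
def IsHomologyBasis (a b : HOne S) : Prop :=
  LinearIndependent ℤ ![a, b] ∧ Submodule.span ℤ {a, b} = ⊤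

/-- The `X_J`-orbit of `p`, traversed once, as a smooth path in a circle-invariant set. -/
def orbitPath [MulAction Circle M]
    (hact : ContMDiff ((𝓡 1).prod (𝓡 4)) (𝓡 4) ∞ fun z : Circle × M => z.1 • z.2)
    (hS : ∀ (z : Circle), ∀ p ∈ S, z • p ∈ S) (p : S) : SmoothPath S where
  toFun t := Circle.exp (2 * Real.pi * (t : ℝ)) • (p : M)
  smooth := by
    have h1 : ContMDiff 𝓘(ℝ, ℝ) 𝓘(ℝ, ℝ) ∞ fun t : ℝ => 2 * Real.pi * t :=
      (contDiff_const.mul contDiff_id).contMDiff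
    have h2 : ContMDiff 𝓘(ℝ, ℝ) (𝓡 1) ∞ fun t : ℝ => Circle.exp (2 * Real.pi * t) :=
      contMDiff_circleExp.comp h1
    have h3 : ContMDiff 𝓘(ℝ, ℝ) (𝓡 4) ∞ fun t : ℝ => Circle.exp (2 * Real.pi * t) • (p : M) :=
      hact.comp (h2.prodMk contMDiff_const)
    refine h3.contMDiffOn.congr fun t ht => ?_
    simp [extendPath, projIcc_of_mem zero_le_one ht]
  mem t := hS _ _ p.2

/-- The 1-cycle defined by the `X_J`-orbit of `p`. -/
def orbitCycle [MulAction Circle M]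
    (hact : ContMDiff ((𝓡 1).prod (𝓡 4)) (𝓡 4) ∞ fun z : Circle × M => z.1 • z.2)
    (hS : ∀ (z : Circle), ∀ p ∈ S, z • p ∈ S) (p : S) : OneCycle S :=
  ⟨Finsupp.single (orbitPath hact hS p) 1, by
    simp [boundaryOne, orbitPath, LinearMap.mem_ker]⟩

/-- The fibres of the energy-momentum map are circle-invariant. -/
theorem IsCircleIntegrable.smul_mem_fibre [MulAction Circle M] {Ω : SymplecticForm M}
    {H J : M → ℝ} (h : IsCircleIntegrable Ω H J) (v : ℝ × ℝ) (z : Circle) :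
    ∀ p ∈ fibre H J v, z • p ∈ fibre H J v := by
  intro p hp
  have hp' : (H p, J p) = v := hp
  show (H (z • p), J (z • p)) = v
  rw [h.invariant_H, h.invariant_J, hp']

end Homology

end

end RotationForm

open RotationForm

namespace RotationForm

/-! Over a regular value the flow of `X_H` is complete and commutes with the circle action, so the
two flows give an action of `ℝ × ℝ` on the fibre (`torusFlow`). Since `X_H` and `X_J` are
independent there, this action is locally free with relatively open orbits
(`exists_small_torusFlow_free`, `exists_small_torusFlow_eq`), and connectedness makes the fibre a
single orbit. Compactness forces the `X_H`-orbit to return to the circle orbit. The fibre is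
therefore the plane modulo a discrete group of periods, and minimality of `T` and freeness of the
circle action show that this group is generated by `(0, 2π)` and `(T, -Θ)`
(`exists_eq_of_mem_periods`).

On a fibre without poles, the form `θ` pulls back to the plane as `f(t) dt + ds`, because `θ(X_J) =
1` and `θ(X_H)` is invariant under the circle. Its periods are thus `2π` on the circle orbit and `Φ
- Θ` on the return cycle (`chainIntegral_eq_of_mk_eq`). A class that completes the circle orbit to a
basis is plus or minus the return class plus `m` times the circle class, and its integral is `±(Φ -
Θ) + 2πm`; this is (b). The homology enters through lifts to the plane: a functional on paths that
is a difference of end point values of lifts kills boundaries (`linearCombination_eq_zero`), and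
coning lifted paths to the origin shows that the two classes generate (`mk_single_eq`,
`exists_mk_cycle_eq`).

For (a), `Φ` minus a continuous choice of the angle of rotation is a period of a closed form, hence
locally constant off the image of the poles (`exists_orbitIntegral_sub_eq`). The exponential of `Θ`
is continuous along `Γ` and has a continuous lift `L` with `L(s + 2π) = L(s) + c`. Both `Φ ∘ Γ - L`
and, if its discontinuities are finite in number, `Θ ∘ Γ - L` are locally constant off isolated
points. Periodicity then makes the jumps in one period add up to `-c`, so both variations equal `c`
(`hasVariation_of_lift`).

Transversality makes the crossings isolated (`eventually_crossing_eq`): the pole set is invariant,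
so `X_J` is tangent to it and lies in the kernel of `dF`; hence `dF` has rank at most one on its
tangent plane, and `Γ'` must point out of that line. -/

instance (priority := 10000) chartedSpaceE4 : ChartedSpace E4 E4 := chartedSpaceSelf E4

/-! ### Vector fields and integral curves in charts -/

section Charts

variable {M : Type*} [TopologicalSpace M] [ChartedSpace E4 M]

theorem isOpen_target_extChartAt (x : M) : IsOpen (extChartAt (𝓡 4) x).target :=
  isOpen_extChartAt_target x

variable [IsManifold (𝓡 4) ∞ M]

theorem contMDiffAt_extChartAt_of_mem {x p : M} (hp : p ∈ (extChartAt (𝓡 4) x).source) :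
    ContMDiffAt (𝓡 4) 𝓘(ℝ, E4) ∞ (extChartAt (𝓡 4) x) p :=
  contMDiffAt_extChartAt' (by simpa using hp)

theorem contMDiffAt_extChartAt_symm_of_mem {x : M} {y : E4}
    (hy : y ∈ (extChartAt (𝓡 4) x).target) :
    ContMDiffAt 𝓘(ℝ, E4) (𝓡 4) ∞ (extChartAt (𝓡 4) x).symm y :=
  (contMDiffOn_extChartAt_symm x).contMDiffAt ((isOpen_target_extChartAt x).mem_nhds hy)

theorem mfderiv_extChartAt_chartInvDeriv {x : M} {y : E4} (hy : y ∈ (extChartAt (𝓡 4) x).target)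
    (w : E4) :
    mfderiv (𝓡 4) 𝓘(ℝ, E4) (extChartAt (𝓡 4) x) ((extChartAt (𝓡 4) x).symm y)
      (chartInvDeriv x y w) = w := by
  have h := mfderiv_extChartAt_comp_mfderivWithin_extChartAt_symm (I := 𝓡 4) hy
  rw [ModelWithCorners.range_eq_univ, mfderivWithin_univ] at h
  exact DFunLike.congr_fun h w

theorem chartInvDeriv_mfderiv_extChartAt {x : M} {y : E4} (hy : y ∈ (extChartAt (𝓡 4) x).target)
    (w : TangentSpace (𝓡 4) ((extChartAt (𝓡 4) x).symm y)) :
    chartInvDeriv x y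
      (mfderiv (𝓡 4) 𝓘(ℝ, E4) (extChartAt (𝓡 4) x) ((extChartAt (𝓡 4) x).symm y) w) = w := by
  have h := mfderivWithin_extChartAt_symm_comp_mfderiv_extChartAt (I := 𝓡 4) hy
  rw [ModelWithCorners.range_eq_univ, mfderivWithin_univ] at h
  exact DFunLike.congr_fun h w

/-- A function written in a chart has the differential written in the chart. -/
theorem fderiv_comp_extChartAt_symm {E : Type*} [NormedAddCommGroup E] [NormedSpace ℝ E]
    {f : M → E} {x : M} {y : E4} (hy : y ∈ (extChartAt (𝓡 4) x).target)
    (hf : MDifferentiableAt (𝓡 4) 𝓘(ℝ, E) f ((extChartAt (𝓡 4) x).symm y)) (w : E4) :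
    fderiv ℝ (f ∘ (extChartAt (𝓡 4) x).symm) y w
      = mfderiv (𝓡 4) 𝓘(ℝ, E) f ((extChartAt (𝓡 4) x).symm y) (chartInvDeriv x y w) := by
  rw [← mfderiv_eq_fderiv, mfderiv_comp (I' := 𝓡 4) y hf
    ((contMDiffAt_extChartAt_symm_of_mem hy).mdifferentiableAt (by simp))]
  rfl

/-- A vector field written in the chart around `x`. -/
noncomputable def vecInChart (X : ∀ p : M, TangentSpace (𝓡 4) p) (x : M) (y : E4) : E4 :=
  mfderiv (𝓡 4) 𝓘(ℝ, E4) (extChartAt (𝓡 4) x) ((extChartAt (𝓡 4) x).symm y)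
    (X ((extChartAt (𝓡 4) x).symm y))

theorem chartInvDeriv_vecInChart (X : ∀ p : M, TangentSpace (𝓡 4) p) {x : M} {y : E4}
    (hy : y ∈ (extChartAt (𝓡 4) x).target) :
    chartInvDeriv x y (vecInChart X x y) = X ((extChartAt (𝓡 4) x).symm y) :=
  chartInvDeriv_mfderiv_extChartAt hy _

/-- A vector field is smooth if its representatives in the charts are. -/
theorem contMDiff_vectorField_of_chart {X : ∀ p : M, TangentSpace (𝓡 4) p}
    (h : ∀ x : M, ContDiffOn ℝ ∞ (vecInChart X x) (extChartAt (𝓡 4) x).target) :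
    ContMDiff (𝓡 4) (𝓡 4).tangent ∞ (fun p => (⟨p, X p⟩ : TangentBundle (𝓡 4) M)) := by
  have : IsManifold (𝓡 4) 1 M := IsManifold.of_le (n := ∞) (by simp)
  intro x
  have hx : x ∈ (extChartAt (𝓡 4) x).source := mem_extChartAt_source x
  have h1 : ContMDiffAt 𝓘(ℝ, E4) 𝓘(ℝ, E4).tangent ∞
      (fun y => (⟨y, vecInChart X x y⟩ : TangentBundle 𝓘(ℝ, E4) E4)) (extChartAt (𝓡 4) x x) := by
    refine contMDiffAt_vectorSpace_iff_contDiffAt.2 ?_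
    exact (h x).contDiffAt ((isOpen_target_extChartAt x).mem_nhds (mem_extChartAt_target x))
  have h2 := h1.mpullback_vectorField_preimage (I := 𝓡 4) (m := ∞) (n := ∞)
    (contMDiffAt_extChartAt_of_mem hx) (isInvertible_mfderiv_extChartAt hx) (by simp)
  refine h2.congr_of_eventuallyEq ?_
  filter_upwards [extChartAt_source_mem_nhds (I := 𝓡 4) x] with p hp
  have key : VectorField.mpullback (𝓡 4) 𝓘(ℝ, E4) (extChartAt (𝓡 4) x) (vecInChart X x) p
      = X p := by
    refine (isInvertible_mfderiv_extChartAt (I := 𝓡 4) hp).inverse_apply_eq.2 ?_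
    unfold vecInChart
    rw [(extChartAt (𝓡 4) x).left_inv hp]
  exact congrArg (fun w => (⟨p, w⟩ : TangentBundle (𝓡 4) M)) key.symm

/-- Together with `hasMFDerivAt_extChartAt_symm_comp` this translates between integral curves on the
manifold and solutions of a differential equation in the model space, where the existence and
smoothness theorems apply. -/
theorem hasDerivAt_extChartAt_comp {X : ∀ p : M, TangentSpace (𝓡 4) p} {γ : ℝ → M} {t : ℝ} {x : M}
    (hγ : HasMFDerivAt 𝓘(ℝ, ℝ) (𝓡 4) γ t ((1 : ℝ →L[ℝ] ℝ).smulRight (M₂ := E4) (X (γ t))))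
    (ht : γ t ∈ (extChartAt (𝓡 4) x).source) :
    HasDerivAt (fun s => extChartAt (𝓡 4) x (γ s)) (vecInChart X x (extChartAt (𝓡 4) x (γ t))) t := by
  have h1 := ((contMDiffAt_extChartAt_of_mem ht).mdifferentiableAt (by simp)).hasMFDerivAt
  have h2 : HasDerivAt (fun s => extChartAt (𝓡 4) x (γ s)) _ t :=
    HasFDerivAt.hasDerivAt (h1.comp t hγ).hasFDerivAt
  refine h2.congr_deriv ?_
  simp only [vecInChart]
  rw [(extChartAt (𝓡 4) x).left_inv ht]
  change (mfderiv (𝓡 4) 𝓘(ℝ, E4) (extChartAt (𝓡 4) x) (γ t)) ((1:ℝ) • X (γ t)) = _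
  rw [one_smul]

theorem hasMFDerivAt_extChartAt_symm_comp {X : ∀ p : M, TangentSpace (𝓡 4) p} {c : ℝ → E4} {t : ℝ}
    {x : M} (hc : HasDerivAt c (vecInChart X x (c t)) t)
    (ht : c t ∈ (extChartAt (𝓡 4) x).target) :
    HasMFDerivAt 𝓘(ℝ, ℝ) (𝓡 4) (fun s => (extChartAt (𝓡 4) x).symm (c s)) t
      ((1 : ℝ →L[ℝ] ℝ).smulRight (M₂ := E4) (X ((extChartAt (𝓡 4) x).symm (c t)))) := by
  have h1 := ((contMDiffAt_extChartAt_symm_of_mem ht).mdifferentiableAt (by simp)).hasMFDerivAt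
  have h2 := h1.comp t (hc.hasFDerivAt.hasMFDerivAt)
  refine h2.congr_mfderiv ?_
  ext
  change (chartInvDeriv x (c t)) ((1:ℝ) • vecInChart X x (c t)) = (1:ℝ) • _
  rw [one_smul, one_smul, chartInvDeriv_vecInChart X ht]

end Charts

/-! ### Existence, uniqueness and smoothness of Hamiltonian vector fields -/

section Hamiltonian

variable {M : Type*} [TopologicalSpace M] [ChartedSpace E4 M]

/-- Nondegeneracy makes the map from the tangent space to its dual injective, and equality of
dimensions makes it surjective; so the choice in `hamVec` is a genuine one. -/
theorem hamVec_spec (Ω : SymplecticForm M) (f : M → ℝ) (p : M) (v : TangentSpace (𝓡 4) p) :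
    Ω.form p (hamVec Ω f p) v = mfderiv (𝓡 4) 𝓘(ℝ, ℝ) f p v := by
  have hex : ∃ X : TangentSpace (𝓡 4) p,
      ∀ v : TangentSpace (𝓡 4) p, Ω.form p X v = mfderiv (𝓡 4) 𝓘(ℝ, ℝ) f p v := by
    let B : E4 →L[ℝ] E4 →L[ℝ] ℝ := Ω.form p
    let L : E4 →ₗ[ℝ] Module.Dual ℝ E4 :=
      (ContinuousLinearMap.coeLM ℝ).comp (B : E4 →ₗ[ℝ] E4 →L[ℝ] ℝ)
    have hinj : Function.Injective L := by
      rw [injective_iff_map_eq_zero]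
      intro u hu
      exact Ω.nondegenerate p u fun v => by
        exact LinearMap.congr_fun hu v
    have hsurj : Function.Surjective L :=
      (LinearMap.injective_iff_surjective_of_finrank_eq_finrank
        (Subspace.dual_finrank_eq (K := ℝ) (V := E4)).symm).1 hinj
    let d : E4 →L[ℝ] ℝ := mfderiv (𝓡 4) 𝓘(ℝ, ℝ) f p
    obtain ⟨X, hX⟩ := hsurj (d : E4 →ₗ[ℝ] ℝ)
    exact ⟨X, fun v => LinearMap.congr_fun hX v⟩
  exact Classical.epsilon_spec hex v

theorem hamVec_unique (Ω : SymplecticForm M) (f : M → ℝ) (p : M) {X : TangentSpace (𝓡 4) p}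
    (h : ∀ v : TangentSpace (𝓡 4) p, Ω.form p X v = mfderiv (𝓡 4) 𝓘(ℝ, ℝ) f p v) :
    X = hamVec Ω f p := by
  have := Ω.nondegenerate p (X - hamVec Ω f p) fun v => by
    rw [map_sub]
    exact sub_eq_zero.2 ((h v).trans (hamVec_spec Ω f p v).symm)
  exact sub_eq_zero.1 this

theorem antisymm_of_alternating {E : Type*} [AddCommGroup E] [Module ℝ E] [TopologicalSpace E]
    {B : E →L[ℝ] E →L[ℝ] ℝ} (h : ∀ u, B u u = 0) (u v : E) : B u v = -B v u := by
  have h' := h (u + v)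
  simp only [map_add, FunLike.coe_add, Pi.add_apply, h] at h'
  linarith

theorem SymplecticForm.antisymm (Ω : SymplecticForm M) (p : M) (u v : TangentSpace (𝓡 4) p) :
    Ω.form p u v = -Ω.form p v u :=
  antisymm_of_alternating (Ω.alternating p) u v

variable [IsManifold (𝓡 4) ∞ M]

theorem isInvertible_twoFormInChart (Ω : SymplecticForm M) {x : M} {y : E4}
    (hy : y ∈ (extChartAt (𝓡 4) x).target) : (twoFormInChart Ω.form x y).IsInvertible := by
  have hinj : Function.Injective (twoFormInChart Ω.form x y) := by
    rw [injective_iff_map_eq_zero]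
    intro u hu
    have h0 : chartInvDeriv x y u = 0 := Ω.nondegenerate _ _ fun v => by
      have := DFunLike.congr_fun hu (mfderiv (𝓡 4) 𝓘(ℝ, E4) (extChartAt (𝓡 4) x)
        ((extChartAt (𝓡 4) x).symm y) v)
      have h2 : Ω.form ((extChartAt (𝓡 4) x).symm y) (chartInvDeriv x y u)
        (chartInvDeriv x y (mfderiv (𝓡 4) 𝓘(ℝ, E4) (extChartAt (𝓡 4) x)
          ((extChartAt (𝓡 4) x).symm y) v)) = 0 := this
      rwa [chartInvDeriv_mfderiv_extChartAt hy] at h2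
    rw [← mfderiv_extChartAt_chartInvDeriv hy u, h0]
    exact map_zero _
  have hdim : Module.finrank ℝ E4 = Module.finrank ℝ (E4 →L[ℝ] ℝ) := by
    rw [← (LinearMap.toContinuousLinearMap (𝕜 := ℝ) (E := E4) (F' := ℝ)).finrank_eq]
    exact (Subspace.dual_finrank_eq (K := ℝ) (V := E4)).symm
  let e : E4 ≃ₗ[ℝ] (E4 →L[ℝ] ℝ) := LinearEquiv.ofInjectiveOfFinrankEq
    (twoFormInChart Ω.form x y : E4 →ₗ[ℝ] (E4 →L[ℝ] ℝ)) hinj hdim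
  exact ⟨e.toContinuousLinearEquiv, by ext; rfl⟩

theorem vecInChart_hamVec (Ω : SymplecticForm M) {f : M → ℝ}
    (hf : ContMDiff (𝓡 4) 𝓘(ℝ, ℝ) ∞ f) {x : M} {y : E4}
    (hy : y ∈ (extChartAt (𝓡 4) x).target) :
    vecInChart (hamVec Ω f) x y
      = (twoFormInChart Ω.form x y).inverse (fderiv ℝ (f ∘ (extChartAt (𝓡 4) x).symm) y) := by
  rw [eq_comm, (isInvertible_twoFormInChart Ω hy).inverse_apply_eq]
  ext w
  rw [fderiv_comp_extChartAt_symm hy ((hf _).mdifferentiableAt (by simp)), ← hamVec_spec,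
    ← chartInvDeriv_vecInChart (hamVec Ω f) hy]
  rfl

/-- In a chart the field is the inverse of the symplectic form applied to the differential, and
inversion is smooth at invertible linear maps. -/
theorem contDiffOn_vecInChart_hamVec (Ω : SymplecticForm M) {f : M → ℝ}
    (hf : ContMDiff (𝓡 4) 𝓘(ℝ, ℝ) ∞ f) (x : M) :
    ContDiffOn ℝ ∞ (vecInChart (hamVec Ω f) x) (extChartAt (𝓡 4) x).target := by
  have hopen := isOpen_target_extChartAt x
  have h1 : ContDiffOn ℝ ∞ (fun y => (twoFormInChart Ω.form x y).inverse
      (fderiv ℝ (f ∘ (extChartAt (𝓡 4) x).symm) y)) (extChartAt (𝓡 4) x).target := by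
    intro y hy
    have h2 : ContDiffAt ℝ ∞ (f ∘ (extChartAt (𝓡 4) x).symm) y :=
      ((hf _).comp y (contMDiffAt_extChartAt_symm_of_mem hy)).contDiffAt
    have h3 := h2.fderiv_right (m := ∞) (by simp)
    have h4 := (isInvertible_twoFormInChart Ω hy).contDiffAt_map_inverse.comp y
      ((Ω.smooth x).contDiffAt (hopen.mem_nhds hy))
    exact (h4.clm_apply h3).contDiffWithinAt
  exact h1.congr fun y hy => vecInChart_hamVec Ω hf hy

theorem contMDiff_hamVec (Ω : SymplecticForm M) {f : M → ℝ}
    (hf : ContMDiff (𝓡 4) 𝓘(ℝ, ℝ) ∞ f) :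
    ContMDiff (𝓡 4) (𝓡 4).tangent ∞ (fun p => (⟨p, hamVec Ω f p⟩ : TangentBundle (𝓡 4) M)) :=
  contMDiff_vectorField_of_chart (contDiffOn_vecInChart_hamVec Ω hf)

end Hamiltonian

/-! ### Local flows, and completeness on compact invariant sets -/

section LocalFlow

variable {M : Type*} [TopologicalSpace M] [ChartedSpace E4 M] [IsManifold (𝓡 4) ∞ M]

/-- The local flow of a smooth vector field exists and is continuous. -/
theorem exists_local_flow {X : ∀ p : M, TangentSpace (𝓡 4) p}
    (hX : ∀ x : M, ContDiffOn ℝ ∞ (vecInChart X x) (extChartAt (𝓡 4) x).target) (p : M) :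
    ∃ ε > 0, ∃ U ∈ 𝓝 p, ∃ α : ℝ × M → M,
      (∀ q ∈ U, α (0, q) = q ∧
        IsMIntegralCurveOn (I := 𝓡 4) (fun t => α (t, q)) X (Ioo (-ε) ε)) ∧
      ContinuousOn α (Ioo (-ε) ε ×ˢ U) := by
  have hopen := isOpen_target_extChartAt p
  have hpt : extChartAt (𝓡 4) p p ∈ (extChartAt (𝓡 4) p).target := mem_extChartAt_target p
  have hc : ContDiffAt ℝ 1 (vecInChart X p) (extChartAt (𝓡 4) p p) :=
    ((hX p).contDiffAt (hopen.mem_nhds hpt)).of_le (by simp)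
  obtain ⟨ε₀, hε₀, a, r, L, K, hr, hpl⟩ := IsPicardLindelof.of_contDiffAt_one hc
  obtain ⟨β, hβ, hβc⟩ := (hpl 0).exists_forall_mem_closedBall_eq_hasDerivWithinAt_continuousOn
  simp only [zero_sub, zero_add] at hβ hβc
  have hr' : (0 : ℝ) < r := hr
  have hnhds : Metric.closedBall (extChartAt (𝓡 4) p p) (r : ℝ) ×ˢ Icc (-ε₀) ε₀
      ∈ 𝓝 (extChartAt (𝓡 4) p p, (0 : ℝ)) :=
    prod_mem_nhds (Metric.closedBall_mem_nhds _ hr') (Icc_mem_nhds (by linarith) hε₀)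
  have hβat : ContinuousAt β (extChartAt (𝓡 4) p p, (0 : ℝ)) := hβc.continuousAt hnhds
  have hβ0 : β (extChartAt (𝓡 4) p p, 0) = extChartAt (𝓡 4) p p :=
    (hβ _ (Metric.mem_closedBall_self hr'.le)).1
  -- The Picard–Lindelöf flow `β` lives in the model space; times and initial points are shrunk
  -- until it stays in the target of the chart and can be carried back.
  have hpre : β ⁻¹' (extChartAt (𝓡 4) p).target ∈ 𝓝 (extChartAt (𝓡 4) p p, (0 : ℝ)) :=
    hβat (by rw [hβ0]; exact hopen.mem_nhds hpt)
  obtain ⟨V, hV, W, hW, hVW⟩ := mem_nhds_prod_iff.1 (inter_mem hnhds hpre)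
  obtain ⟨ε, hε, hεW⟩ := Metric.mem_nhds_iff.1 hW
  rw [Real.ball_eq_Ioo, zero_sub, zero_add] at hεW
  have h0 : (0 : ℝ) ∈ Ioo (-ε) ε := ⟨by linarith, hε⟩
  have hU : (extChartAt (𝓡 4) p).source ∩ extChartAt (𝓡 4) p ⁻¹' V ∈ 𝓝 p :=
    inter_mem (extChartAt_source_mem_nhds p) (continuousAt_extChartAt p hV)
  have hmem : ∀ q ∈ (extChartAt (𝓡 4) p).source ∩ extChartAt (𝓡 4) p ⁻¹' V, ∀ t ∈ Ioo (-ε) ε,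
      (extChartAt (𝓡 4) p q ∈ Metric.closedBall (extChartAt (𝓡 4) p p) (r : ℝ) ∧
        t ∈ Icc (-ε₀) ε₀) ∧ β (extChartAt (𝓡 4) p q, t) ∈ (extChartAt (𝓡 4) p).target := by
    intro q hq t ht
    have h := hVW (mk_mem_prod (a := extChartAt (𝓡 4) p q) hq.2 (hεW ht))
    exact ⟨⟨h.1.1, h.1.2⟩, h.2⟩
  have hin : ∀ t ∈ Ioo (-ε) ε, Icc (-ε₀) ε₀ ∈ 𝓝 t := by
    intro t ht
    have hpV : extChartAt (𝓡 4) p p ∈ V := mem_of_mem_nhds hV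
    have hsub : Ioo (-ε) ε ⊆ Icc (-ε₀) ε₀ := fun s hs =>
      (hmem p ⟨mem_extChartAt_source p, hpV⟩ s hs).1.2
    exact mem_of_superset (isOpen_Ioo.mem_nhds ht) hsub
  refine ⟨ε, hε, _, hU, fun z => (extChartAt (𝓡 4) p).symm (β (extChartAt (𝓡 4) p z.2, z.1)),
    fun q hq => ⟨?_, ?_⟩, ?_⟩
  · change (extChartAt (𝓡 4) p).symm (β (extChartAt (𝓡 4) p q, 0)) = q
    rw [(hβ _ (hmem q hq 0 h0).1.1).1, (extChartAt (𝓡 4) p).left_inv hq.1]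
  · intro t ht
    have h1 := ((hβ _ (hmem q hq t ht).1.1).2 t (hmem q hq t ht).1.2).hasDerivAt (hin t ht)
    exact (hasMFDerivAt_extChartAt_symm_comp h1 (hmem q hq t ht).2).hasMFDerivWithinAt
  · refine (continuousOn_extChartAt_symm p).comp (hβc.comp ?_ ?_) ?_
    · refine ContinuousOn.prodMk ?_ continuousOn_fst
      exact (continuousOn_extChartAt p).comp continuousOn_snd fun z hz => hz.2.1
    · intro z hz
      exact (hmem z.2 hz.2 z.1 hz.1).1
    · intro z hz
      exact (hmem z.2 hz.2 z.1 hz.1).2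

/-- On a compact set of points each of which has integral curves that do not leave the set, the
integral curves are defined for all times. -/
theorem exists_isMIntegralCurve_of_isCompact [T2Space M] {X : ∀ p : M, TangentSpace (𝓡 4) p}
    (hX : ∀ x : M, ContDiffOn ℝ ∞ (vecInChart X x) (extChartAt (𝓡 4) x).target) {K : Set M}
    (hK : IsCompact K)
    (hinv : ∀ (γ : ℝ → M) (a : ℝ), γ 0 ∈ K → IsMIntegralCurveOn (I := 𝓡 4) γ X (Ioo (-a) a) →
      ∀ t ∈ Ioo (-a) a, γ t ∈ K) {x : M} (hx : x ∈ K) :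
    ∃ γ : ℝ → M, γ 0 = x ∧ IsMIntegralCurve (I := 𝓡 4) γ X := by
  have : IsManifold (𝓡 4) 1 M := IsManifold.of_le (n := ∞) (by simp)
  have hv : ContMDiff (𝓡 4) (𝓡 4).tangent 1 (fun p => (⟨p, X p⟩ : TangentBundle (𝓡 4) M)) :=
    (contMDiff_vectorField_of_chart hX).of_le (by simp)
  -- Compactness provides one existence time for all initial points in `K`.
  obtain ⟨ε, hε, h⟩ : ∃ ε > 0, ∀ x ∈ K, ∃ γ : ℝ → M, γ 0 = x ∧
      IsMIntegralCurveOn (I := 𝓡 4) γ X (Ioo (-ε) ε) := by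
    refine hK.induction_on (p := fun S => ∃ ε > 0, ∀ x ∈ S, ∃ γ : ℝ → M, γ 0 = x ∧
      IsMIntegralCurveOn (I := 𝓡 4) γ X (Ioo (-ε) ε)) ⟨1, one_pos, by simp⟩ ?_ ?_ ?_
    · rintro s t hst ⟨ε, hε, h⟩
      exact ⟨ε, hε, fun x hx => h x (hst hx)⟩
    · rintro s t ⟨ε, hε, h⟩ ⟨ε', hε', h'⟩
      refine ⟨min ε ε', lt_min hε hε', ?_⟩
      rintro x (hx | hx)
      · obtain ⟨γ, h0, hγ⟩ := h x hx
        exact ⟨γ, h0, hγ.mono (Ioo_subset_Ioo (neg_le_neg (min_le_left _ _)) (min_le_left _ _))⟩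
      · obtain ⟨γ, h0, hγ⟩ := h' x hx
        exact ⟨γ, h0, hγ.mono (Ioo_subset_Ioo (neg_le_neg (min_le_right _ _)) (min_le_right _ _))⟩
    · intro p _
      obtain ⟨ε, hε, U, hU, α, hα, -⟩ := exists_local_flow hX p
      exact ⟨U, mem_nhdsWithin_of_mem_nhds hU, ε, hε, fun q hq => ⟨fun t => α (t, q), hα q hq⟩⟩
  -- If the half-lengths of the symmetric intervals of existence had a supremum, a curve defined
  -- almost up to it could be restarted at the times `±(asup - ε / 2)`, both with positions in `K`.
  -- Each restart lasts for time `ε`, so the glued curve reaches `±(asup + ε / 2)`.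
  let s := { a | ∃ γ, γ 0 = x ∧ IsMIntegralCurveOn (I := 𝓡 4) γ X (Ioo (-a) a) }
  suffices hbdd : ¬BddAbove s by
    rw [not_bddAbove_iff] at hbdd
    rw [exists_isMIntegralCurve_iff_exists_isMIntegralCurveOn_Ioo hv]
    intro a
    obtain ⟨y, ⟨γ, hγ1, hγ2⟩, hlt⟩ := hbdd a
    exact ⟨γ, hγ1, hγ2.mono <| Ioo_subset_Ioo (neg_le_neg hlt.le) hlt.le⟩
  intro hbdd
  set asup := sSup s with hasup
  obtain ⟨a, ha, hlt⟩ := Real.add_neg_lt_sSup (⟨ε, h x hx⟩ : Set.Nonempty s) (ε := - (ε / 2))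
    (by rw [neg_lt, neg_zero]; exact half_pos hε)
  rw [← hasup, ← sub_eq_add_neg] at hlt
  obtain ⟨γ, h0, hγ⟩ := ha
  have hεle : ε ≤ asup := le_csSup hbdd (h x hx)
  have hmem := hinv γ a (h0 ▸ hx) hγ
  obtain ⟨γ1_aux, h1_aux, hγ1⟩ :=
    h (γ (-(asup - ε / 2))) (hmem _ ⟨by linarith, by linarith⟩)
  rw [← isMIntegralCurveOn_comp_add (dt := asup - ε / 2)] at hγ1
  set γ1 := γ1_aux ∘ (· + (asup - ε / 2)) with γ1_def
  have heq1 : γ1 (-(asup - ε / 2)) = γ (-(asup - ε / 2)) := by simp [γ1_def, h1_aux]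
  obtain ⟨γ2_aux, h2_aux, hγ2⟩ := h (γ (asup - ε / 2)) (hmem _ ⟨by linarith, by linarith⟩)
  rw [← isMIntegralCurveOn_comp_sub (dt := asup - ε / 2)] at hγ2
  set γ2 := γ2_aux ∘ (· - (asup - ε / 2)) with γ2_def
  have heq2 : γ2 (asup - ε / 2) = γ (asup - ε / 2) := by simp [γ2_def, h2_aux]
  simp_rw [Set.mem_Ioo, ← sub_lt_iff_lt_add, ← lt_sub_iff_add_lt, ← Set.mem_Ioo] at hγ1
  simp_rw [Set.mem_Ioo, lt_sub_iff_add_lt, sub_lt_iff_lt_add, ← Set.mem_Ioo] at hγ2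
  set γ_ext : ℝ → M := piecewise (Ioo (-(asup + ε / 2)) a)
    (piecewise (Ioo (-a) a) γ γ1) γ2 with γ_ext_def
  have heq_ext : γ_ext 0 = x := by
    rw [γ_ext_def, piecewise, if_pos ⟨by linarith, by linarith⟩, piecewise,
      if_pos ⟨by linarith, by linarith⟩, h0]
  suffices hext : IsMIntegralCurveOn (I := 𝓡 4) γ_ext X
      (Ioo (-(asup + ε / 2)) (asup + ε / 2)) from
    (not_lt.mpr <| le_csSup hbdd ⟨γ_ext, heq_ext, hext⟩) <| lt_add_of_pos_right asup (half_pos hε)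
  apply (isMIntegralCurveOn_piecewise (t₀ := asup - ε / 2) hv _ hγ2
      ⟨⟨by linarith, hlt⟩, ⟨by linarith, by linarith⟩⟩
      (by rw [piecewise, if_pos ⟨by linarith, hlt⟩, ← heq2])).mono
    (Ioo_subset_Ioo_union_Ioo le_rfl (by linarith) (by linarith))
  exact (isMIntegralCurveOn_piecewise (t₀ := -(asup - ε / 2)) hv hγ hγ1
      ⟨⟨neg_lt_neg hlt, by linarith⟩, ⟨by linarith, by linarith⟩⟩ heq1.symm).mono
    (union_comm _ _ ▸ Ioo_subset_Ioo_union_Ioo (by linarith) (by linarith) le_rfl)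

end LocalFlow

/-! ### The flow of `X_H` on the regular fibres -/

section Flow

variable {M : Type*} [TopologicalSpace M] [ChartedSpace E4 M] [MulAction Circle M]

/-- A circle-integrable system whose regular fibres are compact, connected and freely acted upon
by the circle. -/
structure IsRegularSystem (Ω : SymplecticForm M) (H J : M → ℝ) : Prop
    extends IsCircleIntegrable Ω H J where
  compact : ∀ v ∈ regularValues H J, IsCompact (fibre H J v)
  connected : ∀ v ∈ regularValues H J, IsConnected (fibre H J v)
  free : ∀ v ∈ regularValues H J, ∀ p ∈ fibre H J v, ∀ z : Circle, z • p = p → z = 1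

/-- The union of the regular fibres. -/
def regularPoints (H J : M → ℝ) : Set M := {p | energyMomentum H J p ∈ regularValues H J}

variable {Ω : SymplecticForm M} {H J : M → ℝ}

theorem IsCircleIntegrable.energyMomentum_smul (h : IsCircleIntegrable Ω H J) (z : Circle) (p : M) :
    energyMomentum H J (z • p) = energyMomentum H J p :=
  Prod.ext (h.invariant_H z p) (h.invariant_J z p)

theorem IsCircleIntegrable.mfderiv_H_hamVec (_h : IsCircleIntegrable Ω H J) (p : M) :
    mfderiv (𝓡 4) 𝓘(ℝ, ℝ) H p (hamVec Ω H p) = (0 : ℝ) :=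
  (hamVec_spec Ω H p _).symm.trans (Ω.alternating p _)

theorem IsCircleIntegrable.mfderiv_J_hamVec (h : IsCircleIntegrable Ω H J) (p : M) :
    mfderiv (𝓡 4) 𝓘(ℝ, ℝ) J p (hamVec Ω H p) = (0 : ℝ) :=
  (hamVec_spec Ω J p _).symm.trans
    ((Ω.antisymm p _ _).trans (neg_eq_zero.2 (h.commute p)))

omit [MulAction Circle M] in
/-- Along a curve with velocity `X`, a function has the derivative `df(X)`. -/
theorem hasDerivAt_comp_of_hasMFDerivAt {E : Type*} [NormedAddCommGroup E] [NormedSpace ℝ E]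
    {f : M → E} {γ : ℝ → M} {t : ℝ} {w : E4} (hf : MDifferentiableAt (𝓡 4) 𝓘(ℝ, E) f (γ t))
    (hγ : HasMFDerivAt 𝓘(ℝ, ℝ) (𝓡 4) γ t ((1 : ℝ →L[ℝ] ℝ).smulRight (M₂ := E4) w)) :
    HasDerivAt (fun s => f (γ s)) (mfderiv (𝓡 4) 𝓘(ℝ, E) f (γ t) w : E) t := by
  have h2 : HasDerivAt (fun s => f (γ s)) _ t :=
    HasFDerivAt.hasDerivAt (hf.hasMFDerivAt.comp t hγ).hasFDerivAt
  refine h2.congr_deriv ?_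
  change (mfderiv (𝓡 4) 𝓘(ℝ, E) f (γ t)) ((1:ℝ) • w) = _
  rw [one_smul]

theorem IsCircleIntegrable.energyMomentum_eq_of_isMIntegralCurveOn (h : IsCircleIntegrable Ω H J)
    {γ : ℝ → M} {a b s t : ℝ} (hγ : IsMIntegralCurveOn (I := 𝓡 4) γ (hamVec Ω H) (Ioo a b))
    (hs : s ∈ Ioo a b) (ht : t ∈ Ioo a b) :
    energyMomentum H J (γ s) = energyMomentum H J (γ t) := by
  have key : ∀ f : M → ℝ, ContMDiff (𝓡 4) 𝓘(ℝ, ℝ) ∞ f →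
      (∀ p, mfderiv (𝓡 4) 𝓘(ℝ, ℝ) f p (hamVec Ω H p) = (0 : ℝ)) → f (γ s) = f (γ t) := by
    intro f hf h0
    have hd : ∀ r ∈ Ioo a b, HasDerivAt (fun r => f (γ r)) 0 r := fun r hr =>
      (hasDerivAt_comp_of_hasMFDerivAt ((hf _).mdifferentiableAt (by simp))
        ((hγ r hr).hasMFDerivAt (isOpen_Ioo.mem_nhds hr))).congr_deriv (h0 _)
    exact (convex_Ioo a b).is_const_of_fderivWithin_eq_zero (𝕜 := ℝ) (f := fun r => f (γ r))
      (fun r hr => (hd r hr).differentiableAt.differentiableWithinAt)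
      (fun r hr => by
        rw [fderivWithin_of_isOpen isOpen_Ioo hr]
        ext
        simpa using (hd r hr).deriv) hs ht
  exact Prod.ext (key H h.smooth_H h.mfderiv_H_hamVec) (key J h.smooth_J h.mfderiv_J_hamVec)

theorem IsCircleIntegrable.contMDiff_smul (h : IsCircleIntegrable Ω H J) (z : Circle) :
    ContMDiff (𝓡 4) (𝓡 4) ∞ fun q : M => z • q :=
  h.smooth_action.comp (contMDiff_const.prodMk contMDiff_id)

theorem IsCircleIntegrable.continuous_smul (h : IsCircleIntegrable Ω H J) :
    Continuous fun z : Circle × M => z.1 • z.2 := h.smooth_action.continuous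

/-- A symplectic diffeomorphism that preserves `H` preserves `X_H`. This is how the two flows are
shown to commute, without Lie brackets. -/
theorem IsCircleIntegrable.mfderiv_smul_hamVec (h : IsCircleIntegrable Ω H J) (z : Circle) (p : M) :
    mfderiv (𝓡 4) (𝓡 4) (fun q : M => z • q) p (hamVec Ω H p) = hamVec Ω H (z • p) := by
  refine hamVec_unique Ω H (z • p) fun w => ?_
  have hd : ∀ (z : Circle) (q : M), MDifferentiableAt (𝓡 4) (𝓡 4) (fun q : M => z • q) q :=
    fun z q => (h.contMDiff_smul z q).mdifferentiableAt (by simp)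
  -- The differential of the action of `z` is surjective, with right inverse the differential of the
  -- action of `z⁻¹`; so it suffices to test against its values, where invariance of the form
  -- applies.
  obtain ⟨u, rfl⟩ : ∃ u, mfderiv (𝓡 4) (𝓡 4) (fun q : M => z • q) p u = w := by
    have h1 := (hd z (z⁻¹ • (z • p))).hasMFDerivAt.comp (z • p) (hd z⁻¹ (z • p)).hasMFDerivAt
    have h2 : (fun q : M => z • q) ∘ (fun q : M => z⁻¹ • q) = id := by
      funext q; simp
    rw [h2] at h1
    have h3 := hasMFDerivAt_unique h1 (hasMFDerivAt_id (I := 𝓡 4) (z • p))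
    have h4 := DFunLike.congr_fun h3 w
    rw [inv_smul_smul] at h4
    exact ⟨_, h4⟩
  refine (h.symplectic z p _ _).trans ((hamVec_spec Ω H p u).trans ?_)
  have h1 := (((h.smooth_H (z • p)).mdifferentiableAt (by simp)).hasMFDerivAt).comp p
    (hd z p).hasMFDerivAt
  have h2 : H ∘ (fun q : M => z • q) = H := funext fun q => h.invariant_H z q
  rw [h2] at h1
  exact DFunLike.congr_fun h1.mfderiv u

theorem IsCircleIntegrable.isMIntegralCurve_smul (h : IsCircleIntegrable Ω H J) (z : Circle)
    {γ : ℝ → M} (hγ : IsMIntegralCurve (I := 𝓡 4) γ (hamVec Ω H)) :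
    IsMIntegralCurve (I := 𝓡 4) (fun t => z • γ t) (hamVec Ω H) := by
  intro t
  have h1 := ((h.contMDiff_smul z (γ t)).mdifferentiableAt (by simp)).hasMFDerivAt.comp t (hγ t)
  refine h1.congr_mfderiv ?_
  ext
  change mfderiv (𝓡 4) (𝓡 4) (fun q : M => z • q) (γ t) ((1:ℝ) • hamVec Ω H (γ t)) = (1 : ℝ) • _
  rw [one_smul, one_smul]
  exact h.mfderiv_smul_hamVec z (γ t)

variable [IsManifold (𝓡 4) ∞ M] [T2Space M]

theorem IsCircleIntegrable.isMIntegralCurve_unique (h : IsCircleIntegrable Ω H J)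
    {γ γ' : ℝ → M} (hγ : IsMIntegralCurve (I := 𝓡 4) γ (hamVec Ω H))
    (hγ' : IsMIntegralCurve (I := 𝓡 4) γ' (hamVec Ω H)) (h0 : γ 0 = γ' 0) : γ = γ' := by
  have : IsManifold (𝓡 4) 1 M := IsManifold.of_le (n := ∞) (by simp)
  exact isMIntegralCurve_Ioo_eq_of_contMDiff_boundaryless
    ((contMDiff_hamVec Ω h.smooth_H).of_le (by simp)) hγ hγ' h0

namespace IsRegularSystem

variable (S : IsRegularSystem Ω H J)
include S

/-- Integral curves stay in the fibre by conservation of `H` and `J`, and the fibre is compact;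
hence they are complete and the default branch of `flowH` does not occur. -/
theorem flowH_spec {p : M} (hp : p ∈ regularPoints H J) :
    flowH Ω H p 0 = p ∧ IsMIntegralCurve (I := 𝓡 4) (flowH Ω H p) (hamVec Ω H) := by
  have hex : ∃ γ : ℝ → M, γ 0 = p ∧ IsMIntegralCurve (I := 𝓡 4) γ (hamVec Ω H) := by
    refine exists_isMIntegralCurve_of_isCompact (contDiffOn_vecInChart_hamVec Ω S.smooth_H)
      (S.compact _ hp) ?_ (x := p) rfl
    intro γ a h0 hγ t ht
    have h0' : (0 : ℝ) ∈ Ioo (-a) a := by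
      have := ht.1.trans ht.2
      exact ⟨by linarith, by linarith⟩
    exact (S.energyMomentum_eq_of_isMIntegralCurveOn hγ ht h0').trans h0
  unfold flowH
  rw [dif_pos hex]
  exact hex.choose_spec

theorem flowH_zero {p : M} (hp : p ∈ regularPoints H J) : flowH Ω H p 0 = p := (S.flowH_spec hp).1

theorem isMIntegralCurve_flowH {p : M} (hp : p ∈ regularPoints H J) :
    IsMIntegralCurve (I := 𝓡 4) (flowH Ω H p) (hamVec Ω H) := (S.flowH_spec hp).2

theorem flowH_eq {p : M} (hp : p ∈ regularPoints H J) {γ : ℝ → M}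
    (hγ : IsMIntegralCurve (I := 𝓡 4) γ (hamVec Ω H)) (h0 : γ 0 = p) : flowH Ω H p = γ :=
  S.isMIntegralCurve_unique (S.isMIntegralCurve_flowH hp) hγ ((S.flowH_zero hp).trans h0.symm)

theorem energyMomentum_flowH {p : M} (hp : p ∈ regularPoints H J) (t : ℝ) :
    energyMomentum H J (flowH Ω H p t) = energyMomentum H J p := by
  have h := S.energyMomentum_eq_of_isMIntegralCurveOn
    ((S.isMIntegralCurve_flowH hp).isMIntegralCurveOn (Ioo (-(|t| + 1)) (|t| + 1)))
    (s := t) (t := 0) ⟨by linarith [neg_abs_le t], by linarith [le_abs_self t]⟩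
    ⟨by linarith [abs_nonneg t], by linarith [abs_nonneg t]⟩
  rwa [S.flowH_zero hp] at h

omit [IsManifold (𝓡 4) ∞ M] [T2Space M] in
theorem smul_mem_regularPoints {p : M} (hp : p ∈ regularPoints H J) (z : Circle) :
    z • p ∈ regularPoints H J := by
  rw [regularPoints, mem_ofPred_eq, S.energyMomentum_smul]
  exact hp

theorem flowH_mem_regularPoints {p : M} (hp : p ∈ regularPoints H J) (t : ℝ) :
    flowH Ω H p t ∈ regularPoints H J := by
  rw [regularPoints, mem_ofPred_eq, S.energyMomentum_flowH hp]
  exact hp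

theorem flowH_add {p : M} (hp : p ∈ regularPoints H J) (s t : ℝ) :
    flowH Ω H (flowH Ω H p s) t = flowH Ω H p (t + s) := by
  have h := S.flowH_eq (S.flowH_mem_regularPoints hp s)
    ((S.isMIntegralCurve_flowH hp).comp_add s) (by simp)
  exact congrFun h t

theorem flowH_smul {p : M} (hp : p ∈ regularPoints H J) (z : Circle) (t : ℝ) :
    flowH Ω H (z • p) t = z • flowH Ω H p t := by
  have h := S.flowH_eq (S.smul_mem_regularPoints hp z)
    (S.isMIntegralCurve_smul z (S.isMIntegralCurve_flowH hp)) (by simp [S.flowH_zero hp])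
  exact congrFun h t

/-- The flow of `X_H` is continuous on the union of the regular fibres. -/
theorem continuousOn_flowH :
    ContinuousOn (fun z : ℝ × M => flowH Ω H z.2 z.1) (univ ×ˢ regularPoints H J) := by
  have : IsManifold (𝓡 4) 1 M := IsManifold.of_le (n := ∞) (by simp)
  have hv : ContMDiff (𝓡 4) (𝓡 4).tangent 1
    (fun p => (⟨p, hamVec Ω H p⟩ : TangentBundle (𝓡 4) M)) :=
    (contMDiff_hamVec Ω S.smooth_H).of_le (by simp)
  rintro ⟨t₀, p⟩ ⟨-, hp⟩
  -- By uniqueness `flowH` agrees with the continuous local flows for short times, and compactness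
  -- makes the length of time uniform along the fibre.
  obtain ⟨ε, hε, h⟩ : ∃ ε > 0, ∀ q ∈ fibre H J (energyMomentum H J p),
      q ∈ regularPoints H J → ∀ t ∈ Ioo (-ε) ε,
      ContinuousWithinAt (fun z : ℝ × M => flowH Ω H z.2 z.1) (univ ×ˢ regularPoints H J)
        (t, q) := by
    refine (S.compact _ hp).induction_on (p := fun K => ∃ ε > 0, ∀ q ∈ K,
      q ∈ regularPoints H J → ∀ t ∈ Ioo (-ε) ε,
      ContinuousWithinAt (fun z : ℝ × M => flowH Ω H z.2 z.1) (univ ×ˢ regularPoints H J)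
        (t, q)) ⟨1, one_pos, by simp⟩ ?_ ?_ ?_
    · rintro s t hst ⟨ε, hε, h⟩
      exact ⟨ε, hε, fun x hx => h x (hst hx)⟩
    · rintro s t ⟨ε, hε, h⟩ ⟨ε', hε', h'⟩
      refine ⟨min ε ε', lt_min hε hε', ?_⟩
      rintro x (hx | hx) hx' t ht
      · exact h x hx hx' t (Ioo_subset_Ioo (neg_le_neg (min_le_left _ _)) (min_le_left _ _) ht)
      · exact h' x hx hx' t (Ioo_subset_Ioo (neg_le_neg (min_le_right _ _)) (min_le_right _ _) ht)
    · intro q₀ _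
      obtain ⟨ε, hε, U, hU, α, hα, hαc⟩ :=
        exists_local_flow (contDiffOn_vecInChart_hamVec Ω S.smooth_H) q₀
      refine ⟨interior U, mem_nhdsWithin_of_mem_nhds (interior_mem_nhds.2 hU), ε, hε,
        fun q hq hqr t ht => ?_⟩
      have hn : Ioo (-ε) ε ×ˢ U ∈ 𝓝 (t, q) :=
        prod_mem_nhds (isOpen_Ioo.mem_nhds ht) (mem_interior_iff_mem_nhds.1 hq)
      have heq : ∀ z ∈ (univ ×ˢ regularPoints H J) ∩ (Ioo (-ε) ε ×ˢ U),
          flowH Ω H z.2 z.1 = α z := by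
        rintro ⟨s, y⟩ ⟨⟨-, hy⟩, hs, hyU⟩
        exact isMIntegralCurveOn_Ioo_eqOn_of_contMDiff_boundaryless (t₀ := 0)
          ⟨by linarith, hε⟩ hv ((S.isMIntegralCurve_flowH hy).isMIntegralCurveOn _) (hα y hyU).2
          ((S.flowH_zero hy).trans (hα y hyU).1.symm) hs
      refine (ContinuousWithinAt.congr ((hαc.continuousAt hn).continuousWithinAt
        (s := (univ ×ˢ regularPoints H J) ∩ (Ioo (-ε) ε ×ˢ U))) heq
        (heq (t, q) ⟨⟨mem_univ _, hqr⟩, mem_of_mem_nhds hn⟩)).mono_of_mem_nhdsWithin ?_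
      exact inter_mem_nhdsWithin _ hn
  -- Induction on the length of the time window: a time `t` in the window of half-length `(n + 2)ε`
  -- is split as `d * t + c * t`, with `c * t` in the window of half-length `(n + 1)ε` and `d * t`
  -- in the basic one. Both parts depend continuously on `t`, so the composition law gives
  -- continuity jointly in time and point.
  have key : ∀ n : ℕ, ∀ q ∈ fibre H J (energyMomentum H J p), q ∈ regularPoints H J →
      ∀ t ∈ Ioo (-(((n : ℝ) + 1) * ε)) (((n : ℝ) + 1) * ε),
      ContinuousWithinAt (fun z : ℝ × M => flowH Ω H z.2 z.1) (univ ×ˢ regularPoints H J)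
        (t, q) := by
    intro n
    induction n with
    | zero => simpa using h
    | succ n ih =>
      intro q hq hqr t ht
      have hn : (0 : ℝ) < (n : ℝ) + 1 := by positivity
      have hn2 : (0 : ℝ) < (n : ℝ) + 1 + 1 := by positivity
      push_cast at ht
      set c : ℝ := ((n : ℝ) + 1) / ((n : ℝ) + 1 + 1) with hc
      set d : ℝ := 1 / ((n : ℝ) + 1 + 1) with hd
      have hcd : d + c = 1 := by rw [hc, hd]; field_simp; ring
      have hc0 : 0 < c := by positivity
      have hd0 : 0 < d := by positivity
      have hcb : c * (((n : ℝ) + 1 + 1) * ε) = ((n : ℝ) + 1) * ε := by rw [hc]; field_simp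
      have hdb : d * (((n : ℝ) + 1 + 1) * ε) = ε := by rw [hd]; field_simp
      have hct : c * t ∈ Ioo (-(((n : ℝ) + 1) * ε)) (((n : ℝ) + 1) * ε) :=
        ⟨by nlinarith [mul_lt_mul_of_pos_left ht.1 hc0],
          by nlinarith [mul_lt_mul_of_pos_left ht.2 hc0]⟩
      have hdt : d * t ∈ Ioo (-ε) ε :=
        ⟨by nlinarith [mul_lt_mul_of_pos_left ht.1 hd0],
          by nlinarith [mul_lt_mul_of_pos_left ht.2 hd0]⟩
      have hinner : ContinuousWithinAt (fun z : ℝ × M => (d * z.1, flowH Ω H z.2 (c * z.1)))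
          (univ ×ˢ regularPoints H J) (t, q) := by
        refine ContinuousWithinAt.prodMk (by fun_prop) ?_
        refine ContinuousWithinAt.comp (f := fun z : ℝ × M => (c * z.1, z.2)) (x := (t, q))
          (ih q hq hqr (c * t) hct) (by fun_prop) ?_
        exact fun z hz => ⟨mem_univ _, hz.2⟩
      have houter := ContinuousWithinAt.comp (x := (t, q))
        (f := fun z : ℝ × M => (d * z.1, flowH Ω H z.2 (c * z.1)))
        (h (flowH Ω H q (c * t)) ((S.energyMomentum_flowH hqr _).trans hq)
          (S.flowH_mem_regularPoints hqr _) (d * t) hdt) hinner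
        fun z hz => ⟨mem_univ _, S.flowH_mem_regularPoints hz.2 _⟩
      have heq : ∀ z ∈ univ ×ˢ regularPoints H J, flowH Ω H z.2 z.1
          = flowH Ω H (flowH Ω H z.2 (c * z.1)) (d * z.1) := by
        intro z hz
        rw [S.flowH_add hz.2, ← add_mul, hcd, one_mul]
      exact houter.congr heq (heq (t, q) ⟨mem_univ _, hqr⟩)
  obtain ⟨n, hn⟩ := exists_nat_gt (|t₀| / ε)
  rw [div_lt_iff₀ hε] at hn
  exact key n p rfl hp t₀ ⟨by nlinarith [neg_abs_le t₀], by nlinarith [le_abs_self t₀]⟩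

end IsRegularSystem

end Flow

/-! ### The joint flow of `X_H` and `X_J` as an action of the plane -/

section TorusFlow

variable {M : Type*} [TopologicalSpace M] [ChartedSpace E4 M]

/-- Integral curves of smooth vector fields are smooth. -/
theorem contMDiff_of_isMIntegralCurve [IsManifold (𝓡 4) ∞ M] {X : ∀ p : M, TangentSpace (𝓡 4) p}
    (hX : ∀ x : M, ContDiffOn ℝ ∞ (vecInChart X x) (extChartAt (𝓡 4) x).target) {γ : ℝ → M}
    (hγ : IsMIntegralCurve (I := 𝓡 4) γ X) : ContMDiff 𝓘(ℝ, ℝ) (𝓡 4) ∞ γ := by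
  intro t₀
  have hsrc : γ ⁻¹' (extChartAt (𝓡 4) (γ t₀)).source ∈ 𝓝 t₀ :=
    hγ.continuous.continuousAt (extChartAt_source_mem_nhds (γ t₀))
  obtain ⟨ε, hε, hball⟩ := Metric.mem_nhds_iff.1 hsrc
  have hI : ∀ t ∈ Icc (t₀ - ε / 2) (t₀ + ε / 2), γ t ∈ (extChartAt (𝓡 4) (γ t₀)).source := by
    intro t ht
    refine hball ?_
    rw [Real.ball_eq_Ioo]
    exact ⟨by linarith [ht.1], by linarith [ht.2]⟩
  have hc : ContDiffOn ℝ ∞ (fun t => extChartAt (𝓡 4) (γ t₀) (γ t))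
      (Icc (t₀ - ε / 2) (t₀ + ε / 2)) := by
    -- Bootstrapping: in a chart the curve solves an equation with smooth right-hand side.
    refine ODE.contDiffOn_enat_Icc_of_hasDerivWithinAt (n := ⊤)
      (f := fun _ => vecInChart X (γ t₀)) (u := (extChartAt (𝓡 4) (γ t₀)).target) ?_ ?_ ?_
    · exact (hX (γ t₀)).comp contDiffOn_snd fun z hz => hz.2
    · intro t ht
      exact (hasDerivAt_extChartAt_comp (hγ t) (hI t ht)).hasDerivWithinAt
    · exact fun t ht => (extChartAt (𝓡 4) (γ t₀)).map_source (hI t ht)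
  have hnhds : Icc (t₀ - ε / 2) (t₀ + ε / 2) ∈ 𝓝 t₀ := Icc_mem_nhds (by linarith) (by linarith)
  have h2 := (contMDiffAt_extChartAt_symm_of_mem (mem_extChartAt_target (I := 𝓡 4) (γ t₀))).comp t₀
    (hc.contDiffAt hnhds).contMDiffAt
  refine h2.congr_of_eventuallyEq ?_
  filter_upwards [hnhds] with t ht
  exact ((extChartAt (𝓡 4) (γ t₀)).left_inv (hI t ht)).symm

variable [MulAction Circle M]

/-- The joint flow of `X_H` and `X_J`. -/
noncomputable def torusFlow (Ω : SymplecticForm M) (H : M → ℝ) (a : ℝ × ℝ) (p : M) : M :=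
  Circle.exp a.2 • flowH Ω H p a.1

variable {Ω : SymplecticForm M} {H J : M → ℝ} [IsManifold (𝓡 4) ∞ M] [T2Space M]

namespace IsRegularSystem

variable (S : IsRegularSystem Ω H J)
include S

theorem torusFlow_zero {p : M} (hp : p ∈ regularPoints H J) : torusFlow Ω H 0 p = p := by
  simp [torusFlow, S.flowH_zero hp]

theorem torusFlow_mem {p : M} (hp : p ∈ regularPoints H J) (a : ℝ × ℝ) :
    torusFlow Ω H a p ∈ regularPoints H J :=
  S.smul_mem_regularPoints (S.flowH_mem_regularPoints hp _) _

theorem energyMomentum_torusFlow {p : M} (hp : p ∈ regularPoints H J) (a : ℝ × ℝ) :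
    energyMomentum H J (torusFlow Ω H a p) = energyMomentum H J p := by
  rw [torusFlow, S.energyMomentum_smul, S.energyMomentum_flowH hp]

theorem torusFlow_add {p : M} (hp : p ∈ regularPoints H J) (a b : ℝ × ℝ) :
    torusFlow Ω H a (torusFlow Ω H b p) = torusFlow Ω H (a + b) p := by
  simp only [torusFlow, Prod.fst_add, Prod.snd_add, Circle.exp_add]
  rw [S.flowH_smul (S.flowH_mem_regularPoints hp _), S.flowH_add hp, mul_smul]

theorem torusFlow_neg_add {p : M} (hp : p ∈ regularPoints H J) (a : ℝ × ℝ) :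
    torusFlow Ω H (-a) (torusFlow Ω H a p) = p := by
  rw [S.torusFlow_add hp, neg_add_cancel, S.torusFlow_zero hp]

theorem continuousOn_torusFlow :
    ContinuousOn (fun z : (ℝ × ℝ) × M => torusFlow Ω H z.1 z.2) (univ ×ˢ regularPoints H J) := by
  have h1 : ContinuousOn (fun z : (ℝ × ℝ) × M => flowH Ω H z.2 z.1.1)
      (univ ×ˢ regularPoints H J) :=
    S.continuousOn_flowH.comp (f := fun z : (ℝ × ℝ) × M => (z.1.1, z.2)) (by fun_prop)
      fun z hz => ⟨mem_univ _, hz.2⟩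
  have h2 : ContinuousOn (fun z : (ℝ × ℝ) × M => Circle.exp z.1.2) (univ ×ˢ regularPoints H J) :=
    (Circle.exp.continuous.comp (by fun_prop)).continuousOn
  exact S.continuous_smul.comp_continuousOn (h2.prodMk h1)

theorem contMDiff_torusFlow {p : M} (hp : p ∈ regularPoints H J) :
    ContMDiff 𝓘(ℝ, ℝ × ℝ) (𝓡 4) ∞ (fun a => torusFlow Ω H a p) := by
  have h1 : ContMDiff 𝓘(ℝ, ℝ × ℝ) (𝓡 4) ∞ (fun a : ℝ × ℝ => flowH Ω H p a.1) :=
    (contMDiff_of_isMIntegralCurve (contDiffOn_vecInChart_hamVec Ω S.smooth_H)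
      (S.isMIntegralCurve_flowH hp)).comp contDiff_fst.contMDiff
  have h2 : ContMDiff 𝓘(ℝ, ℝ × ℝ) (𝓡 1) ∞ (fun a : ℝ × ℝ => Circle.exp a.2) :=
    contMDiff_circleExp.comp contDiff_snd.contMDiff
  exact S.smooth_action.comp (h2.prodMk h1)

/-- The differential of the joint flow with respect to the times. -/
theorem mfderiv_torusFlow {p : M} (hp : p ∈ regularPoints H J) (a w : ℝ × ℝ) :
    (mfderiv 𝓘(ℝ, ℝ × ℝ) (𝓡 4) (fun a => torusFlow Ω H a p) a w : E4)
      = w.1 • (hamVec Ω H (torusFlow Ω H a p) : E4)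
        + w.2 • (hamVec Ω J (torusFlow Ω H a p) : E4) := by
  have hd := ((S.contMDiff_torusFlow hp a).mdifferentiableAt (by simp)).hasMFDerivAt
  let D : ℝ × ℝ →L[ℝ] E4 := mfderiv 𝓘(ℝ, ℝ × ℝ) (𝓡 4) (fun a => torusFlow Ω H a p) a
  -- The differential is read off along lines. In the coordinate directions, the action property
  -- turns these lines into integral curves of `X_H` and `X_J` through the point reached.
  have hline : ∀ (w : ℝ × ℝ) (X : E4), HasMFDerivAt 𝓘(ℝ, ℝ) (𝓡 4)
      (fun t : ℝ => torusFlow Ω H (a + t • w) p) 0 ((1 : ℝ →L[ℝ] ℝ).smulRight (M₂ := E4) X) →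
      D w = X := by
    intro w X hX
    have h1 : HasDerivAt (fun t : ℝ => a + t • w) w 0 := by
      simpa using ((hasDerivAt_id (0 : ℝ)).smul_const w).const_add a
    have h1' := h1.hasFDerivAt.hasMFDerivAt
    have hd' : HasMFDerivAt 𝓘(ℝ, ℝ × ℝ) (𝓡 4) (fun a => torusFlow Ω H a p) (a + (0 : ℝ) • w) D := by
      rw [zero_smul, add_zero]; exact hd
    have h2 := hd'.comp (0 : ℝ) h1'
    have h3 := hasMFDerivAt_unique h2 hX
    have h4 : D ((1 : ℝ) • w) = (1 : ℝ) • X := DFunLike.congr_fun h3 (1 : ℝ)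
    simpa using h4
  have hH : D (1, 0) = hamVec Ω H (torusFlow Ω H a p) := by
    refine hline (1, 0) _ ?_
    have h1 := S.isMIntegralCurve_flowH (S.torusFlow_mem hp a) 0
    have h2 : (fun t : ℝ => torusFlow Ω H (a + t • ((1 : ℝ), (0 : ℝ))) p)
        = flowH Ω H (torusFlow Ω H a p) := by
      funext t
      rw [add_comm, ← S.torusFlow_add hp]
      simp [torusFlow]
    rw [S.flowH_zero (S.torusFlow_mem hp a)] at h1
    rw [h2]
    exact h1
  have hJ : D (0, 1) = hamVec Ω J (torusFlow Ω H a p) := by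
    refine hline (0, 1) _ ?_
    have h1 := S.generator (torusFlow Ω H a p) 0
    have h2 : (fun t : ℝ => torusFlow Ω H (a + t • ((0 : ℝ), (1 : ℝ))) p)
        = fun t : ℝ => Circle.exp t • torusFlow Ω H a p := by
      funext t
      simp [torusFlow, Circle.exp_add, add_comm, mul_smul]
    have h0 : (fun t : ℝ => Circle.exp t • torusFlow Ω H a p) 0 = torusFlow Ω H a p := by simp
    rw [h0] at h1
    rw [h2]
    exact h1
  have hw : w = w.1 • ((1 : ℝ), (0 : ℝ)) + w.2 • ((0 : ℝ), (1 : ℝ)) := by ext <;> simp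
  change D w = _
  conv_lhs => rw [hw]
  rw [map_add, map_smul, map_smul, hH, hJ]
  rfl

end IsRegularSystem

end TorusFlow

/-! ### Coordinates adapted to the energy-momentum map and the joint flow -/

section Coordinates

variable {M : Type*} [TopologicalSpace M] [ChartedSpace E4 M] [MulAction Circle M]
  {Ω : SymplecticForm M} {H J : M → ℝ}

/-- The differential of a function at a point, as a linear map on the model space. -/
noncomputable def differentialAt {E : Type*} [NormedAddCommGroup E] [NormedSpace ℝ E]
    (f : M → E) (p : M) : E4 →L[ℝ] E :=
  mfderiv (𝓡 4) 𝓘(ℝ, E) f p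

omit [MulAction Circle M] in
theorem hasFDerivAt_comp_extChartAt_symm_self {E : Type*} [NormedAddCommGroup E]
    [NormedSpace ℝ E] {f : M → E} {p : M} (hf : MDifferentiableAt (𝓡 4) 𝓘(ℝ, E) f p) :
    HasFDerivAt (f ∘ (extChartAt (𝓡 4) p).symm) (differentialAt f p) (extChartAt (𝓡 4) p p) := by
  have h := hf.hasMFDerivAt.2
  rw [ModelWithCorners.range_eq_univ] at h
  exact hasFDerivWithinAt_univ.1 h

theorem IsCircleIntegrable.mdifferentiableAt_energyMomentum (h : IsCircleIntegrable Ω H J) (p : M) :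
    MDifferentiableAt (𝓡 4) 𝓘(ℝ, ℝ × ℝ) (energyMomentum H J) p :=
  MDifferentiableAt.prodMk_space ((h.smooth_H p).mdifferentiableAt (by simp))
    ((h.smooth_J p).mdifferentiableAt (by simp))

theorem IsCircleIntegrable.contMDiff_energyMomentum (h : IsCircleIntegrable Ω H J) :
    ContMDiff (𝓡 4) 𝓘(ℝ, ℝ × ℝ) ∞ (energyMomentum H J) :=
  h.smooth_H.prodMk_space h.smooth_J

theorem IsCircleIntegrable.differentialAt_energyMomentum (h : IsCircleIntegrable Ω H J) (p : M) (u : E4) :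
    differentialAt (energyMomentum H J) p u
      = (Ω.form p (hamVec Ω H p) u, Ω.form p (hamVec Ω J p) u) := by
  have h1 := hasFDerivAt_comp_extChartAt_symm_self (h.mdifferentiableAt_energyMomentum p)
  have h2 := (hasFDerivAt_comp_extChartAt_symm_self
    ((h.smooth_H p).mdifferentiableAt (by simp))).prodMk
    (hasFDerivAt_comp_extChartAt_symm_self ((h.smooth_J p).mdifferentiableAt (by simp)))
  have h3 := DFunLike.congr_fun (h1.unique h2) u
  exact h3.trans (Prod.ext (hamVec_spec Ω H p u).symm (hamVec_spec Ω J p u).symm)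

/-- At a regular point there are linear coordinates dual to `X_H` and `X_J` that complement the
differential of the energy-momentum map. -/
theorem IsCircleIntegrable.exists_dual_coordinates (h : IsCircleIntegrable Ω H J) {p : M}
    (hp : p ∈ regularPoints H J) :
    ∃ L : E4 →L[ℝ] ℝ × ℝ, L (hamVec Ω H p) = (1, 0) ∧ L (hamVec Ω J p) = (0, 1) ∧
      ∃ e : E4 ≃L[ℝ] (ℝ × ℝ) × (ℝ × ℝ), ∀ u : E4,
        e u = (differentialAt (energyMomentum H J) p u, L u) := by
  let D : E4 →L[ℝ] ℝ × ℝ := differentialAt (energyMomentum H J) p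
  let B : E4 →L[ℝ] E4 →L[ℝ] ℝ := Ω.form p
  let XH : E4 := hamVec Ω H p
  let XJ : E4 := hamVec Ω J p
  have hD : ∀ u, D u = (B XH u, B XJ u) := fun u => h.differentialAt_energyMomentum p u
  have hsurj : Function.Surjective D := hp.2 p rfl
  obtain ⟨u₁, hu₁⟩ := hsurj (1, 0)
  obtain ⟨u₂, hu₂⟩ := hsurj (0, 1)
  -- Here `L = (Ω(·, u₁), Ω(·, u₂))`, where `dF` takes `u₁` and `u₂` to the standard basis. As `dF =
  -- (Ω(X_H, ·), Ω(X_J, ·))`, the same four numbers say that `L` takes `X_H` and `X_J` to the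
  -- standard basis.
  let L : E4 →L[ℝ] ℝ × ℝ := (B.flip u₁).prod (B.flip u₂)
  have hL : ∀ w, L w = (B w u₁, B w u₂) := fun w => rfl
  have h1 := (hD u₁).symm.trans hu₁
  have h2 := (hD u₂).symm.trans hu₂
  simp only [Prod.mk.injEq] at h1 h2
  have hLH : L XH = (1, 0) := by rw [hL, h1.1, h2.1]
  have hLJ : L XJ = (0, 1) := by rw [hL, h1.2, h2.2]
  have hc : B XH XJ = 0 := h.commute p
  have hB : ∀ u : E4, B u u = 0 := Ω.alternating p
  have hDH : D XH = 0 := by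
    rw [hD, antisymm_of_alternating hB XJ XH, hc, hB, neg_zero]; rfl
  have hDJ : D XJ = 0 := by
    rw [hD, hc, hB]; rfl
  -- The value of `D` is adjusted with `u₁`, `u₂`; then the value of `L` is adjusted with `X_H`,
  -- `X_J`, which lie in the kernel of `D`. Bijectivity follows because both sides have dimension
  -- four.
  have hsurj2 : Function.Surjective (D.prod L) := by
    rintro ⟨⟨c, d⟩, b⟩
    let w := c • u₁ + d • u₂
    let b' := b - L w
    refine ⟨w + b'.1 • XH + b'.2 • XJ, ?_⟩
    have e1 : D (w + b'.1 • XH + b'.2 • XJ) = (c, d) := by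
      simp [w, hu₁, hu₂, hDH, hDJ]
    have e2 : L (w + b'.1 • XH + b'.2 • XJ) = b := by
      rw [map_add, map_add, map_smul, map_smul, hLH, hLJ]
      ext <;> simp [b']
    exact Prod.ext e1 e2
  have hdim : Module.finrank ℝ E4 = Module.finrank ℝ ((ℝ × ℝ) × (ℝ × ℝ)) := by simp
  have hinj : Function.Injective (D.prod L) :=
    (LinearMap.injective_iff_surjective_of_finrank_eq_finrank (f := (D.prod L).toLinearMap)
      hdim).2 hsurj2
  let e : E4 ≃ₗ[ℝ] (ℝ × ℝ) × (ℝ × ℝ) :=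
    LinearEquiv.ofBijective (D.prod L).toLinearMap ⟨hinj, hsurj2⟩
  exact ⟨L, hLH, hLJ, e.toContinuousLinearEquiv, fun u => rfl⟩

variable [IsManifold (𝓡 4) ∞ M]

omit [MulAction Circle M] in
theorem hasStrictFDerivAt_comp_extChartAt_symm_self {E : Type*} [NormedAddCommGroup E]
    [NormedSpace ℝ E] {f : M → E} {p : M} (hf : ContMDiffAt (𝓡 4) 𝓘(ℝ, E) ∞ f p) :
    HasStrictFDerivAt (f ∘ (extChartAt (𝓡 4) p).symm) (differentialAt f p)
      (extChartAt (𝓡 4) p p) := by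
  have h1 : ContDiffAt ℝ ∞ (f ∘ (extChartAt (𝓡 4) p).symm) (extChartAt (𝓡 4) p p) := by
    refine (ContMDiffAt.comp _ ?_
      (contMDiffAt_extChartAt_symm_of_mem (mem_extChartAt_target p))).contDiffAt
    rw [extChartAt_to_inv]
    exact hf
  exact h1.hasStrictFDerivAt'
    (hasFDerivAt_comp_extChartAt_symm_self (hf.mdifferentiableAt (by simp))) (by simp)

/-- The energy-momentum map is open at regular points. -/
theorem IsCircleIntegrable.map_energyMomentum_nhds (h : IsCircleIntegrable Ω H J) {p : M}
    (hp : p ∈ regularPoints H J) :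
    map (energyMomentum H J) (𝓝 p) = 𝓝 (energyMomentum H J p) := by
  have h1 := (hasStrictFDerivAt_comp_extChartAt_symm_self
    (h.contMDiff_energyMomentum p)).map_nhds_eq_of_surj (LinearMap.range_eq_top.2 (hp.2 p rfl))
  rw [← map_extChartAt_nhds_of_boundaryless (I := 𝓡 4) p, Filter.map_map] at h1
  simp only [Function.comp_apply, extChartAt_to_inv] at h1
  rw [← h1]
  refine map_congr ?_
  filter_upwards [extChartAt_source_mem_nhds (I := 𝓡 4) p] with q hq
  simp only [Function.comp_apply, (extChartAt (𝓡 4) p).left_inv hq]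

omit [MulAction Circle M] in
/-- A smooth map with bijective differential is locally injective. -/
theorem exists_injOn_of_mfderiv_equiv {E : Type*} [NormedAddCommGroup E] [NormedSpace ℝ E]
    {f : M → E} {p : M} (hf : ContMDiffAt (𝓡 4) 𝓘(ℝ, E) ∞ f p) (e : E4 ≃L[ℝ] E)
    (he : ∀ u : E4, e u = differentialAt f p u) : ∃ U ∈ 𝓝 p, InjOn f U := by
  have h1 := hasStrictFDerivAt_comp_extChartAt_symm_self hf
  have h2 : HasStrictFDerivAt (f ∘ (extChartAt (𝓡 4) p).symm) (e : E4 →L[ℝ] E)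
      (extChartAt (𝓡 4) p p) := by
    have h3 : (e : E4 →L[ℝ] E) = differentialAt f p := ContinuousLinearMap.ext he
    rw [h3]
    exact h1
  obtain ⟨V, hV, hinj⟩ : ∃ V ∈ 𝓝 (extChartAt (𝓡 4) p p),
      InjOn (f ∘ (extChartAt (𝓡 4) p).symm) V := by
    refine ⟨(h2.toOpenPartialHomeomorph _).source,
      (h2.toOpenPartialHomeomorph _).open_source.mem_nhds h2.mem_toOpenPartialHomeomorph_source, ?_⟩
    exact (h2.toOpenPartialHomeomorph _).injOn
  refine ⟨_, inter_mem (extChartAt_source_mem_nhds (I := 𝓡 4) p)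
    (continuousAt_extChartAt (I := 𝓡 4) p hV), ?_⟩
  intro q hq q' hq' heq
  refine (extChartAt (𝓡 4) p).injOn hq.1 hq'.1 (hinj hq.2 hq'.2 ?_)
  simp only [Function.comp_apply, (extChartAt (𝓡 4) p).left_inv hq.1,
    (extChartAt (𝓡 4) p).left_inv hq'.1]
  exact heq

omit [MulAction Circle M] in
theorem vecInChart_self (X : ∀ p : M, TangentSpace (𝓡 4) p) (p : M) :
    vecInChart X p (extChartAt (𝓡 4) p p) = X p := by
  unfold vecInChart
  rw [extChartAt_to_inv, mfderiv_extChartAt_self]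
  rfl

variable [T2Space M]

/-- Near a regular point there are coordinates of the fibres in which the joint flow is close to
the translation flow. -/
theorem IsRegularSystem.exists_flow_coordinates (S : IsRegularSystem Ω H J) {p : M}
    (hp : p ∈ regularPoints H J) :
    ∃ ρ : M → ℝ × ℝ, ContMDiffAt (𝓡 4) 𝓘(ℝ, ℝ × ℝ) ∞ ρ p ∧
      HasFDerivAt (fun a => ρ (torusFlow Ω H a p)) (ContinuousLinearMap.id ℝ (ℝ × ℝ)) 0 ∧
      ∃ U ∈ 𝓝 p, InjOn (fun q => (energyMomentum H J q, ρ q)) U ∧ ∃ r > 0, ∃ V ∈ 𝓝 p,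
        ∀ q ∈ V ∩ regularPoints H J, (∀ a ∈ Metric.ball (0 : ℝ × ℝ) r, torusFlow Ω H a q ∈ U) ∧
          ApproximatesLinearOn (fun a => ρ (torusFlow Ω H a q))
            (ContinuousLinearEquiv.refl ℝ (ℝ × ℝ) : ℝ × ℝ →L[ℝ] ℝ × ℝ) (Metric.ball 0 r)
            (1 / 2) := by
  obtain ⟨L, hLH, hLJ, e, he⟩ := S.exists_dual_coordinates hp
  let ρ : M → ℝ × ℝ := fun q => L (extChartAt (𝓡 4) p q)
  have hρsm : ∀ q ∈ (extChartAt (𝓡 4) p).source, ContMDiffAt (𝓡 4) 𝓘(ℝ, ℝ × ℝ) ∞ ρ q :=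
    fun q hq => L.contDiff.contMDiff.contMDiffAt.comp q (contMDiffAt_extChartAt_of_mem hq)
  have hps : p ∈ (extChartAt (𝓡 4) p).source := mem_extChartAt_source p
  have hinj : ∃ U ∈ 𝓝 p, InjOn (fun q => (energyMomentum H J q, ρ q)) U := by
    refine exists_injOn_of_mfderiv_equiv
      ((S.contMDiff_energyMomentum p).prodMk_space (hρsm p hps)) e fun u => ?_
    rw [he]
    have h1 := hasFDerivAt_comp_extChartAt_symm_self
      (((S.contMDiff_energyMomentum p).prodMk_space (hρsm p hps)).mdifferentiableAt (by simp))
    have h2 := hasFDerivAt_comp_extChartAt_symm_self (S.mdifferentiableAt_energyMomentum p)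
    have h3 : HasFDerivAt (ρ ∘ (extChartAt (𝓡 4) p).symm) L (extChartAt (𝓡 4) p p) := by
      refine L.hasFDerivAt.congr_of_eventuallyEq ?_
      filter_upwards [(isOpen_target_extChartAt p).mem_nhds (mem_extChartAt_target p)] with y hy
      simp only [ρ, Function.comp_apply, (extChartAt (𝓡 4) p).right_inv hy]
    exact (DFunLike.congr_fun (h1.unique (h2.prodMk h3)) u).symm
  obtain ⟨U, hU, hinj⟩ := hinj
  -- The time derivative of `ρ` along the joint flow depends only on the point reached. It is the
  -- identity at `p` and continuous there, hence within `1 / 2` of the identity nearby; the mean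
  -- value inequality turns this into the approximation of the flow by translations.
  let D : M → ℝ × ℝ →L[ℝ] ℝ × ℝ := fun y =>
    (ContinuousLinearMap.fst ℝ ℝ ℝ).smulRight
        (L (vecInChart (hamVec Ω H) p (extChartAt (𝓡 4) p y)))
      + (ContinuousLinearMap.snd ℝ ℝ ℝ).smulRight
        (L (vecInChart (hamVec Ω J) p (extChartAt (𝓡 4) p y)))
  have hder : ∀ q ∈ regularPoints H J, ∀ a, torusFlow Ω H a q ∈ (extChartAt (𝓡 4) p).source →
      HasFDerivAt (fun a => ρ (torusFlow Ω H a q)) (D (torusFlow Ω H a q)) a := by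
    intro q hq a ha
    have h1 := L.hasFDerivAt.hasMFDerivAt.comp (torusFlow Ω H a q)
      ((contMDiffAt_extChartAt_of_mem ha).mdifferentiableAt (by simp)).hasMFDerivAt
    have h2 := h1.comp a ((S.contMDiff_torusFlow hq a).mdifferentiableAt (by simp)).hasMFDerivAt
    have h3 : HasFDerivAt (fun a => ρ (torusFlow Ω H a q)) _ a := h2.hasFDerivAt
    refine h3.congr_fderiv (ContinuousLinearMap.ext fun w => ?_)
    have hv : ∀ X : ∀ p : M, TangentSpace (𝓡 4) p,
        vecInChart X p (extChartAt (𝓡 4) p (torusFlow Ω H a q))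
          = mfderiv (𝓡 4) 𝓘(ℝ, E4) (extChartAt (𝓡 4) p) (torusFlow Ω H a q)
            (X (torusFlow Ω H a q)) := by
      intro X
      unfold vecInChart
      rw [(extChartAt (𝓡 4) p).left_inv ha]
    let A : E4 →L[ℝ] E4 := mfderiv (𝓡 4) 𝓘(ℝ, E4) (extChartAt (𝓡 4) p) (torusFlow Ω H a q)
    have h4 : ∀ (c d : ℝ) (x y : E4), L (A (c • x + d • y)) = c • L (A x) + d • L (A y) := by
      intro c d x y
      rw [map_add, map_smul, map_smul, map_add, map_smul, map_smul]
    have h5 := (congrArg (fun u => L (A u)) (S.mfderiv_torusFlow hq a w)).trans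
      (h4 _ _ _ _)
    refine h5.trans ?_
    change _ = w.1 • L (vecInChart (hamVec Ω H) p (extChartAt (𝓡 4) p (torusFlow Ω H a q)))
      + w.2 • L (vecInChart (hamVec Ω J) p (extChartAt (𝓡 4) p (torusFlow Ω H a q)))
    rw [hv, hv]
    rfl
  have hDc : ContinuousAt D p := by
    have hc : ∀ f : M → ℝ, ContMDiff (𝓡 4) 𝓘(ℝ, ℝ) ∞ f →
        ContinuousAt (fun y => L (vecInChart (hamVec Ω f) p (extChartAt (𝓡 4) p y))) p := by
      intro f hf
      exact L.continuous.continuousAt.comp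
        (((contDiffOn_vecInChart_hamVec Ω hf p).continuousOn.continuousAt
          ((isOpen_target_extChartAt p).mem_nhds (mem_extChartAt_target p))).comp
          (continuousAt_extChartAt p))
    have hsr : ∀ c : ℝ × ℝ →L[ℝ] ℝ, Continuous fun w : ℝ × ℝ => c.smulRight w := fun c =>
      (ContinuousLinearMap.smulRightL ℝ (ℝ × ℝ) (ℝ × ℝ) c).continuous
    exact ((hsr _).continuousAt.comp (hc H S.smooth_H)).add
      ((hsr _).continuousAt.comp (hc J S.smooth_J))
  have hDp : D p = ContinuousLinearMap.id ℝ (ℝ × ℝ) := by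
    refine ContinuousLinearMap.ext fun w => ?_
    change w.1 • L (vecInChart (hamVec Ω H) p (extChartAt (𝓡 4) p p))
      + w.2 • L (vecInChart (hamVec Ω J) p (extChartAt (𝓡 4) p p)) = w
    rw [vecInChart_self, vecInChart_self, hLH, hLJ]
    ext <;> simp
  have hW : {y | y ∈ (extChartAt (𝓡 4) p).source ∧ y ∈ U ∧
      ‖D y - ContinuousLinearMap.id ℝ (ℝ × ℝ)‖ ≤ 1 / 2} ∈ 𝓝 p := by
    have h1 : Tendsto (fun y => ‖D y - ContinuousLinearMap.id ℝ (ℝ × ℝ)‖) (𝓝 p) (𝓝 0) := by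
      have h2 : Tendsto (fun y => ‖D y - ContinuousLinearMap.id ℝ (ℝ × ℝ)‖) (𝓝 p)
        (𝓝 ‖D p - ContinuousLinearMap.id ℝ (ℝ × ℝ)‖) := (hDc.sub continuousAt_const).norm
      rwa [hDp, sub_self, norm_zero] at h2
    filter_upwards [extChartAt_source_mem_nhds (I := 𝓡 4) p, hU,
      h1.eventually (ge_mem_nhds (show (0 : ℝ) < 1 / 2 by norm_num))] with y h1 h2 h3
    exact ⟨h1, h2, h3⟩
  have hcont := S.continuousOn_torusFlow (0, p) ⟨mem_univ _, hp⟩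
  have hpre := hcont (show _ ∈ 𝓝 (torusFlow Ω H 0 p) by rw [S.torusFlow_zero hp]; exact hW)
  rw [Filter.mem_map, nhdsWithin_prod_eq, nhdsWithin_univ] at hpre
  obtain ⟨A, hA, B, hB, hAB⟩ := Filter.mem_prod_iff.1 hpre
  obtain ⟨r, hr, hrA⟩ := Metric.mem_nhds_iff.1 hA
  obtain ⟨V, hV, hVB⟩ := mem_nhdsWithin_iff_exists_mem_nhds_inter.1 hB
  have hmem : ∀ q ∈ V ∩ regularPoints H J, ∀ a ∈ Metric.ball (0 : ℝ × ℝ) r,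
      torusFlow Ω H a q ∈ (extChartAt (𝓡 4) p).source ∧ torusFlow Ω H a q ∈ U ∧
      ‖D (torusFlow Ω H a q) - ContinuousLinearMap.id ℝ (ℝ × ℝ)‖ ≤ 1 / 2 :=
    fun q hq a ha => hAB (mk_mem_prod (hrA ha) (hVB hq))
  refine ⟨ρ, hρsm p hps, ?_, U, hU, hinj, r, hr, V, hV, fun q hq =>
    ⟨fun a ha => (hmem q hq a ha).2.1, ?_⟩⟩
  · have := hder p hp 0 (by rw [S.torusFlow_zero hp]; exact hps)
    rwa [S.torusFlow_zero hp, hDp] at this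
  · intro a ha b hb
    have := (convex_ball (0 : ℝ × ℝ) r).norm_image_sub_le_of_norm_hasFDerivWithin_le'
      (fun a ha => (hder q hq.2 a (hmem q hq a ha).1).hasFDerivWithinAt)
      (fun a ha => (hmem q hq a ha).2.2) hb ha
    simpa using this

end Coordinates

/-! ### Transitivity of the joint flow; first return time and rotation number -/

section Returns

variable {M : Type*} [TopologicalSpace M] [ChartedSpace E4 M] [MulAction Circle M]
  {Ω : SymplecticForm M} {H J : M → ℝ} [IsManifold (𝓡 4) ∞ M] [T2Space M]

/-- A small element of the circle is the exponential of a small angle. -/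
theorem eventually_exists_circleExp {r : ℝ} (hr : 0 < r) :
    ∀ᶠ z in 𝓝 (1 : Circle), ∃ s : ℝ, |s| < r ∧ Circle.exp s = z := by
  have h := Circle.isCoveringMap_exp.isLocalHomeomorph.isOpenMap
  have h1 : Circle.exp '' Metric.ball 0 r ∈ 𝓝 (1 : Circle) := by
    refine (h _ Metric.isOpen_ball).mem_nhds ⟨0, Metric.mem_ball_self hr, Circle.exp_zero⟩
  filter_upwards [h1] with z hz
  obtain ⟨s, hs, rfl⟩ := hz
  exact ⟨s, by simpa using hs, rfl⟩

namespace IsRegularSystem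

variable (S : IsRegularSystem Ω H J)
include S

/-- Nearby points of the same fibre are related by the joint flow for a small time. -/
theorem exists_small_torusFlow_eq {p : M} (hp : p ∈ regularPoints H J) {ε : ℝ} (hε : 0 < ε) :
    ∃ V ∈ 𝓝 p, ∀ q ∈ V ∩ regularPoints H J, ∀ q' ∈ V,
      energyMomentum H J q = energyMomentum H J q' → ∃ a : ℝ × ℝ, ‖a‖ ≤ ε ∧
        torusFlow Ω H a q = q' := by
  obtain ⟨ρ, hρ, -, U, hU, hinj, r, hr, V, hV, h⟩ := S.exists_flow_coordinates hp
  set δ := min ε (r / 2) with hδ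
  have hδ0 : 0 < δ := lt_min hε (by linarith)
  -- A map within `1 / 2` of the identity takes the ball of radius `δ` onto at least the ball of
  -- radius `δ / 2` around the image of the centre. Two points with `ρ` in the `δ / 4`-ball are that
  -- close, so some small time corrects `ρ`; the energy-momentum values agree already, and the two
  -- together determine the point.
  have hρ' : ρ ⁻¹' Metric.ball (ρ p) (δ / 4) ∈ 𝓝 p :=
    hρ.continuousAt (Metric.ball_mem_nhds _ (by linarith))
  refine ⟨V ∩ U ∩ ρ ⁻¹' Metric.ball (ρ p) (δ / 4), inter_mem (inter_mem hV hU) hρ', ?_⟩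
  rintro q ⟨⟨⟨hqV, hqU⟩, hqρ⟩, hq⟩ q' ⟨⟨hqV', hqU'⟩, hqρ'⟩ hF
  obtain ⟨hmem, happ⟩ := h q ⟨hqV, hq⟩
  have hsub : Metric.closedBall (0 : ℝ × ℝ) δ ⊆ Metric.ball 0 r :=
    Metric.closedBall_subset_ball (by have := min_le_right ε (r / 2); linarith)
  let R : ((ContinuousLinearEquiv.refl ℝ (ℝ × ℝ) : ℝ × ℝ →L[ℝ] ℝ × ℝ)).NonlinearRightInverse :=
    { toFun := id
      nnnorm := 1
      bound' := fun y => by simp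
      right_inv' := fun y => by simp }
  have hsurj := happ.surjOn_closedBall_of_nonlinearRightInverse R hδ0.le hsub
  have hd : dist (ρ q') (ρ q) ≤ δ / 2 := by
    have h1 : dist (ρ q) (ρ p) < δ / 4 := hqρ
    have h2 : dist (ρ q') (ρ p) < δ / 4 := hqρ'
    linarith [dist_triangle_right (ρ q') (ρ q) (ρ p)]
  obtain ⟨a, ha, haq⟩ := hsurj (a := ρ q') (by
    rw [Metric.mem_closedBall, S.torusFlow_zero hq]
    refine hd.trans (le_of_eq ?_)
    simp [R]
    ring)
  refine ⟨a, ?_, ?_⟩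
  · have : ‖a‖ ≤ δ := by simpa using ha
    exact this.trans (min_le_left _ _)
  · exact hinj (hmem a (hsub ha)) hqU'
      (Prod.ext ((S.energyMomentum_torusFlow hq a).trans hF) haq)

/-- The joint flow is free for small times, locally uniformly. -/
theorem exists_small_torusFlow_free {p : M} (hp : p ∈ regularPoints H J) :
    ∃ r > 0, ∃ V ∈ 𝓝 p, ∀ q ∈ V ∩ regularPoints H J, ∀ a : ℝ × ℝ, ‖a‖ < r →
      torusFlow Ω H a q = q → a = 0 := by
  obtain ⟨ρ, hρ, -, U, hU, hinj, r, hr, V, hV, h⟩ := S.exists_flow_coordinates hp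
  refine ⟨r, hr, V, hV, fun q hq a ha haq => ?_⟩
  have h1 := (h q hq).2 a (by simpa using ha) 0 (Metric.mem_ball_self hr)
  -- The times `a` and `0` lead to the same point, so the approximation by the identity leaves `‖a‖
  -- ≤ ‖a‖ / 2`.
  simp only [haq, S.torusFlow_zero hq.2, sub_self, sub_zero, zero_sub, norm_neg] at h1
  have h2 : ‖a‖ ≤ 1 / 2 * ‖a‖ := by simpa using h1
  exact norm_eq_zero.1 (by linarith [norm_nonneg a])

/-- The regular fibres are orbits of the joint flow. -/
theorem exists_torusFlow_eq {p q : M} (hp : p ∈ regularPoints H J)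
    (hq : energyMomentum H J q = energyMomentum H J p) : ∃ a, torusFlow Ω H a p = q := by
  classical
  -- The indicator of the orbit of `p` is locally constant on the fibre, which is connected.
  let f : M → Bool := fun q => decide (∃ a, torusFlow Ω H a p = q)
  have hc : ContinuousOn f (fibre H J (energyMomentum H J p)) := by
    intro x hx
    have hx' : energyMomentum H J x = energyMomentum H J p := hx
    have hxr : x ∈ regularPoints H J := by
      rw [regularPoints, mem_ofPred_eq, hx']; exact hp
    obtain ⟨V, hV, h⟩ := S.exists_small_torusFlow_eq hxr one_pos
    refine (continuousWithinAt_const (b := f x)).congr_of_eventuallyEq ?_ rfl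
    filter_upwards [mem_nhdsWithin_of_mem_nhds hV, self_mem_nhdsWithin] with y hy hyK
    obtain ⟨a, -, ha⟩ := h x ⟨mem_of_mem_nhds hV, hxr⟩ y hy (hx'.trans (Eq.symm hyK))
    have : (∃ a, torusFlow Ω H a p = y) ↔ ∃ a, torusFlow Ω H a p = x := by
      constructor
      · rintro ⟨b, hb⟩
        refine ⟨-a + b, ?_⟩
        rw [← S.torusFlow_add hp, hb, ← ha, S.torusFlow_neg_add hxr]
      · rintro ⟨b, hb⟩
        exact ⟨a + b, by rw [← S.torusFlow_add hp, hb, ha]⟩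
    simp only [f, this]
  have h1 := (S.connected _ hp).isPreconnected.constant hc (x := q) (y := p) hq rfl
  have h2 : f p = true := by
    simp only [f, decide_eq_true_eq]
    exact ⟨0, S.torusFlow_zero hp⟩
  rw [h2] at h1
  simpa [f] using h1

/-- By compactness the whole fibre is reached from `p` with `X_H`-times bounded by some `R`. The
point at time `R + 1` is also reached at a time of absolute value at most `R`, up to rotation; the
difference of the two times is a positive return time. -/
theorem returnTimes_nonempty {p : M} (hp : p ∈ regularPoints H J) :
    (returnTimes Ω H p).Nonempty := by
  obtain ⟨R, hR⟩ : ∃ R : ℝ, ∀ q ∈ fibre H J (energyMomentum H J p),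
      energyMomentum H J q = energyMomentum H J p →
      ∃ a : ℝ × ℝ, |a.1| ≤ R ∧ torusFlow Ω H a p = q := by
    refine (S.compact _ hp).induction_on (p := fun K => ∃ R : ℝ, ∀ q ∈ K,
      energyMomentum H J q = energyMomentum H J p →
      ∃ a : ℝ × ℝ, |a.1| ≤ R ∧ torusFlow Ω H a p = q) ⟨0, by simp⟩ ?_ ?_ ?_
    · rintro s t hst ⟨R, h⟩
      exact ⟨R, fun x hx => h x (hst hx)⟩
    · rintro s t ⟨R, h⟩ ⟨R', h'⟩
      refine ⟨max R R', ?_⟩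
      rintro x (hx | hx) hF
      · obtain ⟨a, ha, hax⟩ := h x hx hF
        exact ⟨a, ha.trans (le_max_left _ _), hax⟩
      · obtain ⟨a, ha, hax⟩ := h' x hx hF
        exact ⟨a, ha.trans (le_max_right _ _), hax⟩
    · intro x hx
      have hx' : energyMomentum H J x = energyMomentum H J p := hx
      obtain ⟨b, rfl⟩ := S.exists_torusFlow_eq hp hx
      have hxr := S.torusFlow_mem hp b
      obtain ⟨V, hV, h⟩ := S.exists_small_torusFlow_eq hxr one_pos
      refine ⟨V, mem_nhdsWithin_of_mem_nhds hV, |b.1| + 1, fun y hy hF => ?_⟩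
      obtain ⟨a, ha, hay⟩ := h _ ⟨mem_of_mem_nhds hV, hxr⟩ y hy (hx'.trans hF.symm)
      refine ⟨a + b, ?_, by rw [← S.torusFlow_add hp, hay]⟩
      have h1 : |a.1| ≤ 1 := (norm_fst_le a).trans ha
      have h2 := abs_add_le a.1 b.1
      simp only [Prod.fst_add]
      linarith
  obtain ⟨a, ha, hae⟩ := hR (flowH Ω H p (R + 1)) (S.energyMomentum_flowH hp _)
    (S.energyMomentum_flowH hp _)
  have ha1 : a.1 ≤ R := (le_abs_self _).trans ha
  refine ⟨-a.1 + (R + 1), by linarith, Circle.exp a.2, ?_⟩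
  rw [← S.flowH_add hp, ← hae, torusFlow, S.flowH_smul (S.flowH_mem_regularPoints hp _),
    S.flowH_add hp, neg_add_cancel, S.flowH_zero hp]

/-- Points at which the flow does not meet the circle orbit in a given way form an open set. -/
theorem eventually_flowH_ne_smul {p : M} (hp : p ∈ regularPoints H J) {t : ℝ} {z : Circle}
    (hne : flowH Ω H p t ≠ z • p) :
    ∀ᶠ y : (ℝ × M) × Circle in 𝓝 (t, p) ×ˢ 𝓝 z, y.1.2 ∈ regularPoints H J →
      flowH Ω H y.1.2 y.1.1 ≠ y.2 • y.1.2 := by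
  obtain ⟨A, B, hA, hB, htA, hzB, hAB⟩ := t2_separation hne
  have h1 := S.continuousOn_flowH (t, p) ⟨mem_univ _, hp⟩ (hA.mem_nhds htA)
  rw [Filter.mem_map, mem_nhdsWithin_iff_eventually] at h1
  have h2 := S.continuous_smul.continuousAt (x := (z, p)) (hB.mem_nhds hzB)
  have h3 : Tendsto (fun y : (ℝ × M) × Circle => (y.2, y.1.2)) (𝓝 (t, p) ×ˢ 𝓝 z) (𝓝 (z, p)) := by
    rw [← nhds_prod_eq]
    exact Continuous.tendsto' (by fun_prop) _ _ rfl
  filter_upwards [(tendsto_fst (f := 𝓝 (t, p)) (g := 𝓝 z)).eventually h1, h3 h2]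
    with y hy1 hy2 hyr heq
  have hyB : y.2 • y.1.2 ∈ B := hy2
  exact disjoint_left.1 hAB (hy1 ⟨mem_univ _, hyr⟩)
    (show flowH Ω H y.1.2 y.1.1 ∈ B by rw [heq]; exact hyB)

/-- There are no returns for small times, locally uniformly. -/
theorem eventually_no_small_return {p : M} (hp : p ∈ regularPoints H J) :
    ∀ᶠ y : ℝ × M in 𝓝 (0, p), y.2 ∈ regularPoints H J → ∀ z : Circle,
      flowH Ω H y.2 y.1 = z • y.2 → y.1 = 0 := by
  have key : ∀ᶠ y : ℝ × M in 𝓝 (0, p), ∀ z ∈ (univ : Set Circle), y.2 ∈ regularPoints H J →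
      flowH Ω H y.2 y.1 = z • y.2 → y.1 = 0 := by
    refine isCompact_univ.eventually_forall_of_forall_eventually fun z _ => ?_
    rw [nhds_prod_eq]
    -- For `z` near `1` the rotation has a small angle and local freeness of the joint flow applies;
    -- elsewhere freeness of the circle action separates `z • p` from `p`. Compactness of the circle
    -- combines the two cases.
    by_cases hz : z = 1
    · subst hz
      obtain ⟨r, hr, V, hV, h⟩ := S.exists_small_torusFlow_free hp
      have h1 : ∀ᶠ y : ℝ × M in 𝓝 (0, p), |y.1| < r ∧ y.2 ∈ V := by
        rw [nhds_prod_eq]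
        have h0 : ∀ᶠ t in 𝓝 (0 : ℝ), |t| < r := by
          filter_upwards [Metric.ball_mem_nhds (0 : ℝ) hr] with t ht
          simpa using ht
        exact h0.prod_mk (show ∀ᶠ q in 𝓝 p, q ∈ V from hV)
      filter_upwards [h1.prod_mk (eventually_exists_circleExp hr)]
      rintro ⟨⟨t, q⟩, z⟩ ⟨⟨ht, hqV⟩, s, hs, rfl⟩ hq heq
      have h2 : torusFlow Ω H (t, -s) q = q := by
        simp only [torusFlow]
        rw [heq, smul_smul, ← Circle.exp_add]
        simp
      have h3 := h q ⟨hqV, hq⟩ (t, -s) (by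
        rw [Prod.norm_def, max_lt_iff]; simpa using ⟨ht, hs⟩) h2
      exact congrArg Prod.fst h3
    · have hne : flowH Ω H p 0 ≠ z • p := by
        rw [S.flowH_zero hp]
        exact fun h => hz (S.free _ hp p rfl z h.symm)
      filter_upwards [S.eventually_flowH_ne_smul hp hne] with y hy hyr heq
      exact absurd heq (hy hyr)
  filter_upwards [key] with y hy hyr z
  exact hy z (mem_univ _) hyr

omit [IsManifold (𝓡 4) ∞ M] [T2Space M] in
theorem continuous_smul_const (p : M) : Continuous fun z : Circle => z • p :=
  S.continuous_smul.comp (continuous_id.prodMk continuous_const)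

/-- Return times stay away from `0`, and they form a closed set because the circle orbit is compact.
-/
theorem isLeast_firstReturn {p : M} (hp : p ∈ regularPoints H J) :
    IsLeast (returnTimes Ω H p) (firstReturn Ω H p) := by
  obtain ⟨r, hr, h⟩ : ∃ r > 0, ∀ t ∈ returnTimes Ω H p, r ≤ t := by
    have h1 := (S.eventually_no_small_return hp).curry_nhds
    have h2 : ∀ᶠ t : ℝ in 𝓝 0, p ∈ regularPoints H J → ∀ z : Circle,
      flowH Ω H p t = z • p → t = 0 := h1.mono fun t ht => ht.self_of_nhds
    obtain ⟨r, hr, h3⟩ := Metric.eventually_nhds_iff_ball.1 h2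
    refine ⟨r, hr, fun t ht => ?_⟩
    by_contra! hlt
    obtain ⟨z, hz⟩ := ht.2
    have := h3 t (by simpa [abs_of_pos ht.1] using hlt) hp z hz
    exact ht.1.ne' this
  have hcl : IsClosed (returnTimes Ω H p) := by
    have h1 : returnTimes Ω H p = Ici r ∩ flowH Ω H p ⁻¹' (range fun z : Circle => z • p) := by
      ext t
      constructor
      · rintro ht
        obtain ⟨z, hz⟩ := ht.2
        exact ⟨h t ht, z, hz.symm⟩
      · rintro ⟨ht, z, hz⟩
        exact ⟨hr.trans_le ht, z, hz.symm⟩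
    rw [h1]
    refine isClosed_Ici.inter (IsClosed.preimage ?_ ?_)
    · exact (S.isMIntegralCurve_flowH hp).continuous
    · exact (isCompact_range (S.continuous_smul_const p)).isClosed
  exact hcl.isLeast_csInf (S.returnTimes_nonempty hp) ⟨r, h⟩

theorem firstReturn_pos {p : M} (hp : p ∈ regularPoints H J) : 0 < firstReturn Ω H p :=
  (S.isLeast_firstReturn hp).1.1

omit [IsManifold (𝓡 4) ∞ M] [T2Space M] in
theorem smul_injective {p : M} (hp : p ∈ regularPoints H J) {z w : Circle} (h : z • p = w • p) :
    z = w := by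
  have h1 : (w⁻¹ * z) • p = p := by rw [mul_smul, h, inv_smul_smul]
  have h2 := S.free _ hp p rfl _ h1
  rwa [inv_mul_eq_one, eq_comm] at h2

theorem isLeast_rotationNumber {p : M} (hp : p ∈ regularPoints H J) :
    IsLeast (rotationTimes Ω H p) (rotationNumber Ω H p) := by
  have hcl : IsClosed (rotationTimes Ω H p) :=
    isClosed_Ici.inter (isClosed_eq
      ((S.continuous_smul_const p).comp Circle.exp.continuous) continuous_const)
  refine hcl.isLeast_csInf ?_ ⟨0, fun t ht => ht.1⟩
  obtain ⟨z, hz⟩ := (S.isLeast_firstReturn hp).1.2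
  -- The argument may be negative, so a full turn is added to obtain an admissible time.
  refine ⟨Complex.arg z + 2 * Real.pi, ?_, ?_⟩
  · linarith [Complex.neg_pi_lt_arg (z : ℂ), Real.pi_pos]
  · rw [Circle.exp_add_two_pi, Circle.exp_arg, hz]

theorem rotationNumber_lt {p : M} (hp : p ∈ regularPoints H J) :
    rotationNumber Ω H p < 2 * Real.pi := by
  by_contra! hle
  have h1 := S.isLeast_rotationNumber hp
  have h2 := h1.2 (show rotationNumber Ω H p - 2 * Real.pi ∈ rotationTimes Ω H p from
    ⟨by linarith, by rw [Circle.exp_sub_two_pi]; exact h1.1.2⟩)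
  linarith [Real.pi_pos]

theorem flowH_firstReturn {p : M} (hp : p ∈ regularPoints H J) :
    flowH Ω H p (firstReturn Ω H p) = Circle.exp (rotationNumber Ω H p) • p :=
  (S.isLeast_rotationNumber hp).1.2.symm

theorem flowH_torusFlow {p : M} (hp : p ∈ regularPoints H J) (a : ℝ × ℝ) (t : ℝ) :
    flowH Ω H (torusFlow Ω H a p) t = torusFlow Ω H a (flowH Ω H p t) := by
  simp only [torusFlow]
  rw [S.flowH_smul (S.flowH_mem_regularPoints hp _), S.flowH_add hp, S.flowH_add hp, add_comm]

theorem torusFlow_smul {p : M} (hp : p ∈ regularPoints H J) (a : ℝ × ℝ) (z : Circle) :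
    torusFlow Ω H a (z • p) = z • torusFlow Ω H a p := by
  simp only [torusFlow]
  rw [S.flowH_smul hp, smul_smul, smul_smul, mul_comm]

theorem returnTimes_torusFlow {p : M} (hp : p ∈ regularPoints H J) (a : ℝ × ℝ) :
    returnTimes Ω H (torusFlow Ω H a p) = returnTimes Ω H p := by
  have key : ∀ {p : M} (_ : p ∈ regularPoints H J) (a : ℝ × ℝ),
      returnTimes Ω H p ⊆ returnTimes Ω H (torusFlow Ω H a p) := by
    rintro p hp a t ⟨ht, z, hz⟩
    exact ⟨ht, z, by rw [S.flowH_torusFlow hp, hz, S.torusFlow_smul hp]⟩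
  refine Subset.antisymm ?_ (key hp a)
  have := key (S.torusFlow_mem hp a) (-a)
  rwa [S.torusFlow_neg_add hp] at this

theorem firstReturn_torusFlow {p : M} (hp : p ∈ regularPoints H J) (a : ℝ × ℝ) :
    firstReturn Ω H (torusFlow Ω H a p) = firstReturn Ω H p := by
  rw [firstReturn, S.returnTimes_torusFlow hp, firstReturn]

theorem rotationNumber_torusFlow {p : M} (hp : p ∈ regularPoints H J) (a : ℝ × ℝ) :
    rotationNumber Ω H (torusFlow Ω H a p) = rotationNumber Ω H p := by
  have key : ∀ {p : M} (_ : p ∈ regularPoints H J) (a : ℝ × ℝ),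
      rotationTimes Ω H p ⊆ rotationTimes Ω H (torusFlow Ω H a p) := by
    rintro p hp a t ⟨ht, h⟩
    refine ⟨ht, ?_⟩
    rw [S.firstReturn_torusFlow hp, S.flowH_torusFlow hp, ← h, S.torusFlow_smul hp]
  have h2 : rotationTimes Ω H (torusFlow Ω H a p) = rotationTimes Ω H p := by
    refine Subset.antisymm ?_ (key hp a)
    have := key (S.torusFlow_mem hp a) (-a)
    rwa [S.torusFlow_neg_add hp] at this
  rw [rotationNumber, h2, rotationNumber]

/-- The first return time is continuous on the union of the regular fibres. -/
theorem tendsto_firstReturn {p : M} (hp : p ∈ regularPoints H J) :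
    Tendsto (firstReturn Ω H) (𝓝[regularPoints H J] p) (𝓝 (firstReturn Ω H p)) := by
  set T := firstReturn Ω H p with hT
  have hT0 : 0 < T := S.firstReturn_pos hp
  rw [Metric.tendsto_nhds]
  intro ε' hε'
  set ε := min (ε' / 2) (T / 2) with hε
  have hε0 : 0 < ε := lt_min (by linarith) (by linarith)
  have hεT : ε < T := (min_le_right _ _).trans_lt (by linarith)
  have hεε' : ε < ε' := (min_le_left _ _).trans_lt (by linarith)
  set z := Circle.exp (rotationNumber Ω H p) with hz
  have hret : flowH Ω H p T = z • p := S.flowH_firstReturn hp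
  -- an upper bound
  have hup : ∀ᶠ q in 𝓝[regularPoints H J] p, firstReturn Ω H q ≤ T + ε := by
    -- For `q` near `p` the points `z • q` and `flowH Ω H q T` lie in one fibre and both near `z •
    -- p`, so a small joint time `a` leads from the first to the second. Undoing its first component
    -- makes `T - a.1` a return time of `q`.
    obtain ⟨V, hV, h⟩ := S.exists_small_torusFlow_eq (S.smul_mem_regularPoints hp z) hε0
    have h1 : ∀ᶠ q in 𝓝[regularPoints H J] p, flowH Ω H q T ∈ V := by
      have hc : ContinuousWithinAt (fun q => flowH Ω H q T) (regularPoints H J) p :=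
        ContinuousWithinAt.comp (x := p) (f := fun q => (T, q))
          (S.continuousOn_flowH (T, p) ⟨mem_univ _, hp⟩) (by fun_prop)
          fun q hq => ⟨mem_univ _, hq⟩
      exact hc (show V ∈ 𝓝 (flowH Ω H p T) by rw [hret]; exact hV)
    have h2 : ∀ᶠ q in 𝓝[regularPoints H J] p, z • q ∈ V := by
      have hc : Continuous fun q : M => z • q := (S.contMDiff_smul z).continuous
      exact nhdsWithin_le_nhds (hc.continuousAt hV)
    filter_upwards [h1, h2, self_mem_nhdsWithin] with q hq1 hq2 hq
    obtain ⟨a, ha, hae⟩ := h (z • q) ⟨hq2, S.smul_mem_regularPoints hq z⟩ _ hq1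
      (by rw [S.energyMomentum_smul, S.energyMomentum_flowH hq])
    have ha1 : |a.1| ≤ ε := (norm_fst_le a).trans ha
    rw [abs_le] at ha1
    have hmem : -a.1 + T ∈ returnTimes Ω H q := by
      refine ⟨by linarith, Circle.exp a.2 * z, ?_⟩
      rw [← S.flowH_add hq, ← hae, torusFlow,
        S.flowH_smul (S.flowH_mem_regularPoints (S.smul_mem_regularPoints hq z) _),
        S.flowH_add (S.smul_mem_regularPoints hq z), neg_add_cancel,
        S.flowH_zero (S.smul_mem_regularPoints hq z), mul_smul]
    exact ((S.isLeast_firstReturn hq).2 hmem).trans (by linarith)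
  -- a lower bound
  have hlow : ∀ᶠ q in 𝓝[regularPoints H J] p, T - ε < firstReturn Ω H q := by
    have h1 : ∀ᶠ q in 𝓝 p, ∀ y ∈ Icc (0 : ℝ) (T - ε) ×ˢ (univ : Set Circle),
        q ∈ regularPoints H J → flowH Ω H q y.1 = y.2 • q → y.1 = 0 := by
      -- No pair of a time in `[0, T - ε]` and a rotation is a return of nearby points: for positive
      -- times because `T` is the first return of `p`, near time zero by the absence of small
      -- returns.
      refine (isCompact_Icc.prod isCompact_univ).eventually_forall_of_forall_eventually ?_
      rintro ⟨t, w⟩ ⟨ht, -⟩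
      have hmap : Tendsto (fun x : M × (ℝ × Circle) => ((x.2.1, x.1), x.2.2))
          (𝓝 (p, (t, w))) (𝓝 (t, p) ×ˢ 𝓝 w) := by
        rw [← nhds_prod_eq]
        exact Continuous.tendsto' (by fun_prop) _ _ rfl
      by_cases ht0 : t = 0
      · subst ht0
        have h2 := (hmap.comp tendsto_id).fst.eventually (S.eventually_no_small_return hp)
        filter_upwards [h2] with x hx hxr heq
        exact hx hxr _ heq
      · have hne : flowH Ω H p t ≠ w • p := by
          intro heq
          have := (S.isLeast_firstReturn hp).2 (show t ∈ returnTimes Ω H p from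
            ⟨lt_of_le_of_ne ht.1 (Ne.symm ht0), w, heq⟩)
          rw [← hT] at this
          linarith [ht.2]
        filter_upwards [hmap.eventually (S.eventually_flowH_ne_smul hp hne)] with x hx hxr heq
        exact absurd heq (hx hxr)
    filter_upwards [nhdsWithin_le_nhds h1, self_mem_nhdsWithin] with q hq hqr
    by_contra! hle
    obtain ⟨hpos, w, hw⟩ := (S.isLeast_firstReturn hqr).1
    exact hpos.ne' (hq (firstReturn Ω H q, w) ⟨⟨hpos.le, hle⟩, mem_univ _⟩ hqr hw)
  filter_upwards [hup, hlow] with q h1 h2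
  rw [Real.dist_eq, abs_lt]
  constructor <;> linarith

/-- The rotation angle is continuous on the union of the regular fibres. -/
theorem tendsto_circleExp_rotationNumber {p : M} (hp : p ∈ regularPoints H J) :
    Tendsto (fun q => Circle.exp (rotationNumber Ω H q)) (𝓝[regularPoints H J] p)
      (𝓝 (Circle.exp (rotationNumber Ω H p))) := by
  set T := firstReturn Ω H p with hT
  set z := Circle.exp (rotationNumber Ω H p) with hz
  have hret : flowH Ω H p T = z • p := S.flowH_firstReturn hp
  rw [tendsto_def]
  intro O hO
  obtain ⟨O', hO'O, hO', hzO'⟩ := mem_nhds_iff.1 hO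
  -- At time `T` freeness excludes every rotation other than `z` at `p`. The rotations outside `O'`
  -- form a compact set, so they remain excluded for nearby times and points.
  have h1 : ∀ᶠ y : ℝ × M in 𝓝 (T, p), ∀ w ∈ O'ᶜ, y.2 ∈ regularPoints H J →
      flowH Ω H y.2 y.1 ≠ w • y.2 := by
    refine hO'.isClosed_compl.isCompact.eventually_forall_of_forall_eventually fun w hw => ?_
    rw [nhds_prod_eq]
    refine S.eventually_flowH_ne_smul hp ?_
    rw [hret]
    intro heq
    exact hw (S.smul_injective hp heq ▸ hzO')
  have h2 : Tendsto (fun q => (firstReturn Ω H q, q)) (𝓝[regularPoints H J] p) (𝓝 (T, p)) := by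
    rw [nhds_prod_eq]
    exact (S.tendsto_firstReturn hp).prodMk (tendsto_id.mono_left nhdsWithin_le_nhds)
  filter_upwards [h2.eventually h1, self_mem_nhdsWithin] with q hq hqr
  by_contra hn
  exact hq _ (fun h => hn (hO'O h)) hqr (S.flowH_firstReturn hqr)

/-- A first return changes the point only by a rotation, so the `X_H`-time may be reduced modulo
`T`. -/
theorem exists_torusFlow_eq_bounded {p q : M} (hp : p ∈ regularPoints H J)
    (hq : energyMomentum H J q = energyMomentum H J p) :
    ∃ a ∈ Icc (0 : ℝ) (firstReturn Ω H p), ∃ z : Circle, z • flowH Ω H p a = q := by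
  obtain ⟨a, rfl⟩ := S.exists_torusFlow_eq hp hq
  set T := firstReturn Ω H p with hT
  have hT0 : 0 < T := S.firstReturn_pos hp
  have key : ∀ (n : ℕ) (t : ℝ), ∃ w : Circle, flowH Ω H p (t + n * T) = w • flowH Ω H p t := by
    intro n
    induction n with
    | zero => intro t; exact ⟨1, by simp⟩
    | succ n ih =>
      intro t
      obtain ⟨w, hw⟩ := ih t
      refine ⟨w * Circle.exp (rotationNumber Ω H p), ?_⟩
      have h1 : flowH Ω H p (t + ((n + 1 : ℕ) : ℝ) * T)
          = flowH Ω H (flowH Ω H p T) (t + n * T) := by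
        rw [S.flowH_add hp]; congr 1; push_cast; ring
      rw [h1, hT, S.flowH_firstReturn hp, S.flowH_smul hp, hw, smul_smul, mul_comm]
  have keyZ : ∀ (n : ℤ) (t : ℝ), ∃ w : Circle, flowH Ω H p (t + n * T) = w • flowH Ω H p t := by
    intro n t
    obtain ⟨k, rfl | rfl⟩ := n.eq_nat_or_neg
    · exact_mod_cast key k t
    · obtain ⟨w, hw⟩ := key k (t + ((-(k : ℤ) : ℤ) : ℝ) * T)
      refine ⟨w⁻¹, ?_⟩
      rw [eq_inv_smul_iff, ← hw]
      congr 1; push_cast; ring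
  obtain ⟨w, hw⟩ := keyZ ⌊a.1 / T⌋ (a.1 - ⌊a.1 / T⌋ * T)
  have h1 : (⌊a.1 / T⌋ : ℝ) * T ≤ a.1 := by
    rw [← le_div_iff₀ hT0]; exact Int.floor_le _
  have h2 : a.1 < (⌊a.1 / T⌋ + 1 : ℝ) * T := by
    rw [← div_lt_iff₀ hT0]; exact Int.lt_floor_add_one _
  refine ⟨a.1 - ⌊a.1 / T⌋ * T, ⟨by linarith, by linarith⟩, Circle.exp a.2 * w, ?_⟩
  rw [mul_smul, ← hw, torusFlow, sub_add_cancel]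

/-- The regular fibres depend continuously on the value: a neighbourhood of a regular fibre
contains the neighbouring regular fibres. -/
theorem eventually_fibre_subset {p : M} (hp : p ∈ regularPoints H J) {N : Set M} (hN : IsOpen N)
    (hpN : fibre H J (energyMomentum H J p) ⊆ N) :
    ∀ᶠ v in 𝓝[regularValues H J] (energyMomentum H J p), fibre H J v ⊆ N := by
  set T := firstReturn Ω H p with hT
  -- A fibre near that of `p` contains a point `q` near `p`, as the energy-momentum map is open
  -- there, and is swept out from `q` by rotations and `X_H`-times in `[0, T + 1]`. This compact set
  -- of parameters keeps the fibre inside `N`.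
  have h1 : ∀ᶠ q in 𝓝 p, ∀ y ∈ Icc (0 : ℝ) (T + 1) ×ˢ (univ : Set Circle),
      q ∈ regularPoints H J → y.2 • flowH Ω H q y.1 ∈ N := by
    refine (isCompact_Icc.prod isCompact_univ).eventually_forall_of_forall_eventually ?_
    rintro ⟨t, w⟩ -
    have hmem : w • flowH Ω H p t ∈ N := hpN (by
      change energyMomentum H J _ = _
      rw [S.energyMomentum_smul, S.energyMomentum_flowH hp])
    have hc : ContinuousWithinAt (fun x : M × (ℝ × Circle) => x.2.2 • flowH Ω H x.1 x.2.1)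
        (regularPoints H J ×ˢ univ) (p, (t, w)) := by
      refine S.continuous_smul.continuousAt.comp_continuousWithinAt
        (f := fun x : M × (ℝ × Circle) => (x.2.2, flowH Ω H x.1 x.2.1)) ?_
      refine ContinuousWithinAt.prodMk (by fun_prop) ?_
      exact ContinuousWithinAt.comp (x := (p, (t, w)))
        (f := fun x : M × (ℝ × Circle) => (x.2.1, x.1)) (t := univ ×ˢ regularPoints H J)
        (S.continuousOn_flowH (t, p) ⟨mem_univ _, hp⟩) (by fun_prop) fun x hx => ⟨mem_univ _, hx.1⟩
    have h2 := hc (hN.mem_nhds hmem)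
    rw [Filter.mem_map, mem_nhdsWithin_iff_eventually] at h2
    filter_upwards [h2] with x hx hxr
    exact hx ⟨hxr, mem_univ _⟩
  have h3 : ∀ᶠ q in 𝓝 p, q ∈ regularPoints H J → firstReturn Ω H q < T + 1 :=
    eventually_nhdsWithin_iff.1 ((S.tendsto_firstReturn hp).eventually (gt_mem_nhds (by linarith)))
  have h4 : energyMomentum H J '' {q | (∀ y ∈ Icc (0 : ℝ) (T + 1) ×ˢ (univ : Set Circle),
      q ∈ regularPoints H J → y.2 • flowH Ω H q y.1 ∈ N) ∧
      (q ∈ regularPoints H J → firstReturn Ω H q < T + 1)} ∈ 𝓝 (energyMomentum H J p) := by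
    rw [← S.map_energyMomentum_nhds hp]
    exact image_mem_map (h1.and h3)
  filter_upwards [nhdsWithin_le_nhds h4, self_mem_nhdsWithin] with v hv hvr
  obtain ⟨q, ⟨hq1, hq2⟩, rfl⟩ := hv
  intro x hx
  obtain ⟨a, ha, z, rfl⟩ := S.exists_torusFlow_eq_bounded hvr hx
  exact hq1 (a, z) ⟨⟨ha.1, ha.2.trans (hq2 hvr).le⟩, mem_univ _⟩ hvr

omit [T2Space M] in
/-- Points over nearby regular values can be chosen near a given point. -/
theorem eventually_exists_near {p : M} (hp : p ∈ regularPoints H J) {P : M → Prop}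
    (hP : ∀ᶠ q in 𝓝[regularPoints H J] p, P q) :
    ∀ᶠ v in 𝓝[regularValues H J] (energyMomentum H J p),
      ∃ q, energyMomentum H J q = v ∧ P q := by
  have h1 := eventually_nhdsWithin_iff.1 hP
  have h4 : energyMomentum H J '' {q | q ∈ regularPoints H J → P q} ∈ 𝓝 (energyMomentum H J p) := by
    rw [← S.map_energyMomentum_nhds hp]
    exact image_mem_map h1
  filter_upwards [nhdsWithin_le_nhds h4, self_mem_nhdsWithin] with v hv hvr
  obtain ⟨q, hq, rfl⟩ := hv
  exact ⟨q, rfl, hq hvr⟩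

end IsRegularSystem

end Returns

/-! ### Local primitives of the rotation form and their continuation -/

section Primitives

variable {M : Type*} [TopologicalSpace M] [ChartedSpace E4 M] [IsManifold (𝓡 4) ∞ M]

/-- The function `g` is a primitive of the 1-form `θ` near `p`. -/
def IsPrimitiveAt (θ : ∀ p : M, TangentSpace (𝓡 4) p →L[ℝ] ℝ) (g : M → ℝ) (p : M) : Prop :=
  ∀ᶠ q in 𝓝 p, HasMFDerivAt (𝓡 4) 𝓘(ℝ, ℝ) g q (θ q)

theorem hasFDerivAt_comp_extChartAt_symm_of_hasMFDerivAt
    {θ : ∀ p : M, TangentSpace (𝓡 4) p →L[ℝ] ℝ} {g : M → ℝ} {x : M} {y : E4}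
    (hy : y ∈ (extChartAt (𝓡 4) x).target)
    (hg : HasMFDerivAt (𝓡 4) 𝓘(ℝ, ℝ) g ((extChartAt (𝓡 4) x).symm y)
      (θ ((extChartAt (𝓡 4) x).symm y))) :
    HasFDerivAt (g ∘ (extChartAt (𝓡 4) x).symm) (oneFormInChart θ x y) y :=
  (hg.comp y ((contMDiffAt_extChartAt_symm_of_mem hy).mdifferentiableAt
    (by simp)).hasMFDerivAt).hasFDerivAt

theorem hasMFDerivAt_comp_extChartAt
    {θ : ∀ p : M, TangentSpace (𝓡 4) p →L[ℝ] ℝ} {f : E4 → ℝ} {x q : M}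
    (hq : q ∈ (extChartAt (𝓡 4) x).source)
    (hf : HasFDerivAt f (oneFormInChart θ x (extChartAt (𝓡 4) x q)) (extChartAt (𝓡 4) x q)) :
    HasMFDerivAt (𝓡 4) 𝓘(ℝ, ℝ) (f ∘ extChartAt (𝓡 4) x) q (θ q) := by
  have h1 := hf.hasMFDerivAt.comp q ((contMDiffAt_extChartAt_of_mem hq).mdifferentiableAt
    (by simp)).hasMFDerivAt
  refine h1.congr_mfderiv ?_
  have hy := (extChartAt (𝓡 4) x).map_source hq
  obtain ⟨y, hy', rfl⟩ : ∃ y ∈ (extChartAt (𝓡 4) x).target, (extChartAt (𝓡 4) x).symm y = q :=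
    ⟨_, hy, (extChartAt (𝓡 4) x).left_inv hq⟩
  rw [(extChartAt (𝓡 4) x).right_inv hy']
  ext w
  exact congrArg (θ ((extChartAt (𝓡 4) x).symm y)) (chartInvDeriv_mfderiv_extChartAt hy' w)

/-- Two primitives of a 1-form differ by a constant. -/
theorem IsPrimitiveAt.exists_eq_add {θ : ∀ p : M, TangentSpace (𝓡 4) p →L[ℝ] ℝ} {g g' : M → ℝ}
    {p : M} (hg : IsPrimitiveAt θ g p) (hg' : IsPrimitiveAt θ g' p) :
    ∃ c : ℝ, ∀ᶠ q in 𝓝 p, g q = g' q + c := by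
  have h0 := hg.and hg'
  have hsymm : Tendsto (extChartAt (𝓡 4) p).symm (𝓝 (extChartAt (𝓡 4) p p)) (𝓝 p) := by
    have := continuousAt_extChartAt_symm (I := 𝓡 4) p
    rwa [ContinuousAt, extChartAt_to_inv] at this
  obtain ⟨r, hr, hball⟩ := Metric.eventually_nhds_iff_ball.1 ((hsymm.eventually h0).and
    ((isOpen_target_extChartAt p).mem_nhds (mem_extChartAt_target p)))
  have hd : ∀ y ∈ Metric.ball (extChartAt (𝓡 4) p p) r,
      HasFDerivAt (fun y => g ((extChartAt (𝓡 4) p).symm y) - g' ((extChartAt (𝓡 4) p).symm y))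
        (0 : E4 →L[ℝ] ℝ) y := by
    intro y hy
    obtain ⟨⟨h1, h2⟩, hyt⟩ := hball y hy
    have := (hasFDerivAt_comp_extChartAt_symm_of_hasMFDerivAt hyt h1).sub
      (hasFDerivAt_comp_extChartAt_symm_of_hasMFDerivAt hyt h2)
    rwa [sub_self] at this
  refine ⟨g p - g' p, ?_⟩
  filter_upwards [extChartAt_source_mem_nhds (I := 𝓡 4) p,
    continuousAt_extChartAt (I := 𝓡 4) p (Metric.ball_mem_nhds _ hr)] with q hqs hqb
  have h := (convex_ball (extChartAt (𝓡 4) p p) r).is_const_of_fderivWithin_eq_zero (𝕜 := ℝ)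
    (fun y hy => (hd y hy).differentiableAt.differentiableWithinAt)
    (fun y hy => by rw [fderivWithin_of_isOpen Metric.isOpen_ball hy, (hd y hy).fderiv])
    hqb (Metric.mem_ball_self hr)
  simp only [extChartAt_to_inv, (extChartAt (𝓡 4) p).left_inv hqs] at h
  linarith

variable [MulAction Circle M] {Ω : SymplecticForm M} {H J : M → ℝ} {M' : Set M}
  {θ : ∀ p : M, TangentSpace (𝓡 4) p →L[ℝ] ℝ}

/-- This is the Poincaré lemma on a ball of the chart whose preimage avoids the poles. -/
theorem IsRotationForm.exists_isPrimitiveAt (hθ : IsRotationForm Ω J M' θ) {p : M} (hp : p ∈ M') :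
    ∃ g : M → ℝ, IsPrimitiveAt θ g p := by
  have hopen : IsOpen ((extChartAt (𝓡 4) p).target ∩ (extChartAt (𝓡 4) p).symm ⁻¹' M') :=
    (continuousOn_extChartAt_symm p).isOpen_inter_preimage (isOpen_target_extChartAt p) hθ.isOpen
  have hmem : extChartAt (𝓡 4) p p
      ∈ (extChartAt (𝓡 4) p).target ∩ (extChartAt (𝓡 4) p).symm ⁻¹' M' :=
    ⟨mem_extChartAt_target p, by rw [mem_preimage, extChartAt_to_inv]; exact hp⟩
  obtain ⟨r, hr, hball⟩ := Metric.mem_nhds_iff.1 (hopen.mem_nhds hmem)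
  obtain ⟨f, hf⟩ := (convex_ball (extChartAt (𝓡 4) p p) r).exists_forall_hasFDerivAt_of_fderiv_symmetric
    Metric.isOpen_ball
    (((hθ.smooth p).differentiableOn (by simp)).mono hball)
    (fun y hy => hθ.closed p y (hball hy).1 (hball hy).2)
  refine ⟨f ∘ extChartAt (𝓡 4) p, ?_⟩
  filter_upwards [extChartAt_source_mem_nhds (I := 𝓡 4) p,
    continuousAt_extChartAt (I := 𝓡 4) p (Metric.ball_mem_nhds _ hr)] with q hqs hqb
  exact hasMFDerivAt_comp_extChartAt hqs (hf _ hqb)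

/-- The value of a rotation form on a smooth vector field is continuous off the poles. -/
theorem IsRotationForm.continuousOn_apply (hθ : IsRotationForm Ω J M' θ)
    {X : ∀ p : M, TangentSpace (𝓡 4) p}
    (hX : ∀ x : M, ContDiffOn ℝ ∞ (vecInChart X x) (extChartAt (𝓡 4) x).target) :
    ContinuousOn (fun q => θ q (X q)) M' := by
  intro p hp
  refine ContinuousAt.continuousWithinAt ?_
  have hopen : IsOpen ((extChartAt (𝓡 4) p).target ∩ (extChartAt (𝓡 4) p).symm ⁻¹' M') :=
    (continuousOn_extChartAt_symm p).isOpen_inter_preimage (isOpen_target_extChartAt p) hθ.isOpen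
  have hmem : extChartAt (𝓡 4) p p
      ∈ (extChartAt (𝓡 4) p).target ∩ (extChartAt (𝓡 4) p).symm ⁻¹' M' :=
    ⟨mem_extChartAt_target p, by rw [mem_preimage, extChartAt_to_inv]; exact hp⟩
  have h1 : ContinuousAt (fun y => oneFormInChart θ p y (vecInChart X p y))
      (extChartAt (𝓡 4) p p) :=
    (((hθ.smooth p).continuousOn.clm_apply ((hX p).continuousOn.mono inter_subset_left))
      ).continuousAt (hopen.mem_nhds hmem)
  have h2 := h1.comp (continuousAt_extChartAt (I := 𝓡 4) p)
  refine h2.congr ?_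
  filter_upwards [extChartAt_source_mem_nhds (I := 𝓡 4) p] with q hq
  have hy := (extChartAt (𝓡 4) p).map_source hq
  have h3 := chartInvDeriv_vecInChart X hy
  have h4 : oneFormInChart θ p (extChartAt (𝓡 4) p q) (vecInChart X p (extChartAt (𝓡 4) p q))
      = θ ((extChartAt (𝓡 4) p).symm (extChartAt (𝓡 4) p q))
        (X ((extChartAt (𝓡 4) p).symm (extChartAt (𝓡 4) p q))) :=
    congrArg (θ ((extChartAt (𝓡 4) p).symm (extChartAt (𝓡 4) p q))) h3
  refine h4.trans ?_
  rw [(extChartAt (𝓡 4) p).left_inv hq]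

omit [IsManifold (𝓡 4) ∞ M] [MulAction Circle M] in
theorem hasDerivAt_comp_primitive {g : M → ℝ} {γ : ℝ → M} {t : ℝ} {w : TangentSpace (𝓡 4) (γ t)}
    (hg : HasMFDerivAt (𝓡 4) 𝓘(ℝ, ℝ) g (γ t) (θ (γ t)))
    (hγ : HasMFDerivAt 𝓘(ℝ, ℝ) (𝓡 4) γ t ((1 : ℝ →L[ℝ] ℝ).smulRight (M₂ := E4) w)) :
    HasDerivAt (fun s => g (γ s)) (θ (γ t) w) t := by
  have h := hasDerivAt_comp_of_hasMFDerivAt hg.mdifferentiableAt hγ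
  rw [hg.mfderiv] at h
  exact h

/-- Continuation of a primitive along a family of curves `K(·, q)`: the integral of the form along
the curves is the difference of local primitives at the end points, uniformly in `q`. -/
theorem IsRotationForm.exists_primitive_along (hθ : IsRotationForm Ω J M' θ) {R : Set M}
    {K : ℝ → M → M} {f : ℝ → M → ℝ}
    (hK : ContinuousOn (fun z : ℝ × M => K z.1 z.2) (univ ×ˢ R))
    (hf : ∀ q ∈ R, Continuous fun t => f t q)
    (hd : ∀ (g : M → ℝ), ∀ q ∈ R, ∀ t, HasMFDerivAt (𝓡 4) 𝓘(ℝ, ℝ) g (K t q) (θ (K t q)) →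
      HasDerivAt (fun s => g (K s q)) (f t q) t)
    {p : M} (hp : p ∈ R) (hpM : ∀ t, K t p ∈ M') {g₀ : M → ℝ} (hg₀ : IsPrimitiveAt θ g₀ (K 0 p))
    (a : ℝ) :
    ∃ g : M → ℝ, IsPrimitiveAt θ g (K a p) ∧ ∀ᶠ z in 𝓝 a ×ˢ 𝓝[R] p,
      ∫ t in (0 : ℝ)..z.1, f t z.2 = g (K z.1 z.2) - g₀ (K 0 z.2) := by
  set P : ℝ → Prop := fun a => ∃ g : M → ℝ, IsPrimitiveAt θ g (K a p) ∧
    ∀ᶠ z in 𝓝 a ×ˢ 𝓝[R] p, ∫ t in (0 : ℝ)..z.1, f t z.2 = g (K z.1 z.2) - g₀ (K 0 z.2) with hP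
  have hnhds : ∀ b : ℝ, 𝓝 b ×ˢ 𝓝[R] p = 𝓝[univ ×ˢ R] (b, p) := by
    intro b; rw [nhdsWithin_prod_eq, nhdsWithin_univ]
  have hKt : ∀ b, Tendsto (fun z : ℝ × M => K z.1 z.2) (𝓝 b ×ˢ 𝓝[R] p) (𝓝 (K b p)) := by
    intro b
    rw [hnhds]
    exact hK (b, p) ⟨mem_univ _, hp⟩
  -- a primitive computes the integral over a short interval
  have hloc : ∀ (b : ℝ) (h : M → ℝ), IsPrimitiveAt θ h (K b p) → ∃ ε > 0,
      ∀ᶠ q in 𝓝[R] p, ∀ t ∈ Metric.ball b ε, ∀ t' ∈ Metric.ball b ε,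
        ∫ s in t..t', f s q = h (K t' q) - h (K t q) := by
    intro b h hh
    have h1 := (hKt b).eventually hh
    obtain ⟨pa, hpa, pb, hpb, hab⟩ := eventually_prod_iff.1 h1
    obtain ⟨ε, hε, hball⟩ := Metric.eventually_nhds_iff_ball.1 hpa
    refine ⟨ε, hε, ?_⟩
    filter_upwards [hpb, self_mem_nhdsWithin] with q hq hqR t ht t' ht'
    refine intervalIntegral.integral_eq_sub_of_hasDerivAt (f := fun t => h (K t q)) (fun s hs => ?_)
      ((hf q hqR).intervalIntegrable _ _)
    have hsb : s ∈ Metric.ball b ε := by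
      have hc : Convex ℝ (Metric.ball b ε) := convex_ball b ε
      exact (hc.ordConnected.uIcc_subset ht ht') hs
    exact hd h q hqR s (hab (hball s hsb) hq)
  -- Near time `b` a single primitive `h` serves for all curves. The property passes between two
  -- nearby times by replacing the continued primitive with `h` plus a constant; connectedness of
  -- the line does the rest.
  have hstep : ∀ b : ℝ, ∀ᶠ b' in 𝓝 b, (P b ↔ P b') := by
    intro b
    obtain ⟨h, hh⟩ := hθ.exists_isPrimitiveAt (hpM b)
    obtain ⟨ε, hε, hintegral⟩ := hloc b h hh
    have hcurve : ContinuousAt (fun t => K t p) b :=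
      (hKt b).comp (tendsto_id.prodMk (tendsto_const_pure.mono_right (pure_le_nhdsWithin hp)) :
        Tendsto (fun t : ℝ => (t, p)) (𝓝 b) (𝓝 b ×ˢ 𝓝[R] p))
    have hprim : ∀ᶠ b' in 𝓝 b, IsPrimitiveAt θ h (K b' p) :=
      hcurve.eventually hh.eventually_nhds
    have hkey : ∀ a ∈ Metric.ball b ε, ∀ a' ∈ Metric.ball b ε, IsPrimitiveAt θ h (K a p) →
        IsPrimitiveAt θ h (K a' p) → P a → P a' := by
      rintro a ha a' ha' hpa hpa' ⟨g, hg, hga⟩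
      obtain ⟨c, hc⟩ := hg.exists_eq_add hpa
      refine ⟨fun q => h q + c, ?_, ?_⟩
      · filter_upwards [hpa'] with q hq
        have := hq.add (hasMFDerivAt_const (I := 𝓡 4) (I' := 𝓘(ℝ, ℝ)) c q)
        refine this.congr_mfderiv ?_
        ext w
        exact add_zero _
      · have h2 : ∀ᶠ q in 𝓝[R] p, ∫ t in (0 : ℝ)..a, f t q = h (K a q) + c - g₀ (K 0 q) := by
          have h3 := hga.and ((hKt a).eventually hc)
          filter_upwards [(tendsto_const_nhds.prodMk tendsto_id :
            Tendsto (fun q : M => (a, q)) (𝓝[R] p) (𝓝 a ×ˢ 𝓝[R] p)).eventually h3] with q hq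
          rw [hq.1, hq.2]
        have hev : ∀ᶠ t in 𝓝 a', t ∈ Metric.ball b ε := Metric.isOpen_ball.mem_nhds ha'
        filter_upwards [hev.prod_mk ((h2.and hintegral).and self_mem_nhdsWithin)]
        rintro ⟨t, q⟩ ⟨ht, ⟨hq1, hq2⟩, hqR⟩
        have h4 := intervalIntegral.integral_add_adjacent_intervals
          ((hf q hqR).intervalIntegrable (μ := MeasureTheory.volume) 0 a)
          ((hf q hqR).intervalIntegrable (μ := MeasureTheory.volume) a t)
        change ∫ s in (0 : ℝ)..t, f s q = h (K t q) + c - g₀ (K 0 q)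
        rw [← h4, hq1, hq2 a ha t ht]
        ring
    filter_upwards [hprim, Metric.ball_mem_nhds b hε] with b' hb' hbε
    exact ⟨hkey b (Metric.mem_ball_self hε) b' hbε hh hb',
      hkey b' hbε b (Metric.mem_ball_self hε) hb' hh⟩
  have h0 : P 0 := by
    refine ⟨g₀, hg₀, ?_⟩
    obtain ⟨ε, hε, hintegral⟩ := hloc 0 g₀ hg₀
    have hev : ∀ᶠ t in 𝓝 (0 : ℝ), t ∈ Metric.ball 0 ε := Metric.ball_mem_nhds _ hε
    filter_upwards [hev.prod_mk hintegral]
    rintro ⟨t, q⟩ ⟨ht, hq⟩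
    exact hq 0 (Metric.mem_ball_self hε) t ht
  have hiff := isPreconnected_univ.induction₂ (fun a a' : ℝ => (P a ↔ P a'))
    (fun b _ => by rw [nhdsWithin_univ]; exact hstep b) (fun _ _ _ _ _ _ h1 h2 => h1.trans h2)
    (fun _ _ _ _ h => h.symm) (mem_univ (0 : ℝ)) (mem_univ a)
  exact hiff.1 h0

variable [T2Space M]

/-- The regular fibres without poles. -/
def goodPoints (H J : M → ℝ) (M' : Set M) : Set M :=
  {p | p ∈ regularPoints H J ∧ fibre H J (energyMomentum H J p) ⊆ M'}

namespace IsRegularSystem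

variable (S : IsRegularSystem Ω H J)
include S

/-- The complement of the poles is open, so with a regular fibre it contains the neighbouring ones.
-/
theorem goodPoints_mem_nhdsWithin (hθ : IsRotationForm Ω J M' θ) {p : M}
    (hp : p ∈ goodPoints H J M') : goodPoints H J M' ∈ 𝓝[regularPoints H J] p := by
  have h1 : Tendsto (energyMomentum H J) (𝓝[regularPoints H J] p)
      (𝓝[regularValues H J] (energyMomentum H J p)) :=
    tendsto_nhdsWithin_iff.2 ⟨S.contMDiff_energyMomentum.continuous.continuousWithinAt,
      eventually_mem_nhdsWithin⟩
  filter_upwards [h1.eventually (S.eventually_fibre_subset hp.1 hθ.isOpen hp.2),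
    self_mem_nhdsWithin] with q hq hqr
  exact ⟨hqr, hq⟩

omit [IsManifold (𝓡 4) ∞ M] [T2Space M] in
theorem smul_mem_of_mem_goodPoints {p : M} (hp : p ∈ goodPoints H J M') (z : Circle) :
    z • p ∈ M' :=
  hp.2 (S.energyMomentum_smul z p)

theorem flowH_mem_of_mem_goodPoints {p : M} (hp : p ∈ goodPoints H J M') (t : ℝ) :
    flowH Ω H p t ∈ M' :=
  hp.2 (S.energyMomentum_flowH hp.1 t)

theorem continuous_form_hamVec_flowH (hθ : IsRotationForm Ω J M' θ) {p : M}
    (hp : p ∈ goodPoints H J M') :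
    Continuous fun t => θ (flowH Ω H p t) (hamVec Ω H (flowH Ω H p t)) :=
  (hθ.continuousOn_apply (contDiffOn_vecInChart_hamVec Ω S.smooth_H)).comp_continuous
    (S.isMIntegralCurve_flowH hp.1).continuous fun t => S.flowH_mem_of_mem_goodPoints hp t

omit [T2Space M] in
/-- Primitives at the end points of segments of `X_J`-orbits. -/
theorem exists_primitive_along_circle (hθ : IsRotationForm Ω J M' θ) {p : M}
    (hp : p ∈ goodPoints H J M') {g₀ : M → ℝ} (hg₀ : IsPrimitiveAt θ g₀ p) (a : ℝ) :
    ∃ g : M → ℝ, IsPrimitiveAt θ g (Circle.exp a • p) ∧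
      ∀ᶠ z in 𝓝 a ×ˢ 𝓝[goodPoints H J M'] p, z.1 = g (Circle.exp z.1 • z.2) - g₀ z.2 := by
  have h := hθ.exists_primitive_along (R := goodPoints H J M') (K := fun t q => Circle.exp t • q)
    (f := fun _ _ => 1)
    (S.continuous_smul.comp (f := fun z : ℝ × M => (Circle.exp z.1, z.2))
      (by fun_prop)).continuousOn (fun _ _ => continuous_const)
    (fun g q hq t hg => by
      have h1 := hasDerivAt_comp_primitive (θ := θ) (γ := fun s : ℝ => Circle.exp s • q) hg
        (S.generator q t)
      exact h1.congr_deriv (hθ.normalized _ (S.smul_mem_of_mem_goodPoints hq _)))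
    hp (fun t => S.smul_mem_of_mem_goodPoints hp _) (g₀ := g₀)
    (by simpa using hg₀) a
  simpa using h

/-- Primitives at the end points of segments of `X_H`-orbits. -/
theorem exists_primitive_along_flowH (hθ : IsRotationForm Ω J M' θ) {p : M}
    (hp : p ∈ goodPoints H J M') {g₀ : M → ℝ} (hg₀ : IsPrimitiveAt θ g₀ p) (a : ℝ) :
    ∃ g : M → ℝ, IsPrimitiveAt θ g (flowH Ω H p a) ∧
      ∀ᶠ z in 𝓝 a ×ˢ 𝓝[goodPoints H J M'] p,
        ∫ t in (0 : ℝ)..z.1, θ (flowH Ω H z.2 t) (hamVec Ω H (flowH Ω H z.2 t))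
          = g (flowH Ω H z.2 z.1) - g₀ z.2 := by
  obtain ⟨g, hg, h⟩ := hθ.exists_primitive_along (R := goodPoints H J M')
    (K := fun t q => flowH Ω H q t)
    (f := fun t q => θ (flowH Ω H q t) (hamVec Ω H (flowH Ω H q t)))
    (S.continuousOn_flowH.mono (prod_mono_right fun q hq => hq.1))
    (fun q hq => S.continuous_form_hamVec_flowH hθ hq)
    (fun g q hq t hg => hasDerivAt_comp_primitive (θ := θ) hg (S.isMIntegralCurve_flowH hq.1 t))
    hp (fun t => S.flowH_mem_of_mem_goodPoints hp t) (g₀ := g₀)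
    (by rw [S.flowH_zero hp.1]; exact hg₀) a
  refine ⟨g, hg, ?_⟩
  have h2 : ∀ᶠ z in 𝓝 a ×ˢ 𝓝[goodPoints H J M'] p, z.2 ∈ goodPoints H J M' :=
    tendsto_snd.eventually eventually_mem_nhdsWithin
  filter_upwards [h, h2] with z hz hzg
  rw [hz, S.flowH_zero hzg.1]

/-- The difference of the integral of the rotation form and the rotation angle is locally
constant. -/
theorem exists_orbitIntegral_sub_eq (hθ : IsRotationForm Ω J M' θ) {p : M}
    (hp : p ∈ goodPoints H J M') {τ₀ : ℝ}
    (hτ₀ : Circle.exp τ₀ = Circle.exp (rotationNumber Ω H p)) :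
    ∃ ε > 0, ∀ᶠ q in 𝓝[regularPoints H J] p, ∀ τ, |τ - τ₀| < ε →
      Circle.exp τ = Circle.exp (rotationNumber Ω H q) →
      orbitIntegral Ω H θ q - τ = orbitIntegral Ω H θ p - τ₀ := by
  obtain ⟨g₀, hg₀⟩ := hθ.exists_isPrimitiveAt (hp.2 rfl)
  obtain ⟨g, hg, hgint⟩ := S.exists_primitive_along_flowH hθ hp hg₀ (firstReturn Ω H p)
  obtain ⟨g', hg', hgint'⟩ := S.exists_primitive_along_circle hθ hp hg₀ τ₀
  -- The `X_H`-segment and the circle segment of angle `τ₀` end at the same point. The primitives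
  -- continued from `g₀` along the two therefore differ near that point by a constant `c`. For
  -- nearby `q` the end values give `Φ(q) = τ + c`.
  rw [S.flowH_firstReturn hp.1, ← hτ₀] at hg
  obtain ⟨c, hc⟩ := hg.exists_eq_add hg'
  have hT : Tendsto (fun q => (firstReturn Ω H q, q)) (𝓝[goodPoints H J M'] p)
      (𝓝 (firstReturn Ω H p) ×ˢ 𝓝[goodPoints H J M'] p) :=
    ((S.tendsto_firstReturn hp.1).mono_left (nhdsWithin_mono _ fun q hq => hq.1)).prodMk tendsto_id
  have h1 := hT.eventually hgint
  have hct : Tendsto (fun z : ℝ × M => Circle.exp z.1 • z.2)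
      (𝓝 τ₀ ×ˢ 𝓝[goodPoints H J M'] p) (𝓝 (Circle.exp τ₀ • p)) := by
    have h2 : Continuous (fun z : ℝ × M => Circle.exp z.1 • z.2) :=
      S.continuous_smul.comp (f := fun z : ℝ × M => (Circle.exp z.1, z.2)) (by fun_prop)
    refine (h2.tendsto (τ₀, p)).mono_left ?_
    rw [nhds_prod_eq]
    exact prod_mono le_rfl nhdsWithin_le_nhds
  have h3 := (hct.eventually hc).and hgint'
  obtain ⟨pa, hpa, pb, hpb, hab⟩ := eventually_prod_iff.1 h3
  obtain ⟨ε, hε, hball⟩ := Metric.eventually_nhds_iff_ball.1 hpa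
  have key : ∀ᶠ q in 𝓝[goodPoints H J M'] p, ∀ τ, |τ - τ₀| < ε →
      Circle.exp τ = Circle.exp (rotationNumber Ω H q) → orbitIntegral Ω H θ q = τ + c := by
    filter_upwards [h1, hpb, self_mem_nhdsWithin] with q hq1 hq2 hqg τ hτ hτq
    obtain ⟨h4, h5⟩ := hab (hball τ (by simpa [Real.dist_eq] using hτ)) hq2
    dsimp only at h4 h5 hq1
    rw [orbitIntegral, hq1, S.flowH_firstReturn hqg.1, ← hτq, h4]
    linarith
  have hkp := (key.self_of_nhdsWithin hp) τ₀ (by simpa using hε) hτ₀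
  have hle : 𝓝[regularPoints H J] p ≤ 𝓝[goodPoints H J M'] p :=
    nhdsWithin_le_iff.2 (S.goodPoints_mem_nhdsWithin hθ hp)
  refine ⟨ε, hε, ?_⟩
  filter_upwards [hle key] with q hq τ hτ hτq
  rw [hq τ hτ hτq, hkp]
  ring

/-- The integral of the rotation form is constant on the regular fibres without poles. -/
theorem orbitIntegral_eq_of_mem_fibre (hθ : IsRotationForm Ω J M' θ) {p q : M}
    (hp : p ∈ goodPoints H J M') (hq : energyMomentum H J q = energyMomentum H J p) :
    orbitIntegral Ω H θ q = orbitIntegral Ω H θ p := by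
  refine (S.connected _ hp.1).isPreconnected.induction₂
    (fun x y => orbitIntegral Ω H θ x = orbitIntegral Ω H θ y) (fun x hx => ?_)
    (fun _ _ _ _ _ _ h1 h2 => h1.trans h2) (fun _ _ _ _ h => h.symm) hq rfl
  have hx' : energyMomentum H J x = energyMomentum H J p := hx
  have hxr : x ∈ regularPoints H J := by
    rw [regularPoints, mem_ofPred_eq, hx']; exact hp.1
  have hxg : x ∈ goodPoints H J M' := ⟨hxr, by rw [hx']; exact hp.2⟩
  obtain ⟨ε, hε, h⟩ := S.exists_orbitIntegral_sub_eq hθ hxg (τ₀ := rotationNumber Ω H x) rfl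
  have hsub : fibre H J (energyMomentum H J p) ⊆ regularPoints H J := fun y hy => by
    have hy' : energyMomentum H J y = energyMomentum H J p := hy
    rw [regularPoints, mem_ofPred_eq, hy']; exact hp.1
  filter_upwards [nhdsWithin_mono _ hsub h, self_mem_nhdsWithin] with y hy hyf
  obtain ⟨a, rfl⟩ := S.exists_torusFlow_eq hxr (q := y) (Eq.trans hyf hx'.symm)
  -- The rotation number is the same at both points, so local constancy of the difference is local
  -- constancy of the integral.
  have := hy (rotationNumber Ω H x) (by simpa using hε) (by rw [S.rotationNumber_torusFlow hxr])
  linarith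

/-- The value of the rotation form on `X_H` is invariant under the circle action. -/
theorem form_hamVec_smul (hθ : IsRotationForm Ω J M' θ) {p : M} (hp : p ∈ goodPoints H J M')
    (z : Circle) : θ (z • p) (hamVec Ω H (z • p)) = θ p (hamVec Ω H p) := by
  obtain ⟨a, rfl⟩ : ∃ a : ℝ, Circle.exp a = z := ⟨_, Circle.exp_arg z⟩
  obtain ⟨g₀, hg₀⟩ := hθ.exists_isPrimitiveAt (hp.2 rfl)
  obtain ⟨g, hg, hgint⟩ := S.exists_primitive_along_circle hθ hp hg₀ a
  have h1 : ∀ᶠ q in 𝓝[goodPoints H J M'] p, a = g (Circle.exp a • q) - g₀ q :=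
    (tendsto_const_nhds.prodMk tendsto_id :
      Tendsto (fun q : M => (a, q)) (𝓝[goodPoints H J M'] p)
        (𝓝 a ×ˢ 𝓝[goodPoints H J M'] p)).eventually hgint
  have h2 : Tendsto (flowH Ω H p) (𝓝 0) (𝓝[goodPoints H J M'] p) := by
    refine tendsto_nhdsWithin_iff.2 ⟨?_, Eventually.of_forall fun t => ?_⟩
    · have := (S.isMIntegralCurve_flowH hp.1).continuous.tendsto 0
      rwa [S.flowH_zero hp.1] at this
    · refine ⟨S.flowH_mem_regularPoints hp.1 t, ?_⟩
      rw [S.energyMomentum_flowH hp.1]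
      exact hp.2
  -- Near `p` the function `g(exp(a) • q) - g₀(q)` has the constant value `a`; differentiating it
  -- along the flow of `X_H` compares the two values of the form.
  have hd0 := hasDerivAt_comp_primitive (θ := θ) (g := g₀) (t := 0)
    (by rw [S.flowH_zero hp.1]; exact hg₀.self_of_nhds) (S.isMIntegralCurve_flowH hp.1 0)
  have hd1 := hasDerivAt_comp_primitive (θ := θ) (g := g) (t := 0)
    (γ := fun t => Circle.exp a • flowH Ω H p t)
    (by rw [S.flowH_zero hp.1]; exact hg.self_of_nhds)
    (S.isMIntegralCurve_smul (Circle.exp a) (S.isMIntegralCurve_flowH hp.1) 0)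
  have hd2 := (hd0.add_const a).congr_of_eventuallyEq
    (f₁ := fun t => g (Circle.exp a • flowH Ω H p t)) (by
      filter_upwards [h2.eventually h1] with t ht
      linarith)
  have : θ (Circle.exp a • flowH Ω H p 0) (hamVec Ω H (Circle.exp a • flowH Ω H p 0))
      = θ (flowH Ω H p 0) (hamVec Ω H (flowH Ω H p 0)) := hd1.unique hd2
  rwa [S.flowH_zero hp.1] at this

end IsRegularSystem

end Primitives

/-! ### Transversal crossings with the image of the poles are isolated -/

section Crossings

/-- If a plane field of rank one is complemented by a vector, then a solution of the linearized
crossing problem is trivial. -/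
theorem eq_zero_of_span_eq_top {E : Type*} [AddCommGroup E] [Module ℝ E] [FiniteDimensional ℝ E]
    (hE : Module.finrank ℝ E = 4) {G D : E →ₗ[ℝ] ℝ × ℝ} {lam : E →ₗ[ℝ] ℝ} {X : E} {w : ℝ × ℝ}
    (hG : Function.Surjective G) (hGX : G X = 0) (hDX : D X = 0) (hlam : lam X = 1)
    {A : Set (ℝ × ℝ)} (hA : A ⊆ (LinearMap.ker G).map D) (hspan : Submodule.span ℝ ({w} ∪ A) = ⊤)
    {v : E} {σ : ℝ} (h1 : G v = 0) (h2 : D v = σ • w) (h3 : lam v = 0) : v = 0 ∧ σ = 0 := by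
  have h2d : Module.finrank ℝ (ℝ × ℝ) = 2 := by simp
  have hker : Module.finrank ℝ (LinearMap.ker G) = 2 := by
    have h := LinearMap.finrank_range_add_finrank_ker G
    rw [LinearMap.range_eq_top.2 hG, finrank_top, hE] at h
    simp at h
    omega
  set D' : LinearMap.ker G →ₗ[ℝ] ℝ × ℝ := D.domRestrict (LinearMap.ker G) with hD'
  have hrange : LinearMap.range D' = (LinearMap.ker G).map D := LinearMap.range_domRestrict _ _
  have hrn := LinearMap.finrank_range_add_finrank_ker D'
  rw [hker] at hrn
  have hX0 : X ≠ 0 := by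
    rintro rfl
    simp at hlam
  let X' : LinearMap.ker D' := ⟨⟨X, hGX⟩, hDX⟩
  have hX' : X' ≠ 0 := fun h => hX0 (congrArg (fun y : LinearMap.ker D' => ((y : LinearMap.ker G) : E)) h)
  have hkpos : 0 < Module.finrank ℝ (LinearMap.ker D') :=
    Module.finrank_pos_iff_exists_ne_zero.2 ⟨X', hX'⟩
  -- The kernel of `G` is a plane and contains `X`, which `D` kills, so `D` maps it to at most a
  -- line. If `σ` were nonzero, `w` would lie in this image, and together with `A` it would span the
  -- plane inside it.
  have hσ : σ = 0 := by
    by_contra hσ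
    have hw : w ∈ (LinearMap.ker G).map D := by
      refine ⟨σ⁻¹ • v, by simp [h1], ?_⟩
      rw [map_smul, h2, smul_smul, inv_mul_cancel₀ hσ, one_smul]
    have htop : (LinearMap.ker G).map D = ⊤ := by
      rw [eq_top_iff, ← hspan, Submodule.span_le]
      rintro x (rfl | hx)
      · exact hw
      · exact hA hx
    rw [hrange, htop, finrank_top, h2d] at hrn
    omega
  refine ⟨?_, hσ⟩
  -- The image is not zero either, since `w` alone does not span the plane. Hence `D` kills only the
  -- multiples of `X` in the kernel of `G`, and `lam` detects those.
  have hrpos : 0 < Module.finrank ℝ (LinearMap.range D') := by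
    by_contra hn
    have h0 : Module.finrank ℝ (LinearMap.range D') = 0 := by omega
    have hbot := Submodule.finrank_eq_zero.1 h0
    rw [hrange] at hbot
    have hle : Submodule.span ℝ ({w} ∪ A) ≤ Submodule.span ℝ {w} := by
      rw [Submodule.span_le]
      rintro x (rfl | hx)
      · exact Submodule.mem_span_singleton_self _
      · have := hA hx
        rw [hbot] at this
        rw [show x = 0 from this]
        exact zero_mem _
    have h5 := Submodule.finrank_mono hle
    rw [hspan, finrank_top, h2d] at h5
    have h6 : Module.finrank ℝ (Submodule.span ℝ {w}) ≤ 1 := by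
      simpa using finrank_span_le_card (R := ℝ) ({w} : Set (ℝ × ℝ))
    omega
  have hk1 : Module.finrank ℝ (LinearMap.ker D') = 1 := by omega
  obtain ⟨c, hc⟩ := (finrank_eq_one_iff_of_nonzero' X' hX').1 hk1
    ⟨⟨v, h1⟩, by simpa [hD', hσ] using h2⟩
  have hv : c • X = v := congrArg (fun y : LinearMap.ker D' => ((y : LinearMap.ker G) : E)) hc
  rw [← hv, map_smul, hlam] at h3
  have hc0 : c = 0 := by simpa using h3
  rw [← hv, hc0, zero_smul]

variable {M : Type*} [TopologicalSpace M] [ChartedSpace E4 M] [MulAction Circle M]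
  {Ω : SymplecticForm M} {H J : M → ℝ} {M' : Set M}
  {θ : ∀ p : M, TangentSpace (𝓡 4) p →L[ℝ] ℝ}

theorem IsRotationForm.smul_mem_compl (hθ : IsRotationForm Ω J M' θ) {p : M} (hp : p ∈ M'ᶜ)
    (z : Circle) : z • p ∈ M'ᶜ := fun h => hp (by simpa using hθ.invariant z⁻¹ _ h)

theorem IsCircleIntegrable.continuous_expSmul (h : IsCircleIntegrable Ω H J) :
    Continuous (fun z : ℝ × M => Circle.exp z.1 • z.2) :=
  h.continuous_smul.comp (f := fun z : ℝ × M => (Circle.exp z.1, z.2)) (by fun_prop)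

/-- Points near `p` can be moved along their circle orbits to a slice through `p`. -/
theorem IsCircleIntegrable.eventually_exists_smul_mem_slice [IsManifold (𝓡 4) ∞ M]
    (h : IsCircleIntegrable Ω H J) {p : M} {lam : E4 →L[ℝ] ℝ} (hlam : lam (hamVec Ω J p) = 1)
    {N : Set M} (hN : N ∈ 𝓝 p) :
    ∀ᶠ q in 𝓝 p, ∃ z : Circle, z • q ∈ N ∧
      lam (extChartAt (𝓡 4) p (z • q)) = lam (extChartAt (𝓡 4) p p) := by
  -- The height `lam` increases along the circle orbit of `p` with speed one. Its strict
  -- inequalities at the angles `±η` persist for nearby orbits, and the intermediate value theorem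
  -- finds the slice.
  set f : ℝ × M → ℝ := fun y => lam (extChartAt (𝓡 4) p (Circle.exp y.1 • y.2)) with hf
  have h0 : Circle.exp 0 • p = p := by simp
  have hsmul := h.continuous_expSmul
  have hsrc : IsOpen (extChartAt (𝓡 4) p).source := isOpen_extChartAt_source p
  have hsmul0 : Tendsto (fun z : ℝ × M => Circle.exp z.1 • z.2) (𝓝 (0, p)) (𝓝 p) := by
    have := hsmul.tendsto (0, p)
    rwa [h0] at this
  have hfc : ∀ y : ℝ × M, Circle.exp y.1 • y.2 ∈ (extChartAt (𝓡 4) p).source →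
      ContinuousAt f y := fun y hy =>
    lam.continuous.continuousAt.comp
      (ContinuousAt.comp (continuousAt_extChartAt' (I := 𝓡 4) (x := p) (by simpa using hy))
        hsmul.continuousAt)
  have hd : HasDerivAt (fun t => f (t, p)) 1 0 := by
    have h1 := hasDerivAt_extChartAt_comp (X := hamVec Ω J) (x := p) (h.generator p 0)
      (by rw [h0]; exact mem_extChartAt_source p)
    have h2 := lam.hasFDerivAt.comp_hasDerivAt (0 : ℝ) h1
    refine h2.congr_deriv ?_
    rw [h0]
    exact (congrArg lam (vecInChart_self (hamVec Ω J) p)).trans hlam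
  have hN' : ∀ᶠ y : ℝ × M in 𝓝 (0, p), Circle.exp y.1 • y.2 ∈ N ∩ (extChartAt (𝓡 4) p).source :=
    hsmul0 (inter_mem hN (hsrc.mem_nhds (mem_extChartAt_source p)))
  rw [nhds_prod_eq] at hN'
  obtain ⟨pa, hpa, pb, hpb, hab⟩ := eventually_prod_iff.1 hN'
  obtain ⟨r, hr, hball⟩ := Metric.eventually_nhds_iff_ball.1 hpa
  have hsign : ∀ᶠ t in 𝓝[>] (0 : ℝ), f (-t, p) < f (0, p) ∧ f (0, p) < f (t, p) := by
    have e1 := hd.tendsto_slope.eventually (lt_mem_nhds (by norm_num : (0 : ℝ) < 1))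
    have hpos : Tendsto (fun t : ℝ => t) (𝓝[>] 0) (𝓝[≠] 0) :=
      nhdsWithin_mono _ fun t ht => ne_of_gt ht
    have hneg : Tendsto (fun t : ℝ => -t) (𝓝[>] 0) (𝓝[≠] 0) := by
      refine tendsto_nhdsWithin_iff.2 ⟨?_, ?_⟩
      · have : Tendsto (fun t : ℝ => -t) (𝓝 0) (𝓝 (-0)) := tendsto_id.neg
        rw [neg_zero] at this
        exact this.mono_left nhdsWithin_le_nhds
      · filter_upwards [self_mem_nhdsWithin] with t ht
        simpa using ne_of_gt ht
    filter_upwards [hpos.eventually e1, hneg.eventually e1, self_mem_nhdsWithin] with t h1 h2 ht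
    have ht' : (0 : ℝ) < t := ht
    rw [slope_def_field, sub_zero] at h1 h2
    constructor
    · rcases div_pos_iff.1 h2 with h | h <;> linarith [h.1, h.2]
    · rcases div_pos_iff.1 h1 with h | h <;> linarith [h.1, h.2]
  obtain ⟨η, hη, hηr, hη0⟩ := (hsign.and (Ioo_mem_nhdsGT hr)).exists
  have hmemr : ∀ t ∈ Icc (-η) η, pa t := fun t ht => hball t (by
    rw [Metric.mem_ball, dist_zero_right, Real.norm_eq_abs, abs_lt]
    exact ⟨by linarith [ht.1], by linarith [ht.2]⟩)
  have hpbp : pb p := hpb.self_of_nhds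
  have hq1 : ∀ᶠ q in 𝓝 p, f (-η, q) < f (0, p) := by
    have hc := (hfc (-η, p) (hab (hmemr (-η) ⟨le_rfl, by linarith⟩) hpbp).2).comp
      (f := fun q : M => (-η, q)) (by fun_prop)
    exact hc.eventually (gt_mem_nhds hη.1)
  have hq2 : ∀ᶠ q in 𝓝 p, f (0, p) < f (η, q) := by
    have hc := (hfc (η, p) (hab (hmemr η ⟨by linarith, le_rfl⟩) hpbp).2).comp
      (f := fun q : M => (η, q)) (by fun_prop)
    exact hc.eventually (lt_mem_nhds hη.2)
  filter_upwards [hq1, hq2, hpb] with q h1 h2 h3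
  have hcont : ContinuousOn (fun t => f (t, q)) (Icc (-η) η) := fun t ht =>
    ((hfc (t, q) (hab (hmemr t ht) h3).2).comp (f := fun t : ℝ => (t, q))
      (by fun_prop)).continuousWithinAt
  obtain ⟨t, ht, hft⟩ := intermediate_value_Icc (by linarith) hcont ⟨h1.le, h2.le⟩
  refine ⟨Circle.exp t, (hab (hmemr t ht) h3).1, ?_⟩
  simpa [hf] using hft

omit [MulAction Circle M] in
theorem differentialAt_eq_zero_of_mem_tangentDirections {E : Type*} [NormedAddCommGroup E]
    [NormedSpace ℝ E] {S U : Set M} {g : M → E} {p : M} (hU : U ∈ 𝓝 p)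
    (hg : MDifferentiableAt (𝓡 4) 𝓘(ℝ, E) g p) (hS : ∀ q ∈ S ∩ U, g q = 0)
    {v : TangentSpace (𝓡 4) p} (hv : v ∈ tangentDirections S p) : differentialAt g p v = 0 := by
  obtain ⟨c, rfl, hcS, hc⟩ := hv
  have h1 := hasDerivAt_comp_of_hasMFDerivAt hg hc
  have h2 : (fun t => g (c t)) =ᶠ[𝓝 0] fun _ => (0 : E) := by
    filter_upwards [hcS, hc.continuousAt hU] with t h3 h4
    exact hS _ ⟨h3, h4⟩
  exact h1.unique ((hasDerivAt_const (0 : ℝ) (0 : E)).congr_of_eventuallyEq h2)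

/-- Invariance of the pole set keeps the circle orbit inside it. This tangent vector in the kernel
of `dF` is what bounds the rank of `dF` along the poles. -/
theorem IsCircleIntegrable.hamVec_mem_tangentDirections (h : IsCircleIntegrable Ω H J)
    (hθ : IsRotationForm Ω J M' θ) {p : M} (hp : p ∈ M'ᶜ) :
    hamVec Ω J p ∈ tangentDirections M'ᶜ p := by
  refine ⟨fun t => Circle.exp t • p, by simp,
    Eventually.of_forall fun t => hθ.smul_mem_compl hp _, ?_⟩
  refine (h.generator p 0).congr_mfderiv ?_
  have h1 : ∀ q : M, q = p → (hamVec Ω J q : E4) = hamVec Ω J p := by rintro q rfl; rfl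
  exact congrArg (fun w : E4 => (1 : ℝ →L[ℝ] ℝ).smulRight (M₂ := E4) w) (h1 _ (by simp))

variable [IsManifold (𝓡 4) ∞ M]

/-- Near a pole over a transversal crossing there are no poles over other points of the path. -/
theorem IsCircleIntegrable.eventually_crossing_eq (h : IsCircleIntegrable Ω H J)
    (hθ : IsRotationForm Ω J M' θ) {p : M} (hpr : p ∈ regularPoints H J) (hp : p ∈ M'ᶜ)
    (hsurf : IsSmoothSurfaceAt M'ᶜ p) {Γ : ℝ → ℝ × ℝ} {s₀ : ℝ} (hΓ : DifferentiableAt ℝ Γ s₀)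
    (hs₀ : energyMomentum H J p = Γ s₀) (htr : IsTransversalToImage H J M'ᶜ Γ) :
    ∀ᶠ z : M × ℝ in 𝓝 p ×ˢ 𝓝 s₀, z.1 ∈ M'ᶜ → energyMomentum H J z.1 = Γ z.2 → z.2 = s₀ := by
  obtain ⟨U, g, hUo, hpU, hg, hgs, hgU⟩ := hsurf
  have hgd : MDifferentiableAt (𝓡 4) 𝓘(ℝ, ℝ × ℝ) g p :=
    (hg.contMDiffAt (hUo.mem_nhds hpU)).mdifferentiableAt (by simp)
  have hg0 : ∀ q ∈ M'ᶜ ∩ U, g q = 0 := fun q hq => by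
    rw [hgU] at hq
    exact hq.2
  obtain ⟨L, -, hL, -⟩ := h.exists_dual_coordinates hpr
  let lam : E4 →L[ℝ] ℝ := (ContinuousLinearMap.snd ℝ ℝ ℝ).comp L
  have hlam : lam (hamVec Ω J p) = 1 := congrArg Prod.snd hL
  let G : E4 →L[ℝ] ℝ × ℝ := differentialAt g p
  let D : E4 →L[ℝ] ℝ × ℝ := differentialAt (energyMomentum H J) p
  have hker : ∀ v ∈ tangentDirections M'ᶜ p, G v = 0 := fun v hv =>
    differentialAt_eq_zero_of_mem_tangentDirections (hUo.mem_nhds hpU) hgd hg0 hv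
  have hDX : D (hamVec Ω J p) = 0 := by
    refine (h.differentialAt_energyMomentum p (hamVec Ω J p)).trans ?_
    exact Prod.ext (h.commute p) (Ω.alternating p _)
  have hA : {w : ℝ × ℝ | ∃ v ∈ tangentDirections M'ᶜ p,
        mfderiv (𝓡 4) 𝓘(ℝ, ℝ × ℝ) (energyMomentum H J) p v = w}
      ⊆ (LinearMap.ker (G : E4 →ₗ[ℝ] ℝ × ℝ)).map (D : E4 →ₗ[ℝ] ℝ × ℝ) := by
    rintro w ⟨v, hv, rfl⟩
    exact ⟨v, hker v hv, rfl⟩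
  -- A pole over `Γ s` that lies in the slice has the same value of `f` as the pair of `p` and `s₀`.
  -- The differential of `f` at that pair is injective by transversality, so no other nearby pair
  -- has this value. Differentiability at one point suffices here, and no inverse function theorem
  -- is needed.
  let f : E4 × ℝ → (ℝ × ℝ) × (ℝ × ℝ) × ℝ := fun z =>
    (g ((extChartAt (𝓡 4) p).symm z.1),
      (energyMomentum H J ((extChartAt (𝓡 4) p).symm z.1) - Γ z.2, lam z.1))
  let f' : E4 × ℝ →L[ℝ] (ℝ × ℝ) × (ℝ × ℝ) × ℝ :=
    (G.comp (ContinuousLinearMap.fst ℝ E4 ℝ)).prod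
      ((D.comp (ContinuousLinearMap.fst ℝ E4 ℝ)
        - (fderiv ℝ Γ s₀).comp (ContinuousLinearMap.snd ℝ E4 ℝ)).prod
        (lam.comp (ContinuousLinearMap.fst ℝ E4 ℝ)))
  have hf : HasFDerivAt f f' (extChartAt (𝓡 4) p p, s₀) := by
    have e1 : HasFDerivAt (fun z : E4 × ℝ => g ((extChartAt (𝓡 4) p).symm z.1))
        (G.comp (ContinuousLinearMap.fst ℝ E4 ℝ)) (extChartAt (𝓡 4) p p, s₀) :=
      HasFDerivAt.comp (extChartAt (𝓡 4) p p, s₀) (f := Prod.fst)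
        (hasFDerivAt_comp_extChartAt_symm_self hgd) hasFDerivAt_fst
    have e2 : HasFDerivAt
        (fun z : E4 × ℝ => energyMomentum H J ((extChartAt (𝓡 4) p).symm z.1))
        (D.comp (ContinuousLinearMap.fst ℝ E4 ℝ)) (extChartAt (𝓡 4) p p, s₀) :=
      HasFDerivAt.comp (extChartAt (𝓡 4) p p, s₀) (f := Prod.fst)
        (hasFDerivAt_comp_extChartAt_symm_self (h.mdifferentiableAt_energyMomentum p))
        hasFDerivAt_fst
    have e3 : HasFDerivAt (fun z : E4 × ℝ => Γ z.2)
        ((fderiv ℝ Γ s₀).comp (ContinuousLinearMap.snd ℝ E4 ℝ)) (extChartAt (𝓡 4) p p, s₀) :=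
      HasFDerivAt.comp (extChartAt (𝓡 4) p p, s₀) (f := Prod.snd) hΓ.hasFDerivAt hasFDerivAt_snd
    have e4 : HasFDerivAt (fun z : E4 × ℝ => lam z.1)
        (lam.comp (ContinuousLinearMap.fst ℝ E4 ℝ)) (extChartAt (𝓡 4) p p, s₀) :=
      (lam.comp (ContinuousLinearMap.fst ℝ E4 ℝ)).hasFDerivAt
    exact e1.prodMk ((e2.sub e3).prodMk e4)
  have hinj : LinearMap.ker (f' : E4 × ℝ →ₗ[ℝ] (ℝ × ℝ) × (ℝ × ℝ) × ℝ) = ⊥ := by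
    rw [LinearMap.ker_eq_bot']
    rintro ⟨v, σ⟩ hv
    have hv' : (G v, (D v - fderiv ℝ Γ s₀ σ, lam v)) = ((0, (0, 0)) : (ℝ × ℝ) × (ℝ × ℝ) × ℝ) := hv
    simp only [Prod.mk.injEq] at hv'
    obtain ⟨h1, h2, h3⟩ := hv'
    have h4 : D v = σ • deriv Γ s₀ := by
      rw [sub_eq_zero.1 h2, ← fderiv_apply_one_eq_deriv, ← map_smul, smul_eq_mul, mul_one]
    obtain ⟨rfl, rfl⟩ := eq_zero_of_span_eq_top (E := E4) (by simp)
      (G := (G : E4 →ₗ[ℝ] ℝ × ℝ)) (D := (D : E4 →ₗ[ℝ] ℝ × ℝ)) (lam := (lam : E4 →ₗ[ℝ] ℝ))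
      (X := hamVec Ω J p) hgs (hker _ (h.hamVec_mem_tangentDirections hθ hp)) hDX hlam hA
      (htr s₀ p hp hs₀) h1 h4 h3
    rfl
  obtain ⟨C, -, hC⟩ := LinearMap.exists_antilipschitzWith _ hinj
  have hne := hf.eventually_ne (c := f (extChartAt (𝓡 4) p p, s₀)) ⟨C, hC⟩
  rw [eventually_nhdsWithin_iff, nhds_prod_eq] at hne
  obtain ⟨pa, hpa, pb, hpb, hab⟩ := eventually_prod_iff.1 hne
  have hN : {q | q ∈ U ∧ q ∈ (extChartAt (𝓡 4) p).source ∧ pa (extChartAt (𝓡 4) p q)} ∈ 𝓝 p :=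
    inter_mem (hUo.mem_nhds hpU) (inter_mem (extChartAt_source_mem_nhds (I := 𝓡 4) p)
      ((continuousAt_extChartAt (I := 𝓡 4) p).eventually hpa))
  -- An arbitrary nearby pole is first rotated into the slice, which changes neither its being a
  -- pole nor its energy-momentum value.
  filter_upwards [(h.eventually_exists_smul_mem_slice hlam hN).prod_mk hpb]
  rintro ⟨q, s⟩ ⟨⟨z, ⟨hzU, hzs, hza⟩, hzl⟩, hsb⟩ hq hF
  by_contra hs
  refine hab hza hsb ?_ ?_
  · intro heq
    exact hs (congrArg Prod.snd heq)
  · have e0 : (extChartAt (𝓡 4) p).symm (extChartAt (𝓡 4) p (z • q)) = z • q :=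
      (extChartAt (𝓡 4) p).left_inv hzs
    have e1 : g (z • q) = g p :=
      (hg0 _ ⟨hθ.smul_mem_compl hq z, hzU⟩).trans (hg0 _ ⟨hp, hpU⟩).symm
    change (g ((extChartAt (𝓡 4) p).symm (extChartAt (𝓡 4) p (z • q))),
      (energyMomentum H J ((extChartAt (𝓡 4) p).symm (extChartAt (𝓡 4) p (z • q))) - Γ s,
        lam (extChartAt (𝓡 4) p (z • q)))) = (g ((extChartAt (𝓡 4) p).symm (extChartAt (𝓡 4) p p)),
      (energyMomentum H J ((extChartAt (𝓡 4) p).symm (extChartAt (𝓡 4) p p)) - Γ s₀,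
        lam (extChartAt (𝓡 4) p p)))
    have hF' : energyMomentum H J q = Γ s := hF
    rw [e0, extChartAt_to_inv, e1, hzl, h.energyMomentum_smul, hF', hs₀, sub_self, sub_self]

variable [T2Space M]

/-- The crossings of a path with the image of the poles are isolated. -/
theorem IsRegularSystem.eventually_fibre_subset_of_transversal (S : IsRegularSystem Ω H J)
    (hθ : IsRotationForm Ω J M' θ)
    (hsurf : ∀ p ∈ M'ᶜ, (∃ z : Circle, z • p ≠ p) → IsSmoothSurfaceAt M'ᶜ p) {Γ : ℝ → ℝ × ℝ}
    (hΓ : Differentiable ℝ Γ) (hΓr : ∀ s, Γ s ∈ regularValues H J)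
    (htr : IsTransversalToImage H J M'ᶜ Γ) (s₀ : ℝ) :
    ∀ᶠ s in 𝓝[≠] s₀, fibre H J (Γ s) ⊆ M' := by
  have hpt : ∀ p ∈ fibre H J (Γ s₀), ∀ᶠ z : M × ℝ in 𝓝 p ×ˢ 𝓝 s₀, z.1 ∈ M'ᶜ →
      energyMomentum H J z.1 = Γ z.2 → z.2 = s₀ := by
    intro p hp
    have hp' : energyMomentum H J p = Γ s₀ := hp
    have hpr : p ∈ regularPoints H J := by
      rw [regularPoints, mem_ofPred_eq, hp']; exact hΓr s₀
    by_cases hpM : p ∈ M'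
    · have h1 : ∀ᶠ q in 𝓝 p, q ∈ M' := hθ.isOpen.mem_nhds hpM
      filter_upwards [tendsto_fst.eventually h1] with z hz hz'
      exact absurd hz hz'
    -- A pole in a regular fibre is not fixed by the circle: the action is free there and `1` is not
    -- a multiple of `2π`.
    · refine S.eventually_crossing_eq hθ hpr hpM (hsurf p hpM ⟨Circle.exp 1, fun h1 => ?_⟩)
        (hΓ s₀) hp' htr
      have h2 := S.free _ hpr p rfl _ h1
      rw [← Circle.exp_zero, Circle.exp_eq_exp] at h2
      obtain ⟨m, hm⟩ := h2
      have h3 := Real.pi_gt_three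
      have hm0 : (0 : ℝ) < m := by
        by_contra! hle
        nlinarith
      have hm1 : (1 : ℝ) ≤ m := by exact_mod_cast hm0
      nlinarith
  -- Compactness of the fibre combines the local statements into a neighbourhood of the fibre, which
  -- contains the fibres over nearby points of the path.
  obtain ⟨N, hNo, hKN, hN⟩ : ∃ N, IsOpen N ∧ fibre H J (Γ s₀) ⊆ N ∧ ∀ᶠ s in 𝓝 s₀, ∀ q ∈ N,
      q ∈ M'ᶜ → energyMomentum H J q = Γ s → s = s₀ := by
    refine (S.compact _ (hΓr s₀)).induction_on (p := fun A => ∃ N, IsOpen N ∧ A ⊆ N ∧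
      ∀ᶠ s in 𝓝 s₀, ∀ q ∈ N, q ∈ M'ᶜ → energyMomentum H J q = Γ s → s = s₀) ?_ ?_ ?_ ?_
    · exact ⟨∅, isOpen_empty, Subset.rfl, by simp⟩
    · rintro A B hAB ⟨N, h1, h2, h3⟩
      exact ⟨N, h1, hAB.trans h2, h3⟩
    · rintro A B ⟨N, h1, h2, h3⟩ ⟨N', h1', h2', h3'⟩
      refine ⟨N ∪ N', h1.union h1', union_subset_union h2 h2', ?_⟩
      filter_upwards [h3, h3'] with s h4 h4' q hq
      exact hq.elim (h4 q) (h4' q)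
    · intro p hp
      obtain ⟨pa, hpa, pb, hpb, hab⟩ := eventually_prod_iff.1 (hpt p hp)
      obtain ⟨N, hNpa, hNo, hpN⟩ := mem_nhds_iff.1 (show {q | pa q} ∈ 𝓝 p from hpa)
      refine ⟨N, mem_nhdsWithin_of_mem_nhds (hNo.mem_nhds hpN), N, hNo, Subset.rfl, ?_⟩
      filter_upwards [hpb] with s hs q hq
      exact hab (hNpa hq) hs
  obtain ⟨p, hp⟩ := (hΓr s₀).1
  have hp' : energyMomentum H J p = Γ s₀ := hp
  have hpr : p ∈ regularPoints H J := by
    rw [regularPoints, mem_ofPred_eq, hp']; exact hΓr s₀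
  have h1 := S.eventually_fibre_subset hpr hNo (by rw [hp']; exact hKN)
  rw [hp'] at h1
  have h2 : Tendsto Γ (𝓝 s₀) (𝓝[regularValues H J] (Γ s₀)) :=
    tendsto_nhdsWithin_iff.2 ⟨(hΓ s₀).continuousAt, Eventually.of_forall hΓr⟩
  rw [eventually_nhdsWithin_iff]
  filter_upwards [h2.eventually h1, hN] with s hs1 hs2 hne q hq
  by_contra hqM
  exact hne (hs2 q (hs1 hq) hqM hq)

end Crossings

/-- A set of reals without accumulation points is finite in each bounded interval. -/
theorem finite_inter_Ico_of_isolated {B : Set ℝ} (hB : ∀ s, ∀ᶠ r in 𝓝[≠] s, r ∉ B) (a b : ℝ) :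
    {s | s ∈ Ico a b ∧ s ∈ B}.Finite := by
  by_contra hinf
  obtain ⟨x, -, hx⟩ := Set.Infinite.exists_accPt_of_subset_isCompact hinf
    (isCompact_Icc (a := a) (b := b)) fun s hs => Ico_subset_Icc_self hs.1
  rw [accPt_iff_frequently_nhdsNE] at hx
  exact hx ((hB x).mono fun r hr h => hr h.2)

/-! ### Jumps of periodic functions and continuous lifts -/

section Variation

/-- Reduction modulo `P` is injective on a half-open window of length `P` around `s`, so `B` is
finite in that window. -/
theorem isolated_of_periodic_finite {B : Set ℝ} {P : ℝ} (hP : 0 < P)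
    (hper : Function.Periodic (fun s => s ∈ B) P) (hfin : {s | s ∈ Ico 0 P ∧ s ∈ B}.Finite) (s : ℝ) :
    ∀ᶠ r in 𝓝[≠] s, r ∉ B := by
  have h1 : (Ico (s - P / 2) (s - P / 2 + P) ∩ B).Finite := by
    refine Set.Finite.of_injOn (f := toIcoMod hP 0) (t := {s | s ∈ Ico 0 P ∧ s ∈ B}) ?_ ?_ hfin
    · rintro x ⟨-, hx⟩
      refine ⟨by simpa using toIcoMod_mem_Ico hP 0 x, ?_⟩
      have := hper.sub_zsmul_eq (toIcoDiv hP 0 x) (x := x)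
      rw [toIcoMod]
      exact this ▸ hx
    · rintro x ⟨hx, -⟩ y ⟨hy, -⟩ hxy
      obtain ⟨n, hn⟩ := (toIcoMod_eq_toIcoMod hP).1 hxy
      rw [zsmul_eq_mul] at hn
      have hlt : |(n : ℝ)| * P < 1 * P := by
        rw [← abs_of_pos hP, ← abs_mul, ← hn, abs_of_pos hP, one_mul, abs_lt]
        exact ⟨by linarith [hx.1, hx.2, hy.1, hy.2], by linarith [hx.1, hx.2, hy.1, hy.2]⟩
      have hn1 : |n| < 1 := by exact_mod_cast lt_of_mul_lt_mul_right hlt hP.le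
      have hn0 : n = 0 := Int.abs_lt_one_iff.1 hn1
      rw [hn0] at hn
      simp only [Int.cast_zero, zero_mul] at hn
      linarith
  have h2 : ((Ico (s - P / 2) (s - P / 2 + P) ∩ B) \ {s})ᶜ ∈ 𝓝 s :=
    (h1.subset sdiff_subset).isClosed.isOpen_compl.mem_nhds (by simp)
  have h3 : Ico (s - P / 2) (s - P / 2 + P) ∈ 𝓝 s := Ico_mem_nhds (by linarith) (by linarith)
  rw [eventually_nhdsWithin_iff]
  filter_upwards [h2, h3] with r hr2 hr3 hrs hrB
  exact hr2 ⟨⟨hr3, hrB⟩, hrs⟩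

/-- A function on an interval that is locally constant is constant. -/
theorem eq_of_locally_eq {h : ℝ → ℝ} {I : Set ℝ} (hI : IsPreconnected I)
    (hloc : ∀ s ∈ I, ∀ᶠ r in 𝓝[I] s, h s = h r) {x y : ℝ} (hx : x ∈ I) (hy : y ∈ I) : h x = h y :=
  hI.induction₂ (fun x y => h x = h y) hloc (fun _ _ _ _ _ _ h1 h2 => h1.trans h2)
    (fun _ _ _ _ h => h.symm) hx hy

/-- A punctured right neighbourhood that avoids `B` contains an open interval starting at `s`, and a
locally constant function is constant on it. -/
theorem exists_right_value {h : ℝ → ℝ} {B : Set ℝ} (hB : ∀ s, ∀ᶠ r in 𝓝[≠] s, r ∉ B)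
    (hloc : ∀ s ∉ B, ∀ᶠ r in 𝓝 s, h s = h r) (s : ℝ) : ∃ u, ∀ᶠ r in 𝓝[>] s, h r = u := by
  have h1 := (hB s).filter_mono (nhdsWithin_mono _ fun r (hr : s < r) => ne_of_gt hr)
  obtain ⟨b, hb, hsub⟩ := (mem_nhdsGT_iff_exists_Ioo_subset).1 h1
  have hb' : s < b := hb
  refine ⟨h ((s + b) / 2), ?_⟩
  filter_upwards [Ioo_mem_nhdsGT hb'] with r hr
  exact eq_of_locally_eq isPreconnected_Ioo
    (fun x hx => (hloc x (hsub hx)).filter_mono nhdsWithin_le_nhds) hr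
    ⟨by linarith, by linarith⟩

theorem exists_left_value {h : ℝ → ℝ} {B : Set ℝ} (hB : ∀ s, ∀ᶠ r in 𝓝[≠] s, r ∉ B)
    (hloc : ∀ s ∉ B, ∀ᶠ r in 𝓝 s, h s = h r) (s : ℝ) : ∃ u, ∀ᶠ r in 𝓝[<] s, h r = u := by
  have h1 := (hB s).filter_mono (nhdsWithin_mono _ fun r (hr : r < s) => ne_of_lt hr)
  obtain ⟨b, hb, hsub⟩ := (mem_nhdsLT_iff_exists_Ioo_subset).1 h1
  have hb' : b < s := hb
  refine ⟨h ((s + b) / 2), ?_⟩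
  filter_upwards [Ioo_mem_nhdsLT hb'] with r hr
  exact eq_of_locally_eq isPreconnected_Ioo
    (fun x hx => (hloc x (hsub hx)).filter_mono nhdsWithin_le_nhds) hr
    ⟨by linarith, by linarith⟩

/-- The jumps of a locally constant function add up to the difference of its left limits. -/
theorem sum_jumps {h u l : ℝ → ℝ} {B : Set ℝ}
    (hloc : ∀ s ∉ B, ∀ᶠ r in 𝓝 s, h s = h r) (hu : ∀ s, ∀ᶠ r in 𝓝[>] s, h r = u s)
    (hl : ∀ s, ∀ᶠ r in 𝓝[<] s, h r = l s) {a b : ℝ} (hab : a ≤ b) {F : Finset ℝ}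
    (hF : ∀ s, s ∈ F ↔ s ∈ Ico a b ∧ s ∈ B) : ∑ s ∈ F, (u s - l s) = l b - l a := by
  have hlu : ∀ s ∉ B, u s = l s := by
    intro s hs
    have h1 := hloc s hs
    obtain ⟨r, hr, hr'⟩ := ((hu s).and (h1.filter_mono nhdsWithin_le_nhds)).exists
    obtain ⟨t, ht, ht'⟩ := ((hl s).and (h1.filter_mono nhdsWithin_le_nhds)).exists
    rw [← hr, ← ht, ← hr', ← ht']
  have hl' : ∀ (x c : ℝ), (∀ᶠ r in 𝓝 x, h r = c) → l x = c := by
    intro x c hx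
    obtain ⟨r, hr, hr'⟩ := ((hl x).and (hx.filter_mono nhdsWithin_le_nhds)).exists
    rw [← hr, hr']
  -- The left limit minus the jumps already passed is locally constant on the interval. The
  -- inequality `s < x` is strict because the left limit at `x` does not yet contain the jump at
  -- `x`.
  set K : ℝ → ℝ := fun x => l x - ∑ s ∈ F, (if s < x then u s - l s else 0) with hK
  have hstep : ∀ x ∈ Icc a b, ∀ᶠ y in 𝓝[Icc a b] x, K x = K y := by
    intro x hx
    have hsep : ∀ᶠ y in 𝓝 x, ∀ s ∈ F, s ≠ x → (s < y ↔ s < x) := by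
      refine (Finset.eventually_all F).2 fun s _ => ?_
      rcases lt_trichotomy s x with hs | hs | hs
      · filter_upwards [lt_mem_nhds hs] with y hy _
        exact iff_of_true hy hs
      · exact Eventually.of_forall fun y h => absurd hs h
      · filter_upwards [gt_mem_nhds hs] with y hy _
        exact iff_of_false (not_lt.2 (le_of_lt hy)) (not_lt.2 hs.le)
    have hr : ∀ᶠ y in 𝓝[>] x, l y = u x := by
      filter_upwards [(eventually_eventually_nhdsWithin.2 (hu x)), self_mem_nhdsWithin] with y hy hxy
      refine hl' y _ ?_
      rwa [nhdsWithin_eq_nhds.2 (Ioi_mem_nhds hxy)] at hy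
    have hlft : ∀ᶠ y in 𝓝[<] x, l y = l x := by
      filter_upwards [(eventually_eventually_nhdsWithin.2 (hl x)), self_mem_nhdsWithin] with y hy hxy
      refine hl' y _ ?_
      rwa [nhdsWithin_eq_nhds.2 (Iio_mem_nhds hxy)] at hy
    rw [eventually_nhdsWithin_iff] at hr hlft
    rw [eventually_nhdsWithin_iff]
    filter_upwards [hsep, hr, hlft] with y h1 h2 h3 hy
    rcases lt_trichotomy y x with hyx | rfl | hxy
    · simp only [hK]
      rw [h3 hyx]
      congr 1
      refine Finset.sum_congr rfl fun s hs => ?_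
      by_cases hsx : s = x
      · subst hsx; simp [hyx.le]
      · simp [h1 s hs hsx]
    · rfl
    · simp only [hK]
      rw [h2 hxy]
      have h4 : ∀ s ∈ F, (if s < y then u s - l s else 0)
          = (if s < x then u s - l s else 0) + (if s = x then u s - l s else 0) := by
        intro s hs
        by_cases hsx : s = x
        · subst hsx; simp [hxy]
        · simp [h1 s hs hsx, hsx]
      rw [Finset.sum_congr rfl h4, Finset.sum_add_distrib, Finset.sum_ite_eq']
      have h5 : (if x ∈ F then u x - l x else 0) = u x - l x := by
        split_ifs with hxF
        · rfl
        · rw [hlu x fun hxB => hxF ((hF x).2 ⟨⟨hx.1, hxy.trans_le hy.2⟩, hxB⟩), sub_self]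
      rw [h5]
      ring
  have h6 := eq_of_locally_eq isPreconnected_Icc hstep (left_mem_Icc.2 hab) (right_mem_Icc.2 hab)
  simp only [hK] at h6
  have h7 : ∑ s ∈ F, (if s < a then u s - l s else 0) = 0 :=
    Finset.sum_eq_zero fun s hs => by simp [((hF s).1 hs).1.1]
  have h8 : ∑ s ∈ F, (if s < b then u s - l s else 0) = ∑ s ∈ F, (u s - l s) :=
    Finset.sum_congr rfl fun s hs => by simp [((hF s).1 hs).1.2]
  rw [h7, h8] at h6
  linarith

/-- A periodic function that differs by a locally constant function from a continuous function
with increment `c` over a period has the variation `c`. -/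
theorem hasVariation_of_lift {g L : ℝ → ℝ} {c : ℝ} (hL : Continuous L)
    (hg : Function.Periodic g (2 * Real.pi)) (hLc : ∀ s, L (s + 2 * Real.pi) = L s + c)
    {B : Set ℝ} (hB : ∀ s, ∀ᶠ r in 𝓝[≠] s, r ∉ B)
    (hloc : ∀ s ∉ B, ∀ᶠ r in 𝓝 s, g s - L s = g r - L r) : HasVariation g c := by
  choose u hu using exists_right_value (h := fun s => g s - L s) hB hloc
  choose l hl using exists_left_value (h := fun s => g s - L s) hB hloc
  have hfin := finite_inter_Ico_of_isolated hB 0 (2 * Real.pi)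
  have hcont : ∀ s ∉ B, ContinuousAt g s := by
    intro s hs
    have h1 : g =ᶠ[𝓝 s] fun r => L r + (g s - L s) := by
      filter_upwards [hloc s hs] with r hr
      linarith
    exact (hL.continuousAt.add continuousAt_const).congr h1.symm
  have hsub : discontinuities g ⊆ {s | s ∈ Ico 0 (2 * Real.pi) ∧ s ∈ B} := fun s hs =>
    ⟨hs.1, by_contra fun h => hs.2 (hcont s h)⟩
  have hright : ∀ s, Tendsto (fun ε : ℝ => s + ε) (𝓝[>] 0) (𝓝[>] s) := by
    intro s
    refine tendsto_nhdsWithin_iff.2 ⟨?_, ?_⟩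
    · exact (Continuous.tendsto' (by fun_prop) _ _ (by simp)).mono_left nhdsWithin_le_nhds
    · filter_upwards [self_mem_nhdsWithin] with ε hε
      simpa using hε
  have hleft : ∀ s, Tendsto (fun ε : ℝ => s - ε) (𝓝[>] 0) (𝓝[<] s) := by
    intro s
    refine tendsto_nhdsWithin_iff.2 ⟨?_, ?_⟩
    · exact (Continuous.tendsto' (by fun_prop) _ _ (by simp)).mono_left nhdsWithin_le_nhds
    · filter_upwards [self_mem_nhdsWithin] with ε hε
      simpa using hε
  have hjump : ∀ s, Tendsto (fun ε : ℝ => g (s + ε) - g (s - ε)) (𝓝[>] 0) (𝓝 (u s - l s)) := by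
    intro s
    have h1 : Tendsto (fun ε : ℝ => L (s + ε) - L (s - ε) + (u s - l s)) (𝓝[>] 0)
        (𝓝 (u s - l s)) :=
      (Continuous.tendsto' (by fun_prop) _ _ (by simp)).mono_left nhdsWithin_le_nhds
    refine h1.congr' ?_
    filter_upwards [(hright s).eventually (hu s), (hleft s).eventually (hl s)] with ε h2 h3
    linarith
  -- Over a period `g` returns to its value while `L` gains `c`, so the left limit of `g - L` drops
  -- by `c`.
  have hlper : l (2 * Real.pi) = l 0 - c := by
    have h1 : Tendsto (fun r : ℝ => r + 2 * Real.pi) (𝓝[<] 0) (𝓝[<] (2 * Real.pi)) := by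
      refine tendsto_nhdsWithin_iff.2 ⟨?_, ?_⟩
      · exact (Continuous.tendsto' (by fun_prop) _ _ (by simp)).mono_left nhdsWithin_le_nhds
      · filter_upwards [self_mem_nhdsWithin] with r hr
        simpa using hr
    obtain ⟨r, h2, h3⟩ := ((h1.eventually (hl (2 * Real.pi))).and (hl 0)).exists
    rw [hg r, hLc r] at h2
    linarith
  have hsum := sum_jumps hloc hu hl Real.two_pi_pos.le (F := hfin.toFinset) (by simp)
  refine ⟨hfin.subset hsub, fun s => u s - l s, fun s _ => hjump s, ?_⟩
  -- The set `B` may contain points where `g` is continuous; their jumps are zero.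
  have hsame : ∑ s ∈ (hfin.subset hsub).toFinset, (u s - l s) = ∑ s ∈ hfin.toFinset, (u s - l s) := by
    refine Finset.sum_subset (by simpa using hsub) fun s hs hs' => ?_
    have hs1 : s ∈ Ico 0 (2 * Real.pi) := by
      have : s ∈ {s | s ∈ Ico 0 (2 * Real.pi) ∧ s ∈ B} := by simpa using hs
      exact this.1
    have hc : ContinuousAt g s := by
      by_contra hn
      exact hs' ((Set.Finite.mem_toFinset _).2 ⟨hs1, hn⟩)
    have h1 : Tendsto (fun ε : ℝ => g (s + ε) - g (s - ε)) (𝓝[>] 0) (𝓝 (g s - g s)) :=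
      (hc.tendsto.comp ((hright s).mono_right nhdsWithin_le_nhds)).sub
        (hc.tendsto.comp ((hleft s).mono_right nhdsWithin_le_nhds))
    rw [sub_self] at h1
    exact tendsto_nhds_unique (hjump s) h1
  rw [hsame, hsum, hlper]
  ring

/-- A function with values in `Pℤ` is locally constant where it is continuous. -/
theorem eventually_eq_of_continuousAt_zmul {f : ℝ → ℝ} {P : ℝ} (hP : 0 < P)
    (hf : ∀ s, ∃ k : ℤ, f s = k * P) {s : ℝ} (hs : ContinuousAt f s) :
    ∀ᶠ r in 𝓝 s, f s = f r := by
  have h1 := hs (Metric.ball_mem_nhds (f s) hP)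
  filter_upwards [h1] with r hr
  obtain ⟨k, hk⟩ := hf s
  obtain ⟨m, hm⟩ := hf r
  have hr' : |f r - f s| < P := hr
  rw [hk, hm, ← sub_mul, abs_mul, abs_of_pos hP] at hr'
  have h2 : |((m : ℝ) - k)| < 1 := by
    by_contra! hle
    nlinarith
  have h3 : |m - k| < 1 := by exact_mod_cast h2
  have h4 : m - k = 0 := Int.abs_lt_one_iff.1 h3
  rw [hk, hm, sub_eq_zero.1 h4]

theorem exists_int_of_circleExp_eq {x y : ℝ} (h : Circle.exp x = Circle.exp y) :
    ∃ k : ℤ, x - y = k * (2 * Real.pi) := by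
  obtain ⟨m, hm⟩ := Circle.exp_eq_exp.1 h
  exact ⟨m, by rw [hm]; ring⟩

/-- A function with continuous exponential has a continuous lift. -/
theorem exists_continuous_lift {f : ℝ → ℝ} (hf : Continuous fun s => Circle.exp (f s))
    (hper : Function.Periodic f (2 * Real.pi)) :
    ∃ (L : ℝ → ℝ) (c : ℝ), Continuous L ∧ (∀ s, Circle.exp (L s) = Circle.exp (f s)) ∧
      ∀ s, L (s + 2 * Real.pi) = L s + c := by
  obtain ⟨L, ⟨-, hL⟩, -⟩ := Circle.isCoveringMap_exp.existsUnique_continuousMap_lifts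
    (⟨_, hf⟩ : C(ℝ, Circle)) 0 (f 0) rfl
  have hL' : ∀ s, Circle.exp (L s) = Circle.exp (f s) := fun s => congrFun hL s
  refine ⟨L, L (0 + 2 * Real.pi) - L 0, L.continuous, hL', fun s => ?_⟩
  have hc : Continuous fun s => L (s + 2 * Real.pi) - L s := by fun_prop
  -- The increment of the lift over a period is continuous with values in the multiples of `2π`,
  -- hence constant.
  have h1 := eq_of_locally_eq isPreconnected_univ (h := fun s => L (s + 2 * Real.pi) - L s)
    (fun s _ => by
      rw [nhdsWithin_univ]
      exact eventually_eq_of_continuousAt_zmul Real.two_pi_pos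
        (fun s => exists_int_of_circleExp_eq (by rw [hL', hL', hper])) hc.continuousAt)
    (mem_univ s) (mem_univ 0)
  linarith

end Variation

/-! ### The variations of `Φ` and `Θ` along a closed path -/

section Path

variable {M : Type*} [TopologicalSpace M] [ChartedSpace E4 M]

omit [TopologicalSpace M] [ChartedSpace E4 M] in
theorem onValues_eq {H J f : M → ℝ} {p : M}
    (h : ∀ q, energyMomentum H J q = energyMomentum H J p → f q = f p) :
    onValues H J f (energyMomentum H J p) = f p := by
  have hne : (fibre H J (energyMomentum H J p)).Nonempty := ⟨p, rfl⟩
  rw [onValues, dif_pos hne]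
  exact h _ hne.some_mem

variable [MulAction Circle M]
  {Ω : SymplecticForm M} {H J : M → ℝ} {M' : Set M}
  {θ : ∀ p : M, TangentSpace (𝓡 4) p →L[ℝ] ℝ} [IsManifold (𝓡 4) ∞ M] [T2Space M]

namespace IsRegularSystem

variable (S : IsRegularSystem Ω H J)
include S

theorem onValues_firstReturn {p : M} (hp : p ∈ regularPoints H J) :
    onValues H J (firstReturn Ω H) (energyMomentum H J p) = firstReturn Ω H p :=
  onValues_eq fun q hq => by
    obtain ⟨a, rfl⟩ := S.exists_torusFlow_eq hp hq
    exact S.firstReturn_torusFlow hp a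

theorem onValues_rotationNumber {p : M} (hp : p ∈ regularPoints H J) :
    onValues H J (rotationNumber Ω H) (energyMomentum H J p) = rotationNumber Ω H p :=
  onValues_eq fun q hq => by
    obtain ⟨a, rfl⟩ := S.exists_torusFlow_eq hp hq
    exact S.rotationNumber_torusFlow hp a

theorem onValues_orbitIntegral (hθ : IsRotationForm Ω J M' θ) {p : M}
    (hp : p ∈ goodPoints H J M') :
    onValues H J (orbitIntegral Ω H θ) (energyMomentum H J p) = orbitIntegral Ω H θ p :=
  onValues_eq fun _ hq => S.orbitIntegral_eq_of_mem_fibre hθ hp hq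

/-- The rotation number may jump between `0` and `2π`, but its exponential is continuous at regular
points; openness of the energy-momentum map transfers this from points to values. -/
theorem continuous_circleExp_rotationNumber {Γ : ℝ → ℝ × ℝ} (hΓ : Continuous Γ)
    (hΓr : ∀ s, Γ s ∈ regularValues H J) :
    Continuous fun s => Circle.exp (onValues H J (rotationNumber Ω H) (Γ s)) := by
  rw [continuous_iff_continuousAt]
  intro s₀
  obtain ⟨p, hp⟩ := (hΓr s₀).1
  have hp' : energyMomentum H J p = Γ s₀ := hp
  have hpr : p ∈ regularPoints H J := by
    rw [regularPoints, mem_ofPred_eq, hp']; exact hΓr s₀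
  have hΓt : Tendsto Γ (𝓝 s₀) (𝓝[regularValues H J] (energyMomentum H J p)) := by
    rw [hp']
    exact tendsto_nhdsWithin_iff.2 ⟨hΓ.continuousAt, Eventually.of_forall hΓr⟩
  rw [ContinuousAt, ← hp', S.onValues_rotationNumber hpr, tendsto_def]
  intro O hO
  have h1 := S.eventually_exists_near hpr ((S.tendsto_circleExp_rotationNumber hpr).eventually hO)
  filter_upwards [hΓt.eventually h1] with s hs
  obtain ⟨q, hq, hqO⟩ := hs
  have hqr : q ∈ regularPoints H J := by
    rw [regularPoints, mem_ofPred_eq, hq]; exact hΓr s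
  rw [mem_preimage, ← hq, S.onValues_rotationNumber hqr]
  exact hqO

/-- The continuous lift `L` stays near `L s₀`, so it is an admissible choice of the angle in
`exists_orbitIntegral_sub_eq`. -/
theorem eventually_onValues_orbitIntegral_sub (hθ : IsRotationForm Ω J M' θ) {Γ : ℝ → ℝ × ℝ}
    (hΓ : Continuous Γ) (hΓr : ∀ s, Γ s ∈ regularValues H J) {L : ℝ → ℝ} (hL : Continuous L)
    (hLΘ : ∀ s, Circle.exp (L s) = Circle.exp (onValues H J (rotationNumber Ω H) (Γ s))) {s₀ : ℝ}
    (hs₀ : fibre H J (Γ s₀) ⊆ M') :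
    ∀ᶠ s in 𝓝 s₀, onValues H J (orbitIntegral Ω H θ) (Γ s₀) - L s₀
      = onValues H J (orbitIntegral Ω H θ) (Γ s) - L s := by
  obtain ⟨p, hp⟩ := (hΓr s₀).1
  have hp' : energyMomentum H J p = Γ s₀ := hp
  have hpr : p ∈ regularPoints H J := by
    rw [regularPoints, mem_ofPred_eq, hp']; exact hΓr s₀
  have hpg : p ∈ goodPoints H J M' := ⟨hpr, by rw [hp']; exact hs₀⟩
  have hΓt : Tendsto Γ (𝓝 s₀) (𝓝[regularValues H J] (energyMomentum H J p)) := by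
    rw [hp']
    exact tendsto_nhdsWithin_iff.2 ⟨hΓ.continuousAt, Eventually.of_forall hΓr⟩
  obtain ⟨ε, hε, h⟩ := S.exists_orbitIntegral_sub_eq hθ hpg (τ₀ := L s₀) (by
    rw [hLΘ, ← hp', S.onValues_rotationNumber hpr])
  have h1 := S.eventually_exists_near hpr (h.and (S.goodPoints_mem_nhdsWithin hθ hpg))
  filter_upwards [hΓt.eventually h1, hL.continuousAt (Metric.ball_mem_nhds (L s₀) hε)] with s hs hLs
  obtain ⟨q, hq, hq1, hqg⟩ := hs
  have hLs' : |L s - L s₀| < ε := hLs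
  have h2 := hq1 (L s) hLs' (by rw [hLΘ, ← hq, S.onValues_rotationNumber hqg.1])
  rw [← hp', ← hq, S.onValues_orbitIntegral hθ hpg, S.onValues_orbitIntegral hθ hqg]
  exact h2.symm

/-- Variations of the integral of the rotation form and of the rotation number along a closed
path that is transversal to the image of the poles. -/
theorem variation_along_path (hθ : IsRotationForm Ω J M' θ)
    (hsurf : ∀ p ∈ M'ᶜ, (∃ z : Circle, z • p ≠ p) → IsSmoothSurfaceAt M'ᶜ p) {Γ : ℝ → ℝ × ℝ}
    (hΓ : Differentiable ℝ Γ) (hper : Function.Periodic Γ (2 * Real.pi))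
    (hΓr : ∀ s, Γ s ∈ regularValues H J) (htr : IsTransversalToImage H J M'ᶜ Γ) :
    {s | s ∈ Ico 0 (2 * Real.pi) ∧ ¬ fibre H J (Γ s) ⊆ M'}.Finite ∧
      (∀ s, fibre H J (Γ s) ⊆ M' →
        ContinuousAt (fun r => onValues H J (orbitIntegral Ω H θ) (Γ r)) s) ∧
      ∃ c : ℝ, HasVariation (fun s => onValues H J (orbitIntegral Ω H θ) (Γ s)) c ∧
        ((discontinuities fun s => onValues H J (rotationNumber Ω H) (Γ s)).Finite →
          HasVariation (fun s => onValues H J (rotationNumber Ω H) (Γ s)) c) := by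
  set B : Set ℝ := {s | ¬ fibre H J (Γ s) ⊆ M'} with hBdef
  have hB : ∀ s, ∀ᶠ r in 𝓝[≠] s, r ∉ B := fun s =>
    (S.eventually_fibre_subset_of_transversal hθ hsurf hΓ hΓr htr s).mono fun r hr h => h hr
  have hperf : ∀ f : M → ℝ, Function.Periodic (fun s => onValues H J f (Γ s)) (2 * Real.pi) :=
    fun f s => by simp only [hper s]
  obtain ⟨L, c, hL, hLΘ, hLc⟩ := exists_continuous_lift
    (S.continuous_circleExp_rotationNumber hΓ.continuous hΓr) (hperf _)
  have hloc : ∀ s, fibre H J (Γ s) ⊆ M' → ∀ᶠ r in 𝓝 s,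
      onValues H J (orbitIntegral Ω H θ) (Γ s) - L s
        = onValues H J (orbitIntegral Ω H θ) (Γ r) - L r := fun s hs =>
    S.eventually_onValues_orbitIntegral_sub hθ hΓ.continuous hΓr hL hLΘ hs
  refine ⟨finite_inter_Ico_of_isolated hB _ _, fun s hs => ?_, c, ?_, fun hfin => ?_⟩
  · have h1 : (fun r => onValues H J (orbitIntegral Ω H θ) (Γ r)) =ᶠ[𝓝 s]
        fun r => L r + (onValues H J (orbitIntegral Ω H θ) (Γ s) - L s) := by
      filter_upwards [hloc s hs] with r hr
      linarith
    exact (hL.continuousAt.add continuousAt_const).congr h1.symm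
  · exact hasVariation_of_lift hL (hperf _) hLc hB fun s hs => hloc s (not_not.1 hs)
  -- For the rotation number the exceptional set consists of its own discontinuities: elsewhere its
  -- difference from `L` is continuous with values in the multiples of `2π`.
  · set g : ℝ → ℝ := fun s => onValues H J (rotationNumber Ω H) (Γ s) with hg
    have hgper : Function.Periodic g (2 * Real.pi) := hperf _
    have hBper : Function.Periodic (fun s => s ∈ {s | ¬ ContinuousAt g s}) (2 * Real.pi) := by
      intro s
      have h1 : ContinuousAt g (s + 2 * Real.pi) ↔ ContinuousAt g s := by
        have h2 : g ∘ (Homeomorph.addRight (2 * Real.pi)) = g := by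
          funext x
          exact hgper x
        have h3 := (Homeomorph.addRight (2 * Real.pi)).comp_continuousAt_iff' g s
        rw [h2] at h3
        exact h3.symm
      simp only [mem_ofPred_eq, h1]
    refine hasVariation_of_lift hL hgper hLc
      (isolated_of_periodic_finite Real.two_pi_pos hBper hfin) fun s hs => ?_
    have hs' : ContinuousAt g s := not_not.1 hs
    refine eventually_eq_of_continuousAt_zmul (f := fun r => g r - L r) Real.two_pi_pos
      (fun r => exists_int_of_circleExp_eq (hLΘ r).symm) (hs'.sub hL.continuousAt)

end IsRegularSystem

end Path

/-! ### The period lattice and the covering of a regular fibre by the plane -/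

section Covering

variable {M : Type*} [TopologicalSpace M] [ChartedSpace E4 M] [MulAction Circle M]
  {Ω : SymplecticForm M} {H J : M → ℝ} [IsManifold (𝓡 4) ∞ M] [T2Space M]

namespace IsRegularSystem

variable (S : IsRegularSystem Ω H J)

/-- The periods of the joint flow. -/
def periods {p : M} (hp : p ∈ regularPoints H J) : AddSubgroup (ℝ × ℝ) where
  carrier := {a | torusFlow Ω H a p = p}
  zero_mem' := S.torusFlow_zero hp
  add_mem' := by
    intro a b ha hb
    change torusFlow Ω H (a + b) p = p
    rw [← S.torusFlow_add hp, show torusFlow Ω H b p = p from hb]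
    exact ha
  neg_mem' := by
    intro a ha
    have h := S.torusFlow_neg_add hp a
    rwa [show torusFlow Ω H a p = p from ha] at h

include S

theorem mem_periods {p : M} (hp : p ∈ regularPoints H J) {a : ℝ × ℝ} :
    a ∈ S.periods hp ↔ torusFlow Ω H a p = p := Iff.rfl

theorem torusFlow_eq_iff {p : M} (hp : p ∈ regularPoints H J) {a b : ℝ × ℝ} :
    torusFlow Ω H a p = torusFlow Ω H b p ↔ a - b ∈ S.periods hp := by
  rw [S.mem_periods hp]
  constructor
  · intro h
    rw [sub_eq_neg_add, ← S.torusFlow_add hp, h, S.torusFlow_neg_add hp]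
  · intro h
    calc torusFlow Ω H a p = torusFlow Ω H (b + (a - b)) p := by rw [add_sub_cancel]
      _ = torusFlow Ω H b p := by rw [← S.torusFlow_add hp, h]

theorem torusFlow_add_of_mem_periods {p : M} (hp : p ∈ regularPoints H J) {n : ℝ × ℝ}
    (hn : n ∈ S.periods hp) (a : ℝ × ℝ) : torusFlow Ω H (a + n) p = torusFlow Ω H a p :=
  (S.torusFlow_eq_iff hp).2 (by simpa using hn)

theorem exists_periods_discrete {p : M} (hp : p ∈ regularPoints H J) :
    ∃ r > 0, ∀ n ∈ S.periods hp, ‖n‖ < r → n = 0 := by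
  obtain ⟨r, hr, V, hV, h⟩ := S.exists_small_torusFlow_free hp
  exact ⟨r, hr, fun n hn hnr => h p ⟨mem_of_mem_nhds hV, hp⟩ n hnr hn⟩

theorem circle_period_mem {p : M} (hp : p ∈ regularPoints H J) :
    ((0, 2 * Real.pi) : ℝ × ℝ) ∈ S.periods hp := by
  rw [S.mem_periods hp]
  simp [torusFlow, S.flowH_zero hp]

theorem return_period_mem {p : M} (hp : p ∈ regularPoints H J) :
    ((firstReturn Ω H p, -rotationNumber Ω H p) : ℝ × ℝ) ∈ S.periods hp := by
  rw [S.mem_periods hp, torusFlow, S.flowH_firstReturn hp, smul_smul, ← Circle.exp_add]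
  simp

/-- The periods form the lattice generated by the circle period and the return period. -/
theorem exists_eq_of_mem_periods {p : M} (hp : p ∈ regularPoints H J) {a : ℝ × ℝ}
    (ha : a ∈ S.periods hp) : ∃ m n : ℤ, a = m • ((0, 2 * Real.pi) : ℝ × ℝ)
      + n • ((firstReturn Ω H p, -rotationNumber Ω H p) : ℝ × ℝ) := by
  set T := firstReturn Ω H p with hT
  have hT0 : 0 < T := S.firstReturn_pos hp
  -- Subtracting this multiple of the return period puts the first component in `[0, T)`. A positive
  -- value there would be a return before `T`; once it vanishes, freeness makes the second component
  -- a multiple of `2π`.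
  set n : ℤ := ⌊a.1 / T⌋
  set b : ℝ × ℝ := a - n • ((T, -rotationNumber Ω H p) : ℝ × ℝ) with hb
  have hbp : b ∈ S.periods hp :=
    sub_mem ha ((S.periods hp).zsmul_mem (S.return_period_mem hp) n)
  have hb1 : b.1 = a.1 - n * T := by simp [hb]
  have h1 : (n : ℝ) * T ≤ a.1 := by rw [← le_div_iff₀ hT0]; exact Int.floor_le _
  have h2 : a.1 < (n + 1 : ℝ) * T := by rw [← div_lt_iff₀ hT0]; exact Int.lt_floor_add_one _
  have hflow : flowH Ω H p b.1 = Circle.exp (-b.2) • p := by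
    have h3 : Circle.exp b.2 • flowH Ω H p b.1 = p := hbp
    rw [Circle.exp_neg, eq_inv_smul_iff, h3]
  have hb0 : b.1 = 0 := by
    by_contra hne
    have hpos : 0 < b.1 := lt_of_le_of_ne (by rw [hb1]; linarith) (Ne.symm hne)
    have h4 := (S.isLeast_firstReturn hp).2 (show b.1 ∈ returnTimes Ω H p from ⟨hpos, _, hflow⟩)
    rw [hb1] at h4
    linarith
  have h5 : Circle.exp b.2 = 1 := by
    rw [hb0, S.flowH_zero hp] at hflow
    have h6 := S.free _ hp p rfl _ hflow.symm
    rwa [Circle.exp_neg, inv_eq_one] at h6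
  obtain ⟨m, hm⟩ := exists_int_of_circleExp_eq (x := b.2) (y := 0) (by rw [h5, Circle.exp_zero])
  refine ⟨m, n, ?_⟩
  rw [← sub_eq_iff_eq_add, ← hb]
  refine Prod.ext ?_ ?_
  · simp [hb0]
  · simpa using hm

theorem torusFlow_mem_fibre {p : M} (hp : p ∈ regularPoints H J) (a : ℝ × ℝ) :
    torusFlow Ω H a p ∈ fibre H J (energyMomentum H J p) :=
  S.energyMomentum_torusFlow hp a

/-- The joint flow covers a regular fibre by the plane. -/
theorem isAddQuotientCoveringMap_torusFlow {p : M} (hp : p ∈ regularPoints H J) :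
    IsAddQuotientCoveringMap (fun a : ℝ × ℝ =>
      (⟨torusFlow Ω H a p, S.torusFlow_mem_fibre hp a⟩ : fibre H J (energyMomentum H J p)))
      (S.periods hp) := by
  have hcont : Continuous (fun a : ℝ × ℝ =>
      (⟨torusFlow Ω H a p, S.torusFlow_mem_fibre hp a⟩ :
        fibre H J (energyMomentum H J p))) :=
    (S.contMDiff_torusFlow hp).continuous.subtype_mk _
  have hsurj : Function.Surjective (fun a : ℝ × ℝ =>
      (⟨torusFlow Ω H a p, S.torusFlow_mem_fibre hp a⟩ :
        fibre H J (energyMomentum H J p))) := by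
    rintro ⟨q, hq⟩
    obtain ⟨a, rfl⟩ := S.exists_torusFlow_eq hp hq
    exact ⟨a, rfl⟩
  have hopen : IsOpenMap (fun a : ℝ × ℝ =>
      (⟨torusFlow Ω H a p, S.torusFlow_mem_fibre hp a⟩ :
        fibre H J (energyMomentum H J p))) := by
    rw [isOpenMap_iff_nhds_le]
    intro a N hN
    rw [Filter.mem_map] at hN
    obtain ⟨ε, hε, hball⟩ := Metric.mem_nhds_iff.1 hN
    obtain ⟨V, hV, h⟩ := S.exists_small_torusFlow_eq (S.torusFlow_mem hp a) (half_pos hε)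
    have hV' : Subtype.val ⁻¹' V ∈ 𝓝 (⟨torusFlow Ω H a p, S.torusFlow_mem_fibre hp a⟩ :
        fibre H J (energyMomentum H J p)) := continuous_subtype_val.continuousAt hV
    filter_upwards [hV']
    rintro ⟨q, hq⟩ hqV
    obtain ⟨b, hb, hbq⟩ := h _ ⟨mem_of_mem_nhds hV, S.torusFlow_mem hp a⟩ q hqV
      ((S.energyMomentum_torusFlow hp a).trans (Eq.symm hq))
    rw [S.torusFlow_add hp] at hbq
    subst hbq
    refine hball (show b + a ∈ Metric.ball a ε from ?_)
    rw [Metric.mem_ball, dist_eq_norm, add_sub_cancel_right]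
    linarith
  obtain ⟨r, hr, hdisc⟩ := S.exists_periods_discrete hp
  refine { hopen.isQuotientMap hcont hsurj with
    continuous_const_vadd := fun g => ?_
    apply_eq_iff_mem_orbit := ?_
    disjoint := fun e => ⟨Metric.ball e (r / 2), Metric.ball_mem_nhds e (half_pos hr), ?_⟩ }
  · exact continuous_const.add continuous_id
  · intro a b
    refine Subtype.ext_iff.trans ((S.torusFlow_eq_iff hp).trans ?_)
    constructor
    · intro h
      exact ⟨⟨a - b, h⟩, sub_add_cancel a b⟩
    · rintro ⟨⟨n, hn⟩, rfl⟩
      change n + b - b ∈ _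
      rwa [add_sub_cancel_right]
  · rintro ⟨n, hn⟩ ⟨x, ⟨y, hy, rfl⟩, hx⟩
    have hx' : n + y ∈ Metric.ball e (r / 2) := hx
    refine Subtype.ext (hdisc n hn ?_)
    have h1 : dist (n + y) y < r := by
      have := dist_triangle_right (n + y) y e
      have h2 := Metric.mem_ball.1 hx'
      have h3 := Metric.mem_ball.1 hy
      linarith
    rwa [dist_eq_norm, add_sub_cancel_right] at h1

/-- Maps of vector spaces to a regular fibre lift to the plane. -/
theorem exists_torusFlow_lift {p : M} (hp : p ∈ regularPoints H J) {E : Type*}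
    [NormedAddCommGroup E] [NormedSpace ℝ E] {f : E → M} (hf : Continuous f)
    (hfp : ∀ x, f x ∈ fibre H J (energyMomentum H J p)) :
    ∃ c : E → ℝ × ℝ, Continuous c ∧ ∀ x, torusFlow Ω H (c x) p = f x := by
  obtain ⟨a, ha⟩ := S.exists_torusFlow_eq hp (hfp 0)
  obtain ⟨c, ⟨-, hc⟩, -⟩ :=
    (S.isAddQuotientCoveringMap_torusFlow hp).isCoveringMap.existsUnique_continuousMap_lifts
      (⟨fun x => ⟨f x, hfp x⟩, hf.subtype_mk _⟩ : C(E, fibre H J (energyMomentum H J p)))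
      0 a (Subtype.ext ha)
  exact ⟨c, c.continuous, fun x => congrArg Subtype.val (congrFun hc x)⟩

/-- The displacement of a lift does not depend on the lift. -/
theorem sub_eq_sub_of_torusFlow_eq {p : M} (hp : p ∈ regularPoints H J) {c c' : ℝ → ℝ × ℝ}
    (hc : ContinuousOn c (Icc 0 1)) (hc' : ContinuousOn c' (Icc 0 1))
    (h : ∀ t ∈ Icc (0 : ℝ) 1, torusFlow Ω H (c t) p = torusFlow Ω H (c' t) p) :
    c 1 - c 0 = c' 1 - c' 0 := by
  obtain ⟨r, hr, hdisc⟩ := S.exists_periods_discrete hp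
  have key : c 1 - c' 1 = c 0 - c' 0 := by
    -- Two lifts of one path differ by a continuous function with values in the discrete group of
    -- periods.
    refine isPreconnected_Icc.induction₂ (fun s t => c s - c' s = c t - c' t) (fun s hs => ?_)
      (fun _ _ _ _ _ _ h1 h2 => h1.trans h2) (fun _ _ _ _ h => h.symm)
      (right_mem_Icc.2 (zero_le_one' ℝ)) (left_mem_Icc.2 (zero_le_one' ℝ))
    filter_upwards [(hc.sub hc') s hs (Metric.ball_mem_nhds _ hr), self_mem_nhdsWithin]
      with t ht htI
    have ht' : dist (c t - c' t) (c s - c' s) < r := ht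
    rw [dist_eq_norm] at ht'
    have h1 := hdisc _ (sub_mem ((S.torusFlow_eq_iff hp).1 (h t htI))
      ((S.torusFlow_eq_iff hp).1 (h s hs))) ht'
    exact (sub_eq_zero.1 h1).symm
  linear_combination (exp := 1) key

/-- Continuous lifts of smooth maps are smooth. -/
theorem contDiffWithinAt_lift {p : M} (hp : p ∈ regularPoints H J) {E : Type*}
    [NormedAddCommGroup E] [NormedSpace ℝ E] {f : E → M} {c : E → ℝ × ℝ} {s : Set E} {x : E}
    (hx : x ∈ s) (hf : ContMDiffWithinAt 𝓘(ℝ, E) (𝓡 4) ∞ f s x) (hc : ContinuousWithinAt c s x)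
    (hcf : ∀ y ∈ s, torusFlow Ω H (c y) p = f y) : ContDiffWithinAt ℝ ∞ c s x := by
  set q := torusFlow Ω H (c x) p with hq
  have hqr : q ∈ regularPoints H J := S.torusFlow_mem hp _
  obtain ⟨ρ, hρ, hρ', -⟩ := S.exists_flow_coordinates hqr
  -- Near `c x` the map `Ψ` has a smooth inverse, since its differential at `c x` is the identity.
  -- The lift is this inverse applied to the smooth map `ρ ∘ f`.
  set Ψ : ℝ × ℝ → ℝ × ℝ := fun a => ρ (torusFlow Ω H a p) with hΨ
  have hΨs : ContDiffAt ℝ ∞ Ψ (c x) :=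
    (ContMDiffAt.comp (c x) hρ (S.contMDiff_torusFlow hp (c x))).contDiffAt
  have hΨd : HasFDerivAt Ψ (ContinuousLinearEquiv.refl ℝ (ℝ × ℝ) : ℝ × ℝ →L[ℝ] ℝ × ℝ) (c x) := by
    have h1 : HasFDerivAt (fun a : ℝ × ℝ => a - c x) (ContinuousLinearMap.id ℝ (ℝ × ℝ)) (c x) :=
      (hasFDerivAt_id _).sub_const _
    have h2 := HasFDerivAt.comp (c x) (f := fun a : ℝ × ℝ => a - c x)
      (g := fun a => ρ (torusFlow Ω H a q)) (by rw [sub_self]; exact hρ') h1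
    refine h2.congr_of_eventuallyEq (Eventually.of_forall fun a => ?_)
    simp only [hΨ, hq, Function.comp_apply]
    rw [S.torusFlow_add hp, sub_add_cancel]
  set e := hΨs.toOpenPartialHomeomorph Ψ hΨd (by simp) with he
  have hinv : ContDiffAt ℝ ∞ (hΨs.localInverse hΨd (by simp)) (Ψ (c x)) :=
    hΨs.to_localInverse hΨd (by simp)
  have hfx : f x = q := (hcf x hx).symm
  have hρf : ContDiffWithinAt ℝ ∞ (fun y => ρ (f y)) s x := by
    have h3 : ContMDiffAt (𝓡 4) 𝓘(ℝ, ℝ × ℝ) ∞ ρ (f x) := by rw [hfx]; exact hρ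
    exact (h3.comp_contMDiffWithinAt x hf).contDiffWithinAt
  have hcomp : ContDiffWithinAt ℝ ∞ (fun y => hΨs.localInverse hΨd (by simp) (ρ (f y))) s x := by
    refine ContDiffAt.comp_contDiffWithinAt x (f := fun y => ρ (f y)) ?_ hρf
    have h4 : ρ (f x) = Ψ (c x) := by rw [hfx]
    rw [h4]
    exact hinv
  have hsrc : ∀ᶠ y in 𝓝[s] x, c y ∈ e.source :=
    hc (e.open_source.mem_nhds (hΨs.mem_toOpenPartialHomeomorph_source hΨd (by simp)))
  refine hcomp.congr_of_eventuallyEq_of_mem ?_ hx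
  filter_upwards [hsrc, self_mem_nhdsWithin] with y hy hys
  have h5 : e.symm (e (c y)) = c y := e.left_inv hy
  have h6 : e (c y) = ρ (f y) := by
    rw [← hcf y hys]
    rfl
  rw [h6] at h5
  exact h5.symm

end IsRegularSystem

end Covering

/-! ### Homology of a regular fibre, computed from lifts -/

section Chains

variable {M : Type*} [TopologicalSpace M] [ChartedSpace E4 M]

theorem SmoothPath.eq_of_toFun_eq {K : Set M} {γ γ' : SmoothPath K} (h : γ.toFun = γ'.toFun) :
    γ = γ' := by
  cases γ
  cases γ'
  cases h
  rfl

omit [TopologicalSpace M] [ChartedSpace E4 M] in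
theorem extendPath_coe (γ : unitInterval → M) (t : unitInterval) : extendPath γ t = γ t := by
  simp [extendPath]

omit [TopologicalSpace M] [ChartedSpace E4 M] in
theorem extendPath_of_mem (γ : unitInterval → M) {t : ℝ} (ht : t ∈ Icc (0 : ℝ) 1) :
    extendPath γ t = γ ⟨t, ht⟩ := extendPath_coe γ ⟨t, ht⟩

omit [TopologicalSpace M] [ChartedSpace E4 M] in
theorem extendSquare_of_mem (σ : unitInterval × unitInterval → M) {z : ℝ × ℝ}
    (hz : z ∈ Icc (0 : ℝ) 1 ×ˢ Icc (0 : ℝ) 1) :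
    extendSquare σ z = σ (⟨z.1, hz.1⟩, ⟨z.2, hz.2⟩) := by
  simp [extendSquare, projIcc_of_mem zero_le_one hz.1, projIcc_of_mem zero_le_one hz.2]

theorem SmoothPath.continuous_extendPath {K : Set M} (γ : SmoothPath K) :
    Continuous (extendPath γ.toFun) := by
  have h : Continuous γ.toFun := by
    have h1 := γ.smooth.continuousOn.comp_continuous (f := fun t : unitInterval => (t : ℝ))
      continuous_subtype_val fun t => t.2
    exact h1.congr fun t => extendPath_coe γ.toFun t
  exact h.comp continuous_projIcc

theorem SmoothSquare.continuous_extendSquare {K : Set M} (σ : SmoothSquare K) :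
    Continuous (extendSquare σ.toFun) := by
  have h : Continuous σ.toFun := by
    have h1 := σ.smooth.continuousOn.comp_continuous
      (f := fun t : unitInterval × unitInterval => ((t.1 : ℝ), (t.2 : ℝ)))
      (by fun_prop) fun t => ⟨t.1.2, t.2.2⟩
    exact h1.congr fun t => extendSquare_of_mem σ.toFun (z := (t.1, t.2)) ⟨t.1.2, t.2.2⟩
  exact h.comp (f := fun z : ℝ × ℝ =>
    (projIcc (0 : ℝ) 1 zero_le_one z.1, projIcc (0 : ℝ) 1 zero_le_one z.2))
    ((continuous_projIcc.comp continuous_fst).prodMk (continuous_projIcc.comp continuous_snd))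

variable [MulAction Circle M] {Ω : SymplecticForm M} {H J : M → ℝ} [IsManifold (𝓡 4) ∞ M]
  [T2Space M]

variable (Ω) in
/-- The smooth path `c` in the plane lifts the path `γ` in the fibre of `p`. -/
def IsLift {p : M} (c : ℝ → ℝ × ℝ) (γ : SmoothPath (fibre H J (energyMomentum H J p))) : Prop :=
  ContDiffOn ℝ ∞ c (Icc 0 1) ∧ ∀ t : unitInterval, torusFlow Ω H (c t) p = γ.toFun t

namespace IsRegularSystem

variable (S : IsRegularSystem Ω H J) {p : M} (hp : p ∈ regularPoints H J)

/-- The path in a regular fibre covered by a smooth path in the plane. -/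
noncomputable def pathOfLift (c : ℝ → ℝ × ℝ) (hc : ContDiffOn ℝ ∞ c (Icc 0 1)) :
    SmoothPath (fibre H J (energyMomentum H J p)) where
  toFun t := torusFlow Ω H (c t) p
  smooth := by
    refine ((S.contMDiff_torusFlow hp).comp_contMDiffOn hc.contMDiffOn).congr fun t ht => ?_
    exact extendPath_of_mem _ ht
  mem t := S.torusFlow_mem_fibre hp _

/-- The square in a regular fibre covered by a smooth square in the plane. -/
noncomputable def squareOfLift (c : ℝ × ℝ → ℝ × ℝ) (hc : ContDiffOn ℝ ∞ c (Icc 0 1 ×ˢ Icc 0 1)) :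
    SmoothSquare (fibre H J (energyMomentum H J p)) where
  toFun z := torusFlow Ω H (c (z.1, z.2)) p
  smooth := by
    refine ((S.contMDiff_torusFlow hp).comp_contMDiffOn hc.contMDiffOn).congr fun t ht => ?_
    exact extendSquare_of_mem _ ht
  mem t := S.torusFlow_mem_fibre hp _

/-- The image of the segment from the origin to `a`. -/
noncomputable def ray (a : ℝ × ℝ) : SmoothPath (fibre H J (energyMomentum H J p)) :=
  S.pathOfLift hp (fun t => t • a) (contDiff_id.smul contDiff_const).contDiffOn

theorem isLift_ray {a n : ℝ × ℝ} (hn : n ∈ S.periods hp) :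
    IsLift Ω (fun t => t • a + n) (S.ray hp a) :=
  ⟨((contDiff_id.smul contDiff_const).add contDiff_const).contDiffOn, fun _ =>
    S.torusFlow_add_of_mem_periods hp hn _⟩

include S hp in
theorem exists_isLift (γ : SmoothPath (fibre H J (energyMomentum H J p))) :
    ∃ c, IsLift Ω c γ := by
  obtain ⟨c, hc, hcγ⟩ := S.exists_torusFlow_lift hp γ.continuous_extendPath fun t => γ.mem _
  refine ⟨c, fun t ht => ?_, fun t => (hcγ t).trans (extendPath_coe _ t)⟩
  exact S.contDiffWithinAt_lift hp ht (γ.smooth t ht) hc.continuousWithinAt fun y _ => hcγ y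

include S hp in
theorem exists_square_lift (σ : SmoothSquare (fibre H J (energyMomentum H J p))) :
    ∃ c : ℝ × ℝ → ℝ × ℝ, ContDiffOn ℝ ∞ c (Icc 0 1 ×ˢ Icc 0 1) ∧
      ∀ z : unitInterval × unitInterval, torusFlow Ω H (c (z.1, z.2)) p = σ.toFun z := by
  obtain ⟨c, hc, hcσ⟩ := S.exists_torusFlow_lift hp σ.continuous_extendSquare fun z => σ.mem _
  refine ⟨c, fun t ht => ?_, fun z => (hcσ _).trans (extendSquare_of_mem σ.toFun
    (z := (z.1, z.2)) ⟨z.1.2, z.2.2⟩)⟩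
  exact S.contDiffWithinAt_lift hp ht (σ.smooth t ht) hc.continuousWithinAt fun y _ => hcσ y

include S hp in
/-- A functional on paths that is the difference of the values of a function at the end points of
lifts vanishes on the chains that vanish in homology. -/
theorem linearCombination_eq_zero {A : Type*} [AddCommGroup A]
    {φ : SmoothPath (fibre H J (energyMomentum H J p)) → A} {N : ℝ × ℝ → A}
    (hφ : ∀ γ c, IsLift Ω c γ → φ γ = N (c 1) - N (c 0))
    {z : OneChain (fibre H J (energyMomentum H J p))} (hz : z ∈ nullChains _) :
    Finsupp.linearCombination ℤ φ z = 0 := by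
  have hle : nullChains (fibre H J (energyMomentum H J p))
      ≤ LinearMap.ker (Finsupp.linearCombination ℤ φ) := by
    refine Submodule.span_le.2 ?_
    rintro x (⟨σ, rfl⟩ | ⟨γ, hγ, rfl⟩)
    · obtain ⟨c, hc, hcσ⟩ := S.exists_square_lift hp σ
      have h1 : ∀ b : unitInterval, φ (σ.faceFst b) = N (c (1, b)) - N (c (0, b)) := fun b =>
        hφ _ (fun t => c (t, b)) ⟨hc.comp (contDiff_id.prodMk contDiff_const).contDiffOn
          fun t ht => ⟨ht, b.2⟩, fun t => hcσ (t, b)⟩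
      have h2 : ∀ b : unitInterval, φ (σ.faceSnd b) = N (c (b, 1)) - N (c (b, 0)) := fun b =>
        hφ _ (fun t => c (b, t)) ⟨hc.comp (contDiff_const.prodMk contDiff_id).contDiffOn
          fun t ht => ⟨b.2, ht⟩, fun t => hcσ (b, t)⟩
      -- The values of `N` at the four corners of the lifted square cancel in pairs.
      simp only [SetLike.mem_coe, LinearMap.mem_ker, SmoothSquare.boundary, map_add, map_sub,
        Finsupp.linearCombination_single, one_smul, h1, h2, Icc.coe_zero,
        Icc.coe_one]
      abel
    · obtain ⟨c, hc, hcγ⟩ := S.exists_isLift hp γ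
      have h1 := hφ γ (fun _ => c 0) ⟨contDiffOn_const, fun t => by
        rw [hγ t, ← hcγ 0, Icc.coe_zero]⟩
      simp only [SetLike.mem_coe, LinearMap.mem_ker, Finsupp.linearCombination_single, one_smul, h1,
        sub_self]
  exact hle hz

/-- The class of the image of a segment modulo the chains that vanish in homology. -/
noncomputable def rayClass (a : ℝ × ℝ) : OneChain (fibre H J (energyMomentum H J p)) ⧸
    nullChains (fibre H J (energyMomentum H J p)) :=
  Submodule.Quotient.mk (Finsupp.single (S.ray hp a) 1)

/-- The square `(t, s) ↦ s • c t` is the cone of the lifted path from the origin. Its faces are the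
path, the two rays to the end points of the lift, and a constant path. -/
theorem mk_single_eq {c : ℝ → ℝ × ℝ} {γ : SmoothPath (fibre H J (energyMomentum H J p))}
    (hc : IsLift Ω c γ) :
    (Submodule.Quotient.mk (Finsupp.single γ 1) :
      OneChain (fibre H J (energyMomentum H J p)) ⧸ nullChains _)
      = S.rayClass hp (c 1) - S.rayClass hp (c 0) := by
  have hsm : ContDiffOn ℝ ∞ (fun z : ℝ × ℝ => z.2 • c z.1) (Icc 0 1 ×ˢ Icc 0 1) :=
    contDiff_snd.contDiffOn.smul (hc.1.comp contDiff_fst.contDiffOn fun z hz => hz.1)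
  set σ := S.squareOfLift hp _ hsm with hσ
  have h0 : Finsupp.single (σ.faceFst 0) (1 : ℤ) ∈ nullChains (fibre H J (energyMomentum H J p)) :=
    Submodule.subset_span (Or.inr ⟨σ.faceFst 0, fun t => by
      change torusFlow Ω H (((0 : unitInterval) : ℝ) • c t) p
        = torusFlow Ω H (((0 : unitInterval) : ℝ) • c _) p
      simp, rfl⟩)
  have h1 : σ.faceFst 1 = γ := SmoothPath.eq_of_toFun_eq (by
    funext t
    change torusFlow Ω H (((1 : unitInterval) : ℝ) • c t) p = _
    rw [Icc.coe_one, one_smul, hc.2])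
  have h2 : ∀ b : unitInterval, σ.faceSnd b = S.ray hp (c b) := fun b => rfl
  have h3 : σ.boundary ∈ nullChains (fibre H J (energyMomentum H J p)) :=
    Submodule.subset_span (Or.inl ⟨σ, rfl⟩)
  rw [SmoothSquare.boundary, h1, h2, h2, Icc.coe_one, Icc.coe_zero] at h3
  have h4 := sub_mem h3 h0
  rw [rayClass, rayClass, ← Submodule.Quotient.mk_sub, eq_comm, Submodule.Quotient.eq]
  convert h4 using 1
  abel

/-- The ray of `a` is also covered by the segment from `n` to `a + n`, and its class may be computed
from either lift. So `rayClass` is additive on periods. -/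
theorem rayClass_add {n : ℝ × ℝ} (hn : n ∈ S.periods hp) (a : ℝ × ℝ) :
    S.rayClass hp (a + n) = S.rayClass hp a + S.rayClass hp n := by
  have h := S.mk_single_eq hp (S.isLift_ray hp (a := a) hn)
  simp only [one_smul, zero_smul, zero_add] at h
  change S.rayClass hp a = _ at h
  rw [h, sub_add_cancel]

theorem rayClass_zsmul_add_zsmul (m n : ℤ) :
    S.rayClass hp (m • ((0, 2 * Real.pi) : ℝ × ℝ)
        + n • ((firstReturn Ω H p, -rotationNumber Ω H p) : ℝ × ℝ))
      = m • S.rayClass hp (0, 2 * Real.pi)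
        + n • S.rayClass hp (firstReturn Ω H p, -rotationNumber Ω H p) := by
  let e : S.periods hp →+ _ := AddMonoidHom.mk' (fun n : S.periods hp => S.rayClass hp n)
    fun a b => S.rayClass_add hp b.2 a
  have h := e.map_add (m • ⟨_, S.circle_period_mem hp⟩) (n • ⟨_, S.return_period_mem hp⟩)
  rw [map_zsmul, map_zsmul] at h
  exact h

/-- The homology of a regular fibre is generated by the classes of the circle period and of the
return period. -/
theorem exists_mk_cycle_eq {z : OneChain (fibre H J (energyMomentum H J p))}
    (hz : z ∈ OneCycle (fibre H J (energyMomentum H J p))) :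
    ∃ m n : ℤ, (Submodule.Quotient.mk z :
      OneChain (fibre H J (energyMomentum H J p)) ⧸ nullChains _)
      = m • S.rayClass hp (0, 2 * Real.pi)
        + n • S.rayClass hp (firstReturn Ω H p, -rotationNumber Ω H p) := by
  choose ℓ hℓ using fun x : fibre H J (energyMomentum H J p) => S.exists_torusFlow_eq hp x.2
  let s : (fibre H J (energyMomentum H J p) →₀ ℤ) →ₗ[ℤ]
      OneChain (fibre H J (energyMomentum H J p)) ⧸ nullChains _ :=
    Finsupp.linearCombination ℤ fun x => S.rayClass hp (ℓ x)
  -- With a chosen lift `ℓ x` of every point, each path is closed up by the rays to its end points.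
  -- The corrected class differs from zero only by classes of periods, so `Ψ` takes values in `Y`;
  -- on cycles the correction vanishes.
  let Ψ : OneChain (fibre H J (energyMomentum H J p)) →ₗ[ℤ]
      OneChain (fibre H J (energyMomentum H J p)) ⧸ nullChains _ :=
    (nullChains _).mkQ - s.comp (boundaryOne _)
  set Y : Submodule ℤ (OneChain (fibre H J (energyMomentum H J p)) ⧸
    nullChains (fibre H J (energyMomentum H J p))) :=
    Submodule.span ℤ {S.rayClass hp (0, 2 * Real.pi),
      S.rayClass hp (firstReturn Ω H p, -rotationNumber Ω H p)} with hY
  have hper : ∀ n ∈ S.periods hp, S.rayClass hp n ∈ Y := by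
    intro n hn
    obtain ⟨k, l, rfl⟩ := S.exists_eq_of_mem_periods hp hn
    rw [S.rayClass_zsmul_add_zsmul hp]
    exact Submodule.mem_span_pair.2 ⟨k, l, rfl⟩
  have hpt : ∀ (a : ℝ × ℝ) (x : fibre H J (energyMomentum H J p)), torusFlow Ω H a p = x →
      S.rayClass hp a - S.rayClass hp (ℓ x) ∈ Y := by
    intro a x hax
    have hn : a - ℓ x ∈ S.periods hp := (S.torusFlow_eq_iff hp).1 (hax.trans (hℓ x).symm)
    have h1 := S.rayClass_add hp hn (ℓ x)
    rw [add_sub_cancel] at h1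
    rw [h1, add_sub_cancel_left]
    exact hper _ hn
  have hΨ : ∀ y, Ψ y ∈ Y := by
    intro y
    induction y using Finsupp.induction_linear with
    | zero => rw [map_zero]; exact zero_mem _
    | add f g hf hg => rw [map_add]; exact add_mem hf hg
    | single γ k =>
      have hk : Finsupp.single γ k = k • Finsupp.single γ (1 : ℤ) := by simp
      rw [hk, map_zsmul]
      refine Submodule.smul_mem _ _ ?_
      obtain ⟨c, hc⟩ := S.exists_isLift hp γ
      have h1 : Ψ (Finsupp.single γ 1) = (S.rayClass hp (c 1) - S.rayClass hp (c 0))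
          - (S.rayClass hp (ℓ ⟨γ.toFun 1, γ.mem 1⟩) - S.rayClass hp (ℓ ⟨γ.toFun 0, γ.mem 0⟩)) := by
        rw [← S.mk_single_eq hp hc]
        simp [Ψ, s, boundaryOne]
      rw [h1]
      have e1 := hpt (c 1) ⟨γ.toFun 1, γ.mem 1⟩ (by simpa using hc.2 1)
      have e0 := hpt (c 0) ⟨γ.toFun 0, γ.mem 0⟩ (by simpa using hc.2 0)
      convert sub_mem e1 e0 using 1
      abel
  have h2 := hΨ z
  have h3 : Ψ z = Submodule.Quotient.mk z := by
    have h4 : boundaryOne _ z = 0 := hz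
    simp [Ψ, h4]
  rw [h3] at h2
  obtain ⟨m, n, h⟩ := Submodule.mem_span_pair.1 h2
  exact ⟨m, n, h.symm⟩

end IsRegularSystem

end Chains

/-! ### The rotation form pulled back to the plane -/

section Integrals

variable {M : Type*} [TopologicalSpace M] [ChartedSpace E4 M] [MulAction Circle M]
  {Ω : SymplecticForm M} {H J : M → ℝ} [IsManifold (𝓡 4) ∞ M] [T2Space M] {M' : Set M}
  {θ : ∀ p : M, TangentSpace (𝓡 4) p →L[ℝ] ℝ}

variable (Ω H θ) in
/-- The primitive of the pull-back of the rotation form to the plane. -/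
noncomputable def planePrimitive (p : M) (a : ℝ × ℝ) : ℝ :=
  a.2 + ∫ t in (0 : ℝ)..a.1, θ (flowH Ω H p t) (hamVec Ω H (flowH Ω H p t))

namespace IsRegularSystem

variable (S : IsRegularSystem Ω H J) {p : M}
include S

/-- The rotation form along a lifted path. -/
theorem form_mfderivWithin_of_isLift (hθ : IsRotationForm Ω J M' θ)
    (hp : p ∈ goodPoints H J M') {c : ℝ → ℝ × ℝ}
    {γ : SmoothPath (fibre H J (energyMomentum H J p))} (hc : IsLift Ω c γ) {t : ℝ}
    (ht : t ∈ Icc (0 : ℝ) 1) :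
    θ (extendPath γ.toFun t)
      (mfderivWithin 𝓘(ℝ, ℝ) (𝓡 4) (extendPath γ.toFun) (Icc 0 1) t (1 : ℝ))
      = (derivWithin c (Icc 0 1) t).1
          * θ (flowH Ω H p (c t).1) (hamVec Ω H (flowH Ω H p (c t).1))
        + (derivWithin c (Icc 0 1) t).2 := by
  have heq : ∀ s ∈ Icc (0 : ℝ) 1, extendPath γ.toFun s = torusFlow Ω H (c s) p := fun s hs =>
    (extendPath_of_mem _ hs).trans (hc.2 ⟨s, hs⟩).symm
  have hcd : HasFDerivWithinAt c (fderivWithin ℝ c (Icc 0 1) t) (Icc 0 1) t :=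
    ((hc.1 t ht).differentiableWithinAt (by simp)).hasFDerivWithinAt
  have h1 := ((S.contMDiff_torusFlow hp.1 (c t)).mdifferentiableAt
    (by simp)).hasMFDerivAt.comp_hasMFDerivWithinAt t hcd.hasMFDerivWithinAt
  have h2 := h1.congr_of_eventuallyEq (f₁ := extendPath γ.toFun)
    (eventually_nhdsWithin_of_forall heq) (heq t ht)
  have h3 := h2.mfderivWithin
    ((uniqueDiffOn_Icc (zero_lt_one' ℝ)).uniqueMDiffOn t ht)
  have h4 : (mfderivWithin 𝓘(ℝ, ℝ) (𝓡 4) (extendPath γ.toFun) (Icc 0 1) t (1 : ℝ) : E4)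
      = (derivWithin c (Icc 0 1) t).1 • (hamVec Ω H (torusFlow Ω H (c t) p) : E4)
        + (derivWithin c (Icc 0 1) t).2 • (hamVec Ω J (torusFlow Ω H (c t) p) : E4) :=
    (DFunLike.congr_fun h3 (1 : ℝ)).trans
      (S.mfderiv_torusFlow hp.1 (c t) (fderivWithin ℝ c (Icc 0 1) t 1))
  -- The tangent spaces depend on the point, so equality of base points and of vectors is
  -- transported through `θ` in one substitution.
  have hgen : ∀ (x y : M) (w w' : E4), x = y → w = w' → θ x w = θ y w' := by
    rintro x _ w _ rfl rfl
    rfl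
  have hlin : ∀ (B : E4 →L[ℝ] ℝ) (k l : ℝ) (x y : E4), B (k • x + l • y) = k * B x + l * B y := by
    intro B k l x y
    simp
  refine (hgen _ _ _ _ (heq t ht) h4).trans ((hlin (θ (torusFlow Ω H (c t) p)) _ _ _ _).trans ?_)
  have hfl : flowH Ω H p (c t).1 ∈ goodPoints H J M' :=
    ⟨S.flowH_mem_regularPoints hp.1 _, by rw [S.energyMomentum_flowH hp.1]; exact hp.2⟩
  have h5 : θ (torusFlow Ω H (c t) p) (hamVec Ω H (torusFlow Ω H (c t) p))
      = θ (flowH Ω H p (c t).1) (hamVec Ω H (flowH Ω H p (c t).1)) :=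
    S.form_hamVec_smul hθ hfl _
  have h6 : θ (torusFlow Ω H (c t) p) (hamVec Ω J (torusFlow Ω H (c t) p)) = 1 :=
    hθ.normalized _ (hp.2 (S.torusFlow_mem_fibre hp.1 _))
  have h7 : ∀ x y k l z : ℝ, x = z → y = 1 → k * x + l * y = k * z + l := by
    rintro x y k l z rfl rfl
    ring
  exact h7 _ _ _ _ _ h5 h6

/-- The integral of the rotation form along a path in a regular fibre. -/
theorem pathIntegral_eq_of_isLift (hθ : IsRotationForm Ω J M' θ) (hp : p ∈ goodPoints H J M')
    {c : ℝ → ℝ × ℝ} {γ : SmoothPath (fibre H J (energyMomentum H J p))} (hc : IsLift Ω c γ) :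
    pathIntegral θ γ = planePrimitive Ω H θ p (c 1) - planePrimitive Ω H θ p (c 0) := by
  set f : ℝ → ℝ := fun t => θ (flowH Ω H p t) (hamVec Ω H (flowH Ω H p t)) with hf
  have hfc : Continuous f := S.continuous_form_hamVec_flowH hθ hp
  have hcd : ContinuousOn (derivWithin c (Icc 0 1)) (Icc 0 1) :=
    hc.1.continuousOn_derivWithin (uniqueDiffOn_Icc (zero_lt_one' ℝ)) (by simp)
  have hcc : ContinuousOn c (Icc 0 1) := hc.1.continuousOn
  have hGd : ∀ a : ℝ, HasDerivAt (fun u => ∫ t in (0 : ℝ)..u, f t) (f a) a := fun a =>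
    (hfc.integral_hasStrictDerivAt 0 a).hasDerivAt
  have hGc : Continuous (fun u => ∫ t in (0 : ℝ)..u, f t) :=
    continuous_iff_continuousAt.2 fun a => (hGd a).continuousAt
  have h1 : pathIntegral θ γ = ∫ t in (0 : ℝ)..1, ((derivWithin c (Icc 0 1) t).1 * f (c t).1
      + (derivWithin c (Icc 0 1) t).2) := by
    refine intervalIntegral.integral_congr fun t ht => ?_
    rw [uIcc_of_le zero_le_one] at ht
    exact S.form_mfderivWithin_of_isLift hθ hp hc ht
  rw [h1]
  refine intervalIntegral.integral_eq_sub_of_hasDerivAt_of_le zero_le_one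
    (f := fun t => planePrimitive Ω H θ p (c t)) ?_ ?_ ?_
  · exact (continuous_snd.comp_continuousOn hcc).add
      (hGc.comp_continuousOn (continuous_fst.comp_continuousOn hcc))
  · intro t ht
    have hd : HasDerivAt c (derivWithin c (Icc 0 1) t) t :=
      ((hc.1 t (Ioo_subset_Icc_self ht)).differentiableWithinAt
        (by simp)).hasDerivWithinAt.hasDerivAt (Icc_mem_nhds ht.1 ht.2)
    have hd2 : HasDerivAt (fun t => (c t).2) (derivWithin c (Icc 0 1) t).2 t :=
      (ContinuousLinearMap.snd ℝ ℝ ℝ).hasFDerivAt.comp_hasDerivAt t hd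
    have hd1 : HasDerivAt (fun t => (c t).1) (derivWithin c (Icc 0 1) t).1 t :=
      (ContinuousLinearMap.fst ℝ ℝ ℝ).hasFDerivAt.comp_hasDerivAt t hd
    have := hd2.add ((hGd (c t).1).comp t hd1)
    refine this.congr_deriv ?_
    ring
  · refine ContinuousOn.intervalIntegrable_of_Icc zero_le_one ?_
    exact ((continuous_fst.comp_continuousOn hcd).mul
      (hfc.comp_continuousOn (continuous_fst.comp_continuousOn hcc))).add
      (continuous_snd.comp_continuousOn hcd)

end IsRegularSystem

end Integrals

/-! ### Periods of the rotation form and bases of homology -/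

section Homology

variable {M : Type*} [TopologicalSpace M] [ChartedSpace E4 M] [MulAction Circle M]
  {Ω : SymplecticForm M} {H J : M → ℝ} [IsManifold (𝓡 4) ∞ M] [T2Space M] {M' : Set M}
  {θ : ∀ p : M, TangentSpace (𝓡 4) p →L[ℝ] ℝ}

omit [MulAction Circle M] [IsManifold (𝓡 4) ∞ M] [T2Space M] in
theorem chainIntegral_eq_linearCombination {K : Set M} (z : OneChain K) :
    chainIntegral θ z = Finsupp.linearCombination ℤ (pathIntegral (S := K) θ) z := by
  rw [chainIntegral, Finsupp.linearCombination_apply]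
  simp only [zsmul_eq_mul]

omit [MulAction Circle M] [IsManifold (𝓡 4) ∞ M] [T2Space M] in
theorem homologyClass_eq_iff {K : Set M} {z z' : OneCycle K} :
    homologyClass z = homologyClass z' ↔
      (Submodule.Quotient.mk (z : OneChain K) : OneChain K ⧸ nullChains K)
        = Submodule.Quotient.mk (z' : OneChain K) := by
  rw [homologyClass, homologyClass, Submodule.Quotient.eq, Submodule.Quotient.eq]
  rfl

namespace IsRegularSystem

variable (S : IsRegularSystem Ω H J) {p : M}

/-- The cycle of the return period. -/
noncomputable def returnCycle (hp : p ∈ regularPoints H J) :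
    OneCycle (fibre H J (energyMomentum H J p)) :=
  ⟨Finsupp.single (S.ray hp (firstReturn Ω H p, -rotationNumber Ω H p)) 1, by
    have h : (⟨(S.ray hp (firstReturn Ω H p, -rotationNumber Ω H p)).toFun 1,
        (S.ray hp _).mem 1⟩ : fibre H J (energyMomentum H J p))
        = ⟨(S.ray hp (firstReturn Ω H p, -rotationNumber Ω H p)).toFun 0, (S.ray hp _).mem 0⟩ := by
      refine Subtype.ext ?_
      change torusFlow Ω H (((1 : unitInterval) : ℝ) • _) p
        = torusFlow Ω H (((0 : unitInterval) : ℝ) • _) p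
      rw [Icc.coe_one, Icc.coe_zero, one_smul, zero_smul, S.torusFlow_zero hp]
      exact S.return_period_mem hp
    rw [LinearMap.mem_ker, boundaryOne, Finsupp.linearCombination_single, h, sub_self, smul_zero]⟩

theorem orbitPath_eq_ray (hp : p ∈ regularPoints H J) :
    orbitPath S.smooth_action (S.smul_mem_fibre (energyMomentum H J p)) ⟨p, rfl⟩
      = S.ray hp (0, 2 * Real.pi) := by
  refine SmoothPath.eq_of_toFun_eq ?_
  funext t
  change Circle.exp (2 * Real.pi * (t : ℝ)) • p
    = Circle.exp ((t : ℝ) • ((0, 2 * Real.pi) : ℝ × ℝ)).2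
      • flowH Ω H p ((t : ℝ) • ((0, 2 * Real.pi) : ℝ × ℝ)).1
  simp [S.flowH_zero hp, mul_comm]

include S in
/-- The classes of the circle period and of the return period are independent. -/
theorem eq_zero_of_rayClass (hp : p ∈ regularPoints H J) {m n : ℤ}
    (h : m • S.rayClass hp (0, 2 * Real.pi)
      + n • S.rayClass hp (firstReturn Ω H p, -rotationNumber Ω H p) = 0) : m = 0 ∧ n = 0 := by
  -- The displacement of a lift is independent of the lift and vanishes on null chains. Applied to a
  -- ray it gives the period itself, and the two generating periods are independent since `T` and
  -- `2π` are positive.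
  choose ℓ hℓ using S.exists_isLift hp
  have hφ : ∀ γ c, IsLift Ω c γ → ℓ γ 1 - ℓ γ 0 = id (c 1) - id (c 0) := fun γ c hc =>
    S.sub_eq_sub_of_torusFlow_eq hp (hℓ γ).1.continuousOn hc.1.continuousOn fun t ht =>
      ((hℓ γ).2 ⟨t, ht⟩).trans (hc.2 ⟨t, ht⟩).symm
  rw [← S.rayClass_zsmul_add_zsmul hp] at h
  have h1 := S.linearCombination_eq_zero hp hφ ((Submodule.Quotient.mk_eq_zero _).1 h)
  rw [Finsupp.linearCombination_single, one_smul,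
    hφ _ _ (S.isLift_ray hp (S.periods hp).zero_mem)] at h1
  have hT := S.firstReturn_pos hp
  simp only [id, one_smul, zero_smul, add_zero, sub_zero] at h1
  have hsum : m • ((0, 2 * Real.pi) : ℝ × ℝ)
      + n • ((firstReturn Ω H p, -rotationNumber Ω H p) : ℝ × ℝ)
      = (n * firstReturn Ω H p, m * (2 * Real.pi) - n * rotationNumber Ω H p) := by
    ext <;> simp [sub_eq_add_neg]
  rw [hsum, Prod.mk_eq_zero] at h1
  obtain ⟨h2, h3⟩ := h1
  have hn : n = 0 := by
    rcases mul_eq_zero.1 h2 with h | h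
    · exact_mod_cast h
    · exact absurd h hT.ne'
  subst hn
  simp only [Int.cast_zero, zero_mul, sub_zero] at h3
  rcases mul_eq_zero.1 h3 with h | h
  · exact ⟨by exact_mod_cast h, rfl⟩
  · exact absurd h Real.two_pi_pos.ne'

include S in
-- The integral is a difference of values of `planePrimitive` at the ends of lifts, so it depends
-- only on the class. The primitive vanishes at the origin and takes the values `2π` at `(0, 2π)`
-- and `Φ - Θ` at `(T, -Θ)`.
theorem chainIntegral_eq_of_mk_eq (hθ : IsRotationForm Ω J M' θ) (hp : p ∈ goodPoints H J M')
    {z : OneChain (fibre H J (energyMomentum H J p))} {m n : ℤ}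
    (h : (Submodule.Quotient.mk z :
      OneChain (fibre H J (energyMomentum H J p)) ⧸ nullChains _)
      = m • S.rayClass hp.1 (0, 2 * Real.pi)
        + n • S.rayClass hp.1 (firstReturn Ω H p, -rotationNumber Ω H p)) :
    chainIntegral θ z = m * (2 * Real.pi) + n * (orbitIntegral Ω H θ p - rotationNumber Ω H p) := by
  have hφ : ∀ (γ : SmoothPath (fibre H J (energyMomentum H J p))) c, IsLift Ω c γ →
      pathIntegral θ γ = planePrimitive Ω H θ p (c 1) - planePrimitive Ω H θ p (c 0) :=
    fun γ c hc => S.pathIntegral_eq_of_isLift hθ hp hc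
  have hray : ∀ a, pathIntegral θ (S.ray hp.1 a) = planePrimitive Ω H θ p a := by
    intro a
    rw [hφ _ _ (S.isLift_ray hp.1 (S.periods hp.1).zero_mem)]
    simp [planePrimitive]
  have h1 : z - (m • Finsupp.single (S.ray hp.1 (0, 2 * Real.pi)) 1
      + n • Finsupp.single (S.ray hp.1 (firstReturn Ω H p, -rotationNumber Ω H p)) 1)
      ∈ nullChains _ := by
    rw [← Submodule.Quotient.eq, h]
    rfl
  have h2 := S.linearCombination_eq_zero hp.1 hφ h1
  rw [map_sub, map_add, map_zsmul, map_zsmul, Finsupp.linearCombination_single,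
    Finsupp.linearCombination_single, one_smul, one_smul, hray, hray, sub_eq_zero] at h2
  rw [chainIntegral_eq_linearCombination, h2]
  simp only [planePrimitive, orbitIntegral, zsmul_eq_mul, intervalIntegral.integral_same]
  ring

/-- The integral of the rotation form equals the rotation number modulo `2π` if and only if the
form has a vanishing period that complements the circle orbit. -/
theorem orbitIntegral_congr_iff (hθ : IsRotationForm Ω J M' θ) (hp : p ∈ goodPoints H J M') :
    (∃ k : ℤ, orbitIntegral Ω H θ p = rotationNumber Ω H p + 2 * Real.pi * k) ↔
      ∃ δ : OneCycle (fibre H J (energyMomentum H J p)),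
        IsHomologyBasis (homologyClass (orbitCycle S.smooth_action
          (S.smul_mem_fibre (energyMomentum H J p)) ⟨p, rfl⟩)) (homologyClass δ) ∧
        chainIntegral θ (δ : OneChain (fibre H J (energyMomentum H J p))) = 0 := by
  set o := orbitCycle S.smooth_action (S.smul_mem_fibre (energyMomentum H J p)) ⟨p, rfl⟩ with ho
  set e₁ := S.rayClass hp.1 (0, 2 * Real.pi) with he₁
  set e₂ := S.rayClass hp.1 (firstReturn Ω H p, -rotationNumber Ω H p) with he₂
  have hmo : (Submodule.Quotient.mk (o : OneChain (fibre H J (energyMomentum H J p))) :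
      OneChain (fibre H J (energyMomentum H J p)) ⧸ nullChains _) = e₁ := by
    change Submodule.Quotient.mk (Finsupp.single (orbitPath S.smooth_action
      (S.smul_mem_fibre (energyMomentum H J p)) ⟨p, rfl⟩) 1) = _
    rw [S.orbitPath_eq_ray hp.1]
    rfl
  have hmr : (Submodule.Quotient.mk (S.returnCycle hp.1 :
      OneChain (fibre H J (energyMomentum H J p))) :
      OneChain (fibre H J (energyMomentum H J p)) ⧸ nullChains _) = e₂ := rfl
  have hcomb : ∀ (a b : ℤ) (z w : OneCycle (fibre H J (energyMomentum H J p))),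
      (Submodule.Quotient.mk ((a • z + b • w : OneCycle (fibre H J (energyMomentum H J p))) :
        OneChain (fibre H J (energyMomentum H J p))) :
        OneChain (fibre H J (energyMomentum H J p)) ⧸ nullChains _)
        = a • Submodule.Quotient.mk (z : OneChain _) + b • Submodule.Quotient.mk (w : OneChain _) :=
    fun a b z w => rfl
  have hclass : ∀ (a b : ℤ) (z w : OneCycle (fibre H J (energyMomentum H J p))),
      homologyClass (a • z + b • w) = a • homologyClass z + b • homologyClass w :=
    fun a b z w => rfl
  constructor
  · rintro ⟨k, hk⟩
    -- The return cycle has integral `Φ - Θ = 2πk`; subtracting `k` circle orbits removes it and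
    -- keeps a basis.
    set δ := (-k) • o + (1 : ℤ) • S.returnCycle hp.1 with hδ
    have hmδ : (Submodule.Quotient.mk (δ : OneChain (fibre H J (energyMomentum H J p))) :
        OneChain (fibre H J (energyMomentum H J p)) ⧸ nullChains _)
        = (-k) • e₁ + (1 : ℤ) • e₂ := by rw [hδ, hcomb, hmo, hmr]
    refine ⟨δ, ⟨?_, ?_⟩, ?_⟩
    · rw [LinearIndependent.pair_iff]
      intro s t hst
      rw [← hclass, show (0 : HOne (fibre H J (energyMomentum H J p))) = homologyClass 0 from rfl,
        homologyClass_eq_iff, hcomb, hmo, hmδ] at hst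
      have h0 : (s - t * k) • e₁ + t • e₂ = 0 := by
        have h1 : s • e₁ + t • ((-k) • e₁ + (1 : ℤ) • e₂) = 0 := hst
        rw [← h1]
        module
      obtain ⟨h2, h3⟩ := S.eq_zero_of_rayClass hp.1 h0
      subst h3
      exact ⟨by simpa using h2, rfl⟩
    · rw [eq_top_iff]
      rintro x -
      obtain ⟨z, rfl⟩ := Submodule.Quotient.mk_surjective _ x
      obtain ⟨m, n, hz⟩ := S.exists_mk_cycle_eq hp.1 z.2
      refine Submodule.mem_span_pair.2 ⟨m + n * k, n, ?_⟩
      rw [← hclass]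
      change _ = homologyClass z
      rw [homologyClass_eq_iff, hcomb, hmo, hmδ, hz]
      module
    · rw [S.chainIntegral_eq_of_mk_eq hθ hp hmδ, hk]
      push_cast
      ring
  · rintro ⟨δ, ⟨-, hspan⟩, hintegral⟩
    obtain ⟨m, n, hmδ⟩ := S.exists_mk_cycle_eq hp.1 δ.2
    rw [S.chainIntegral_eq_of_mk_eq hθ hp hmδ] at hintegral
    -- Only the spanning property is needed: expressing the return class through the circle class
    -- and `δ` shows that the coefficient `n` of `δ` along the return class is a unit with inverse
    -- `t`.
    have hmem : homologyClass (S.returnCycle hp.1)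
        ∈ Submodule.span ℤ {homologyClass o, homologyClass δ} := by
      rw [hspan]
      exact Submodule.mem_top
    obtain ⟨s, t, hst⟩ := Submodule.mem_span_pair.1 hmem
    rw [← hclass, homologyClass_eq_iff, hcomb, hmo, hmr, hmδ] at hst
    have h0 : (s + t * m) • e₁ + (t * n - 1) • e₂ = 0 := by
      have h1 : s • e₁ + t • (m • e₁ + n • e₂) - e₂ = 0 := sub_eq_zero.2 hst
      rw [← h1]
      module
    have h2 := (S.eq_zero_of_rayClass hp.1 h0).2
    have h3 : n * t = 1 := by linarith
    -- Multiplying `2πm + n(Φ - Θ) = 0` by `t` leaves `Φ - Θ = -2πtm`.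
    refine ⟨-(t * m), ?_⟩
    have h4 : (n : ℝ) * t = 1 := by exact_mod_cast h3
    push_cast
    linear_combination (t : ℝ) * hintegral - (orbitIntegral Ω H θ p - rotationNumber Ω H p) * h4

end IsRegularSystem

end Homology

end RotationForm

/-! ### The theorem, assembled from statements at points of the fibres -/

theorem mainTheorem4 {M : Type*} [TopologicalSpace M] [T2Space M]
    [ChartedSpace (EuclideanSpace ℝ (Fin 4)) M] [IsManifold (𝓡 4) ∞ M] [MulAction Circle M]
    (Ω : SymplecticForm M) (H J : M → ℝ) (hsys : IsCircleIntegrable Ω H J)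
    (hcompact : ∀ v ∈ regularValues H J, IsCompact (fibre H J v))
    (hconn : ∀ v ∈ regularValues H J, IsConnected (fibre H J v))
    (hfree : ∀ v ∈ regularValues H J, ∀ p ∈ fibre H J v, ∀ z : Circle, z • p = p → z = 1)
    (M' : Set M) (θ : ∀ p : M, TangentSpace (𝓡 4) p →L[ℝ] ℝ)
    (hθ : IsRotationForm Ω J M' θ) :
    -- `T`, `Θ` and `Φ` are well defined and constant on regular fibres
    (∀ v ∈ regularValues H J, ∀ p ∈ fibre H J v,
      IsMIntegralCurve (I := 𝓡 4) (flowH Ω H p) (hamVec Ω H) ∧ flowH Ω H p 0 = p ∧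
      IsLeast (returnTimes Ω H p) (firstReturn Ω H p) ∧
      IsLeast (rotationTimes Ω H p) (rotationNumber Ω H p) ∧
      rotationNumber Ω H p < 2 * Real.pi ∧
      firstReturn Ω H p = onValues H J (firstReturn Ω H) v ∧
      rotationNumber Ω H p = onValues H J (rotationNumber Ω H) v ∧
      (fibre H J v ⊆ M' → orbitIntegral Ω H θ p = onValues H J (orbitIntegral Ω H θ) v)) ∧
    -- (a)
    ((∀ p ∈ M'ᶜ, (∃ z : Circle, z • p ≠ p) → IsSmoothSurfaceAt M'ᶜ p) →
      ∀ Γ : ℝ → ℝ × ℝ, ContDiff ℝ 1 Γ → Function.Periodic Γ (2 * Real.pi) →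
        (∀ s, Γ s ∈ regularValues H J) → IsTransversalToImage H J M'ᶜ Γ →
        {s | s ∈ Ico 0 (2 * Real.pi) ∧ ¬ fibre H J (Γ s) ⊆ M'}.Finite ∧
        (∀ s, fibre H J (Γ s) ⊆ M' →
          ContinuousAt (fun r => onValues H J (orbitIntegral Ω H θ) (Γ r)) s) ∧
        ∃ c : ℝ, HasVariation (fun s => onValues H J (orbitIntegral Ω H θ) (Γ s)) c ∧
          ((discontinuities fun s => onValues H J (rotationNumber Ω H) (Γ s)).Finite →
            HasVariation (fun s => onValues H J (rotationNumber Ω H) (Γ s)) c)) ∧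
    -- (b)
    (∀ v ∈ regularValues H J, fibre H J v ⊆ M' → ∀ p : fibre H J v,
      ((∃ k : ℤ, onValues H J (orbitIntegral Ω H θ) v
          = onValues H J (rotationNumber Ω H) v + 2 * Real.pi * k) ↔
        ∃ δ : OneCycle (fibre H J v),
          IsHomologyBasis (homologyClass (orbitCycle hsys.smooth_action (hsys.smul_mem_fibre v) p))
            (homologyClass δ) ∧
          chainIntegral θ (δ : OneChain (fibre H J v)) = 0)) := by
  have S : IsRegularSystem Ω H J := ⟨hsys, hcompact, hconn, hfree⟩
  refine ⟨?_, ?_, ?_⟩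
  · intro v hv p hp
    have hpv : energyMomentum H J p = v := hp
    subst hpv
    have hpr : p ∈ regularPoints H J := hv
    exact ⟨S.isMIntegralCurve_flowH hpr, S.flowH_zero hpr, S.isLeast_firstReturn hpr,
      S.isLeast_rotationNumber hpr, S.rotationNumber_lt hpr, (S.onValues_firstReturn hpr).symm,
      (S.onValues_rotationNumber hpr).symm,
      fun hM => (S.onValues_orbitIntegral hθ ⟨hpr, hM⟩).symm⟩
  · intro hsurf Γ hΓ hper hΓr htr
    exact S.variation_along_path hθ hsurf (hΓ.differentiable (by simp)) hper hΓr htr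
  · rintro v hv hM ⟨p, hp⟩
    have hpv : energyMomentum H J p = v := hp
    subst hpv
    have hpg : p ∈ goodPoints H J M' := ⟨hv, hM⟩
    rw [S.onValues_orbitIntegral hθ hpg, S.onValues_rotationNumber hpg.1]
    exact S.orbitIntegral_congr_iff hθ hpg
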